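/- Let $h\in\mathbb C$, $h\ne 0$, let $I$ be an ordered index set with two distinct elements called $0$ and $1$, and let $H_I$ be the complex unital algebra with generators $x_i,y_i$ ($i\in I$) and relations $x_iy_i=y_ix_i+hy_i^2$ and, for $i<j$, $$x_jy_i=y_ix_j+hy_iy_j,\quad y_jx_i=x_iy_j-hy_iy_j,\quad y_jy_i=y_iy_j,\quad x_jx_i=x_ix_j-hx_iy_j+hy_ix_j+h^2y_iy_j .$$ Write $x=x_0$, $y=y_0$. The operators $E,F,H$ of $U_h(sl(2))$ act linearly on $H_I$ by $Ex_i=0$, $Ey_i=x_i$, $Fx_i=y_i$, $Fy_i=0$, $Hx_i=x_i$, $Hy_i=-y_i$, $E1=F1=H1=0$ and $F(ab)=F(a)b+aF(b)$, $E(ab)=E(a)e^{-hF}(b)+e^{hF}(a)E(b)$, $H(ab)=H(a)e^{-hF}(b)+e^{hF}(a)H(b)$; an element is invariant if $E,F,H$ annihilate it. For $S\subseteq I$ let $H_S$ be the subalgebra generated by the $x_i,y_i$ with $i\in S$. The algebra $H_I$ has a right quotient division ring $Q_I$ (a skew field containing $H_I$, all of whose elements are of the form $ab^{-1}$ with $a,b\in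 H_I$, $b\neq0$); let $Q_S$ be the skew subfield generated by $H_S$, and $Q_S^{Inv}$ its set of invariant elements for the extension of the action to $Q_I$. Let $f$ be a binary $n$-form with coefficients in $H_{I\setminus\{0,1\}}$, that is, a nonzero invariant element $f=\sum_{i=0}^n\binom ni x^{n-i}y^iA_i$ of $H_I$ with $A_i\in H_{I\setminus\{0,1\}}$. Let $P_{01}=\frac1d\Delta_{01}$ on elements homogeneous of degree $d\ge 1$ in the index $0$, where $\Delta_{01}$ is the derivation of $H_I$ with $x_0\mapsto x_1$, $y_0\mapsto y_1$ that annihilates the other generators. Put $f_1=P_{01}^nf$, $\xi=P_{01}^{n-1}f$ (if $n\ge1$) and $\eta=(01)=xy_1-yx_1-hyy_1$. Then there are a skew field $Q_I^\Sigma=Q_I[\sigma_1,\dots,\sigma_n]\supseteq Q_I$ generated as a ring by $Q_I$ and central elements $\sigma_1,\dots,\sigma_n$, an extension of the action of $U_h(sl(2))$ to $Q_I^\Sigma$ (operators $E,F,H$ and an algebra automorphism extending $e^{hF}$, with the above product rules) for which the $\sigma_i$ are invariant, where the coefficients of $\prod_{i=1}^n(T-\sigma_i)$ lie in $Q^{Inv}_{I\setminus\{0\}}$,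 and elements $X_i,Y_i\in Q_{I\setminus\{0\}}^\Sigma:=Q_{I\setminus\{0\}}[\sigma_1,\dots,\sigma_n]$ such that $$f=C\prod_{i=1}^n\,(xY_i-yX_i-hyY_i),\qquad C=f_1^{1-n}\in Q^{Inv}_{I\setminus\{0\}},$$ where the linear forms $xY_i-yX_i-hyY_i=\xi-\sigma_i\eta$ commute with each other and are invariant. -/

import Mathlib

open Polynomial

universe u

namespace NCForm

/-! ### The algebra of noncommutative homogeneous coordinates -/

section Algebra

variable (h : ℂ) (I : Type u) [LinearOrder I]

/-- The free generators `x i` of the free algebra. -/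
def freeX {I : Type u} (i : I) : FreeAlgebra ℂ (I ⊕ I) := FreeAlgebra.ι ℂ (Sum.inl i)

/-- The free generators `y i` of the free algebra. -/
def freeY {I : Type u} (i : I) : FreeAlgebra ℂ (I ⊕ I) := FreeAlgebra.ι ℂ (Sum.inr i)

/-- The defining relations of the coordinate algebra. -/
inductive Rel : FreeAlgebra ℂ (I ⊕ I) → FreeAlgebra ℂ (I ⊕ I) → Prop
  | xy_self (i : I) :
      Rel (freeX i * freeY i) (freeY i * freeX i + h • (freeY i * freeY i))
  | xy (i j : I) (hij : i < j) :
      Rel (freeX j * freeY i) (freeY i * freeX j + h • (freeY i * freeY j))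
  | yx (i j : I) (hij : i < j) :
      Rel (freeY j * freeX i) (freeX i * freeY j - h • (freeY i * freeY j))
  | yy (i j : I) (hij : i < j) :
      Rel (freeY j * freeY i) (freeY i * freeY j)
  | xx (i j : I) (hij : i < j) :
      Rel (freeX j * freeX i)
        (freeX i * freeX j - h • (freeX i * freeY j) + h • (freeY i * freeX j)
          + h ^ 2 • (freeY i * freeY j))

/-- The complex unital algebra `H_I` with generators `x i`, `y i` for `i ∈ I`. -/
def HAlg : Type u := RingQuot (Rel h I)

instance : Ring (HAlg h I) := inferInstanceAs (Ring (RingQuot (Rel h I)))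

instance : Algebra ℂ (HAlg h I) := inferInstanceAs (Algebra ℂ (RingQuot (Rel h I)))

/-- The quotient map from the free algebra. -/
def mk : FreeAlgebra ℂ (I ⊕ I) →ₐ[ℂ] HAlg h I := RingQuot.mkAlgHom ℂ (Rel h I)

theorem mk_rel {a b : FreeAlgebra ℂ (I ⊕ I)} (hab : Rel h I a b) : mk h I a = mk h I b :=
  RingQuot.mkAlgHom_rel ℂ hab

theorem mk_surjective : Function.Surjective (mk h I) :=
  RingQuot.mkAlgHom_surjective ℂ (Rel h I)

variable {I}

/-- The generator `x i` of `H_I`. -/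
def x (i : I) : HAlg h I := mk h I (freeX i)

/-- The generator `y i` of `H_I`. -/
def y (i : I) : HAlg h I := mk h I (freeY i)

theorem y_comm (i j : I) : y h j * y h i = y h i * y h j := by
  have key : ∀ i j : I, i < j → y h j * y h i = y h i * y h j := fun i j hij => by
    simpa [x, y] using mk_rel h I (Rel.yy (h := h) i j hij)
  rcases lt_trichotomy i j with hij | rfl | hij
  · exact key i j hij
  · rfl
  · exact (key j i hij).symm

/-- The mixed relation holds for all pairs of indices. -/
theorem x_mul_y (i j : I) :
    x h i * y h j = y h j * x h i + h • (y h i * y h j) := by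
  rcases lt_trichotomy i j with hij | rfl | hij
  · have e : y h j * x h i = x h i * y h j - h • (y h i * y h j) := by
      simpa [x, y] using mk_rel h I (Rel.yx (h := h) i j hij)
    rw [e]; abel
  · simpa [x, y] using mk_rel h I (Rel.xy_self (h := h) i)
  · have e : x h i * y h j = y h j * x h i + h • (y h j * y h i) := by
      simpa [x, y] using mk_rel h I (Rel.xy (h := h) j i hij)
    rw [e, y_comm h i j]

/-- The relation between two `x` generators holds for all pairs of indices. -/
theorem x_mul_x (i j : I) :
    x h j * x h i = x h i * x h j - h • (x h i * y h j) + h • (y h i * x h j)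
      + h ^ 2 • (y h i * y h j) := by
  have key : ∀ i j : I, i < j →
      x h j * x h i = x h i * x h j - h • (x h i * y h j) + h • (y h i * x h j)
        + h ^ 2 • (y h i * y h j) := fun i j hij => by
    simpa [x, y] using mk_rel h I (Rel.xx (h := h) i j hij)
  rcases lt_trichotomy i j with hij | rfl | hij
  · exact key i j hij
  · rw [x_mul_y h i i]; module
  · rw [key j i hij, x_mul_y h i j, x_mul_y h j i, y_comm h i j]
    simp only [smul_add, smul_smul, ← sq]
    abel

theorem liftH_aux
    {B : Type*} [Ring B] [Algebra ℂ B] (X Y : I → B)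
    (hyy : ∀ i j, Y j * Y i = Y i * Y j)
    (hxy : ∀ i j, X i * Y j = Y j * X i + h • (Y i * Y j))
    (hxx : ∀ i j, X j * X i = X i * X j - h • (X i * Y j) + h • (Y i * X j)
      + h ^ 2 • (Y i * Y j)) :
    ∀ ⦃a b : FreeAlgebra ℂ (I ⊕ I)⦄, Rel h I a b →
    FreeAlgebra.lift ℂ (Sum.elim X Y) a = FreeAlgebra.lift ℂ (Sum.elim X Y) b := by
  intro a b hab
  cases hab with
  | xy_self i => simpa [freeX, freeY] using hxy i i
  | xy i j _ => simpa [freeX, freeY, hyy i j] using hxy j i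
  | yx i j _ => simp [freeX, freeY, hxy i j]
  | yy i j _ => simpa [freeX, freeY] using hyy i j
  | xx i j _ => simpa [freeX, freeY] using hxx i j

/-- The universal property: elements satisfying the relations define a homomorphism. -/
def liftH
    {B : Type*} [Ring B] [Algebra ℂ B] (X Y : I → B)
    (hyy : ∀ i j, Y j * Y i = Y i * Y j)
    (hxy : ∀ i j, X i * Y j = Y j * X i + h • (Y i * Y j))
    (hxx : ∀ i j, X j * X i = X i * X j - h • (X i * Y j) + h • (Y i * X j)
      + h ^ 2 • (Y i * Y j)) :
    HAlg h I →ₐ[ℂ] B :=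
  RingQuot.liftAlgHom ℂ ⟨FreeAlgebra.lift ℂ (Sum.elim X Y), liftH_aux h X Y hyy hxy hxx⟩

@[simp] theorem liftH_x
    {B : Type*} [Ring B] [Algebra ℂ B] (X Y : I → B)
    (hyy : ∀ i j, Y j * Y i = Y i * Y j)
    (hxy : ∀ i j, X i * Y j = Y j * X i + h • (Y i * Y j))
    (hxx : ∀ i j, X j * X i = X i * X j - h • (X i * Y j) + h • (Y i * X j)
      + h ^ 2 • (Y i * Y j)) (i : I) :
    liftH h X Y hyy hxy hxx (x h i) = X i := by
  have := RingQuot.liftAlgHom_mkAlgHom_apply ℂ (s := Rel h I) (FreeAlgebra.lift ℂ (Sum.elim X Y))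
    (liftH_aux h X Y hyy hxy hxx) (freeX i)
  exact this.trans (by simp [freeX])

@[simp] theorem liftH_y
    {B : Type*} [Ring B] [Algebra ℂ B] (X Y : I → B)
    (hyy : ∀ i j, Y j * Y i = Y i * Y j)
    (hxy : ∀ i j, X i * Y j = Y j * X i + h • (Y i * Y j))
    (hxx : ∀ i j, X j * X i = X i * X j - h • (X i * Y j) + h • (Y i * X j)
      + h ^ 2 • (Y i * Y j)) (i : I) :
    liftH h X Y hyy hxy hxx (y h i) = Y i := by
  have := RingQuot.liftAlgHom_mkAlgHom_apply ℂ (s := Rel h I) (FreeAlgebra.lift ℂ (Sum.elim X Y))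
    (liftH_aux h X Y hyy hxy hxx) (freeY i)
  exact this.trans (by simp [freeY])
/-- Induction over the generators. -/
theorem induction_on {P : HAlg h I → Prop} (hc : ∀ c : ℂ, P (algebraMap ℂ _ c))
    (hx : ∀ i, P (x h i)) (hy : ∀ i, P (y h i))
    (hadd : ∀ a b, P a → P b → P (a + b)) (hmul : ∀ a b, P a → P b → P (a * b))
    (a : HAlg h I) : P a := by
  obtain ⟨a, rfl⟩ := mk_surjective h I a
  induction a using FreeAlgebra.induction with
  | grade0 c => simpa using hc c
  | grade1 g =>
    rcases g with i | i
    · exact hx i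
    · exact hy i
  | mul a b ha hb => simpa using hmul _ _ ha hb
  | add a b ha hb => simpa using hadd _ _ ha hb

/-- The subalgebra `H_S` of `H_I` generated by the `x i`, `y i` with `i ∈ S`. -/
def subH (S : Set I) : Subalgebra ℂ (HAlg h I) :=
  Algebra.adjoin ℂ (x h '' S ∪ y h '' S)

end Algebra

/-! ### The action of the quantum group -/

section Action

variable (h : ℂ) {I : Type u} [LinearOrder I]

/-- `shift h c` is the operator `e ^ (c F)`, where `F` is the locally nilpotent derivation with
`F x i = y i`, `F y i = 0`; see `shift_eq_sum`. It is an algebra endomorphism. -/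
def shift (c : ℂ) : HAlg h I →ₐ[ℂ] HAlg h I :=
  liftH h (fun i => x h i + c • y h i) (fun i => y h i)
    (fun i j => y_comm h i j)
    (fun i j => by
      simp only [add_mul, mul_add, smul_mul_assoc, mul_smul_comm, x_mul_y h i j, y_comm h i j]
      abel)
    (fun i j => by
      simp only [add_mul, mul_add, smul_mul_assoc, mul_smul_comm, x_mul_x h i j,
        x_mul_y h i j, x_mul_y h j i, y_comm h i j, smul_add, smul_smul]
      module)

@[simp] theorem shift_x (c : ℂ) (i : I) : shift h c (x h i) = x h i + c • y h i := by
  simp [shift]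

@[simp] theorem shift_y (c : ℂ) (i : I) : shift h c (y h i) = y h i := by
  simp [shift]

@[simp] theorem shift_zero (a : HAlg h I) : shift h 0 a = a := by
  induction a using induction_on with
  | hc c => simp
  | hx i => simp
  | hy i => simp
  | hadd a b ha hb => simp [ha, hb]
  | hmul a b ha hb => simp [ha, hb]

section Skew

variable (c : ℂ) (DX DY : I → HAlg h I)
  (hyy : ∀ i j, DY j * y h i + y h j * DY i = DY i * y h j + y h i * DY j)
  (hxy : ∀ i j, DX i * y h j + (x h i + c • y h i) * DY j =
    DY j * (x h i - c • y h i) + y h j * DX i + h • (DY i * y h j + y h i * DY j))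
  (hxx : ∀ i j, DX j * (x h i - c • y h i) + (x h j + c • y h j) * DX i =
    DX i * (x h j - c • y h j) + (x h i + c • y h i) * DX j
    - h • (DX i * y h j + (x h i + c • y h i) * DY j)
    + h • (DY i * (x h j - c • y h j) + y h i * DX j)
    + h ^ 2 • (DY i * y h j + y h i * DY j))

/-- The homomorphism `a ↦ (e^{cF} a, D a; 0, e^{-cF} a)` into upper triangular matrices that
encodes a skew derivation `D` with prescribed values on the generators. -/
def skewHom : HAlg h I →ₐ[ℂ] Matrix (Fin 2) (Fin 2) (HAlg h I) :=
  liftH h (fun i => !![x h i + c • y h i, DX i; 0, x h i - c • y h i])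
    (fun i => !![y h i, DY i; 0, y h i])
    (fun i j => by
      have e1 := y_comm h i j
      have e2 := hyy i j
      rw [← sub_eq_zero] at e2
      ext a b
      fin_cases a <;> fin_cases b <;> simp [Matrix.mul_apply, Fin.sum_univ_two, e1]
      rw [← sub_eq_zero, ← e2]
      abel)
    (fun i j => by
      have e1 := y_comm h i j
      have e2 := hxy i j
      have e3 := x_mul_y h i j
      rw [← sub_eq_zero] at e2
      ext a b
      fin_cases a <;> fin_cases b <;> simp [Matrix.mul_apply, Fin.sum_univ_two]
      · simp only [add_mul, mul_add, smul_mul_assoc, mul_smul_comm, e1, e3]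
        module
      · rw [← sub_eq_zero, ← e2]
        module
      · simp only [sub_mul, mul_sub, smul_mul_assoc, mul_smul_comm, e1, e3]
        module)
    (fun i j => by
      have e1 := y_comm h i j
      have e2 := hxx i j
      have e3 := x_mul_y h i j
      have e4 := x_mul_y h j i
      have e5 := x_mul_x h i j
      rw [← sub_eq_zero] at e2
      ext a b
      fin_cases a <;> fin_cases b <;> simp [Matrix.mul_apply, Fin.sum_univ_two]
      · simp only [add_mul, mul_add, smul_mul_assoc, mul_smul_comm, e1, e3, e4, e5]
        module
      · rw [← sub_eq_zero, ← e2]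
        module
      · simp only [sub_mul, mul_sub, smul_mul_assoc, mul_smul_comm, e1, e3, e4, e5]
        module)

/-- The linear map `D` with `D (a * b) = D a * e^{-cF} b + e^{cF} a * D b` (see `skewDer_mul`),
`D (x i) = DX i` and `D (y i) = DY i`. -/
def skewDer : HAlg h I →ₗ[ℂ] HAlg h I where
  toFun a := skewHom h c DX DY hyy hxy hxx a 0 1
  map_add' a b := by simp
  map_smul' r a := by simp

@[simp] theorem skewDer_x (i : I) : skewDer h c DX DY hyy hxy hxx (x h i) = DX i := by
  simp [skewDer, skewHom]

@[simp] theorem skewDer_y (i : I) : skewDer h c DX DY hyy hxy hxx (y h i) = DY i := by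
  simp [skewDer, skewHom]

theorem skewHom_apply (a : HAlg h I) :
    skewHom h c DX DY hyy hxy hxx a 0 0 = shift h c a ∧
    skewHom h c DX DY hyy hxy hxx a 1 0 = 0 ∧
    skewHom h c DX DY hyy hxy hxx a 1 1 = shift h (-c) a := by
  induction a using induction_on with
  | hc r => simp [Matrix.algebraMap_matrix_apply]
  | hx i => simp [skewHom, sub_eq_add_neg]
  | hy i => simp [skewHom]
  | hadd a b ha hb => simp [ha.1, ha.2.1, ha.2.2, hb.1, hb.2.1, hb.2.2]
  | hmul a b ha hb =>
    simp [Matrix.mul_apply, Fin.sum_univ_two, ha.1, ha.2.1, ha.2.2, hb.1, hb.2.1, hb.2.2]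

theorem skewDer_mul (a b : HAlg h I) :
    skewDer h c DX DY hyy hxy hxx (a * b) =
      skewDer h c DX DY hyy hxy hxx a * shift h (-c) b +
        shift h c a * skewDer h c DX DY hyy hxy hxx b := by
  have ha := (skewHom_apply h c DX DY hyy hxy hxx a).1
  have hb := (skewHom_apply h c DX DY hyy hxy hxx b).2.2
  simp only [skewDer, LinearMap.coe_mk, AddHom.coe_mk, map_mul, Matrix.mul_apply,
    Fin.sum_univ_two, ha, hb]
  abel

@[simp] theorem skewDer_one : skewDer h c DX DY hyy hxy hxx 1 = 0 := by
  simp [skewDer]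

end Skew

/-- The action of the generator `F`: the derivation with `F x i = y i` and `F y i = 0`. -/
def opF : HAlg h I →ₗ[ℂ] HAlg h I :=
  skewDer h 0 (fun i => y h i) (fun _ => 0) (by simp)
    (fun i j => by simp [y_comm h i j])
    (fun i j => by
      simp [x_mul_y h i j, x_mul_y h j i, y_comm h i j]
      module)

/-- The action of the generator `E`: `E x i = 0`, `E y i = x i` and
`E (a * b) = E a * e^{-hF} b + e^{hF} a * E b`. -/
def opE : HAlg h I →ₗ[ℂ] HAlg h I :=
  skewDer h h (fun _ => 0) (fun i => x h i)
    (fun i j => by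
      simp [x_mul_y h i j, x_mul_y h j i, y_comm h i j]
      module)
    (fun i j => by
      simp only [zero_mul, mul_zero, add_mul, mul_sub, smul_mul_assoc, mul_smul_comm,
        x_mul_y h i j, x_mul_y h j i, y_comm h i j, x_mul_x h i j]
      module)
    (fun i j => by
      simp only [zero_mul, mul_zero, add_mul, mul_sub, smul_mul_assoc, mul_smul_comm,
        x_mul_y h i j]
      module)

/-- The action of the generator `H`: `H x i = x i`, `H y i = - y i` and
`H (a * b) = H a * e^{-hF} b + e^{hF} a * H b`. -/
def opH : HAlg h I →ₗ[ℂ] HAlg h I :=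
  skewDer h h (fun i => x h i) (fun i => - y h i)
    (fun i j => by simp [y_comm h i j])
    (fun i j => by
      simp only [add_mul, mul_sub, smul_mul_assoc, mul_smul_comm, mul_neg, neg_mul,
        y_comm h i j, x_mul_y h i j]
      module)
    (fun i j => by
      simp only [add_mul, mul_sub, smul_mul_assoc, mul_smul_comm, mul_neg, neg_mul,
        x_mul_y h i j, x_mul_y h j i, y_comm h i j, x_mul_x h i j]
      module)

@[simp] theorem opF_x (i : I) : opF h (x h i) = y h i := by simp [opF]
@[simp] theorem opF_y (i : I) : opF h (y h i) = 0 := by simp [opF]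
@[simp] theorem opE_x (i : I) : opE h (x h i) = 0 := by simp [opE]
@[simp] theorem opE_y (i : I) : opE h (y h i) = x h i := by simp [opE]
@[simp] theorem opH_x (i : I) : opH h (x h i) = x h i := by simp [opH]
@[simp] theorem opH_y (i : I) : opH h (y h i) = - y h i := by simp [opH]

theorem opF_mul (a b : HAlg h I) : opF h (a * b) = opF h a * b + a * opF h b := by
  simp [opF, skewDer_mul]

theorem opE_mul (a b : HAlg h I) :
    opE h (a * b) = opE h a * shift h (-h) b + shift h h a * opE h b := by
  simp [opE, skewDer_mul]

theorem opH_mul (a b : HAlg h I) :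
    opH h (a * b) = opH h a * shift h (-h) b + shift h h a * opH h b := by
  simp [opH, skewDer_mul]

/-- Invariant elements of `H_I`. -/
def IsInvariant (v : HAlg h I) : Prop := opE h v = 0 ∧ opF h v = 0 ∧ opH h v = 0

/-- The polarization operator `Δ_{kl}`: the derivation with `x k ↦ x l`, `y k ↦ y l` that
annihilates the other generators. -/
def polarize (k l : I) : HAlg h I →ₗ[ℂ] HAlg h I :=
  skewDer h 0 (fun i => if i = k then x h l else 0) (fun i => if i = k then y h l else 0)
    (fun i j => by
      have e1 := y_comm h i l
      have e2 := y_comm h j l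
      by_cases hi : i = k <;> by_cases hj : j = k <;> simp [hi, hj] <;> simp_all)
    (fun i j => by
      have e1 := x_mul_y h i l
      have e2 := x_mul_y h l j
      by_cases hi : i = k <;> by_cases hj : j = k <;> simp [hi, hj] <;> simp_all
      abel)
    (fun i j => by
      have e1 := x_mul_x h i l
      have e2 := x_mul_x h l j
      by_cases hi : i = k <;> by_cases hj : j = k <;> simp only [hi, hj, if_true, if_false]
      · simp [x_mul_y h l k, x_mul_y h k l, y_comm h k l]
        module
      · simpa using e2
      · simpa using e1
      · simp)

theorem polarize_x (k l i : I) :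
    polarize h k l (x h i) = if i = k then x h l else 0 := by simp [polarize]

theorem polarize_y (k l i : I) :
    polarize h k l (y h i) = if i = k then y h l else 0 := by simp [polarize]

theorem polarize_mul (k l : I) (a b : HAlg h I) :
    polarize h k l (a * b) = polarize h k l a * b + a * polarize h k l b := by
  simp [polarize, skewDer_mul]

/-- The bracket symbol `(i j)`. -/
def bracket (i j : I) : HAlg h I :=
  x h i * y h j - y h i * x h j - h • (y h i * y h j)

/-- `polar h k l d m a` is `P_{kl}^m a` for an element `a` that is homogeneous of degree `d` with
respect to the index `k`, where the operator `P_{kl}` acts as `(1 / d) Δ_{kl}` on such elements.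
Each application lowers the degree with respect to `k` by one. -/
noncomputable def polar (k l : I) : ℕ → ℕ → HAlg h I → HAlg h I
  | _, 0, a => a
  | d, m + 1, a => polar k l (d - 1) m ((1 / (d : ℂ)) • polarize h k l a)

/-- The homomorphism `a ↦ e^{TF} a` into polynomials in `T`. -/
noncomputable def shiftPoly : HAlg h I →ₐ[ℂ] (HAlg h I)[X] :=
  liftH h (fun i => monomial 0 (x h i) + monomial 1 (y h i)) (fun i => monomial 0 (y h i))
    (fun i j => by simp only [monomial_mul_monomial, y_comm h i j])
    (fun i j => by
      simp only [add_mul, mul_add, monomial_mul_monomial, x_mul_y h i j, y_comm h i j, map_add,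
        ← smul_monomial]
      abel)
    (fun i j => by
      simp only [add_mul, mul_add, monomial_mul_monomial, x_mul_x h i j, x_mul_y h i j,
        x_mul_y h j i, y_comm h i j, map_add, map_sub, ← smul_monomial, add_zero, zero_add]
      module)

theorem derivative_shiftPoly (a : HAlg h I) :
    derivative (shiftPoly h a) = shiftPoly h (opF h a) := by
  induction a using induction_on with
  | hc c => simp [opF, skewDer, Matrix.algebraMap_matrix_apply, Polynomial.algebraMap_apply]
  | hx i => simp [shiftPoly]
  | hy i => simp [shiftPoly]
  | hadd a b ha hb => simp [ha, hb]
  | hmul a b ha hb => simp [ha, hb, opF_mul]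

theorem coeff_zero_shiftPoly (a : HAlg h I) : (shiftPoly h a).coeff 0 = a := by
  induction a using induction_on with
  | hc c => simp [Polynomial.algebraMap_apply]
  | hx i => simp [shiftPoly, coeff_monomial]
  | hy i => simp [shiftPoly]
  | hadd a b ha hb => simp [ha, hb]
  | hmul a b ha hb => simp [mul_coeff_zero, ha, hb]

theorem factorial_coeff_shiftPoly (k : ℕ) (a : HAlg h I) :
    (k.factorial : ℂ) • (shiftPoly h a).coeff k = (opF h)^[k] a := by
  induction k generalizing a with
  | zero => simp [coeff_zero_shiftPoly]
  | succ k ih =>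
    rw [Function.iterate_succ_apply, ← ih, ← derivative_shiftPoly, coeff_derivative,
      Nat.factorial_succ]
    push_cast
    rw [mul_comm ((k : ℂ) + 1), mul_smul]
    congr 1
    rw [Algebra.smul_def, ← Nat.cast_succ, ← Nat.cast_succ, map_natCast]
    exact (Nat.cast_commute _ _).eq

theorem eval_shiftPoly (c : ℂ) (a : HAlg h I) :
    (shiftPoly h a).eval (algebraMap ℂ _ c) = shift h c a := by
  induction a using induction_on with
  | hc r => simp [Polynomial.algebraMap_apply]
  | hx i => simp [shiftPoly, eval_monomial, ← Algebra.commutes, Algebra.smul_def]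
  | hy i => simp [shiftPoly]
  | hadd a b ha hb => simp [ha, hb]
  | hmul a b ha hb =>
    rw [map_mul, eval, eval₂_mul_noncomm _ _ fun k => (Algebra.commutes c _).symm, ← eval, ← eval,
      ha, hb, map_mul]

/-- `shift h c` is the exponential of `c F`; the series is finite on every element. -/
theorem shift_eq_sum (a : HAlg h I) :
    ∃ N : ℕ, ∀ c : ℂ, ∀ m ≥ N,
      shift h c a = ∑ k ∈ Finset.range m, (c ^ k / (k.factorial : ℂ)) • (opF h)^[k] a := by
  refine ⟨(shiftPoly h a).natDegree + 1, fun c m hm => ?_⟩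
  rw [← eval_shiftPoly, eval_eq_sum_range' (by omega : (shiftPoly h a).natDegree < m)]
  refine Finset.sum_congr rfl fun k _ => ?_
  rw [← factorial_coeff_shiftPoly, smul_smul, div_mul_cancel₀ _ (by exact_mod_cast k.factorial_ne_zero), ← map_pow,
    ← Algebra.commutes, Algebra.smul_def]

end Action

/-! ### Forms, quotient division rings and extensions -/

section Forms

variable (h : ℂ) {I : Type u} [LinearOrder I]

/-- `f` is a binary `n`-form in the variables `x o`, `y o` with coefficients in `H_S`: a nonzero
invariant element `∑ (n choose i) x^(n-i) y^i A_i` with all `A_i ∈ H_S`. -/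
structure IsForm (o : I) (S : Set I) (n : ℕ) (f : HAlg h I) : Prop where
  ne_zero : f ≠ 0
  invariant : IsInvariant h f
  exists_coeff : ∃ A : ℕ → HAlg h I, (∀ i, A i ∈ subH h S) ∧
    f = ∑ i ∈ Finset.range (n + 1), n.choose i • (x h o ^ (n - i) * y h o ^ i * A i)

/-- `ι` exhibits `Q` as the right quotient division ring of `R`. -/
structure IsRightQuotientDivisionRing {R Q : Type*} [Ring R] [Algebra ℂ R] [DivisionRing Q]
    [Algebra ℂ Q] (ι : R →ₐ[ℂ] Q) : Prop where
  injective : Function.Injective ι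
  exists_eq : ∀ q : Q, ∃ a b : R, b ≠ 0 ∧ q = ι a * (ι b)⁻¹

variable {h} {K : Type*} [DivisionRing K] [Algebra ℂ K]

/-- An extension of the action of the quantum group from `H_I` to a skew field `K` containing it:
`τ` extends `e^{hF}`, and `E`, `F`, `H` extend the operators on `H_I` and satisfy the same
product rules. These data are determined by their values on generators of the skew field `K`. -/
structure ExtendedAction (ι : HAlg h I →ₐ[ℂ] K) where
  τ : K ≃ₐ[ℂ] K
  E : K →ₗ[ℂ] K
  F : K →ₗ[ℂ] K
  H : K →ₗ[ℂ] K
  τ_apply : ∀ a, τ (ι a) = ι (shift h h a)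
  E_apply : ∀ a, E (ι a) = ι (opE h a)
  F_apply : ∀ a, F (ι a) = ι (opF h a)
  H_apply : ∀ a, H (ι a) = ι (opH h a)
  E_mul : ∀ a b, E (a * b) = E a * τ.symm b + τ a * E b
  F_mul : ∀ a b, F (a * b) = F a * b + a * F b
  H_mul : ∀ a b, H (a * b) = H a * τ.symm b + τ a * H b

/-- Elements of `K` that are invariant under the extended action (`e^{hF}` acts by its counit). -/
def ExtendedAction.IsInvariant {ι : HAlg h I →ₐ[ℂ] K} (act : ExtendedAction ι) (v : K) : Prop :=
  act.E v = 0 ∧ act.F v = 0 ∧ act.H v = 0 ∧ act.τ v = v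

/-- The skew subfield `Q_S` of `K` generated by `H_S`. -/
def subQ (ι : HAlg h I →ₐ[ℂ] K) (S : Set I) : Subfield K :=
  Subfield.closure (ι '' (subH h S : Set (HAlg h I)))

/-- The subring `Q_S[σ_1, …, σ_n]` of `K`. -/
def adjoinRoots (ι : HAlg h I →ₐ[ℂ] K) (S : Set I) {n : ℕ} (σ : Fin n → K) : Subring K :=
  Subring.closure ((subQ ι S : Set K) ∪ Set.range σ)

/-- The invariant elements `Q_S^{Inv}` of `Q_S`. -/
def invQ {ι : HAlg h I →ₐ[ℂ] K} (act : ExtendedAction ι) (S : Set I) : Set K :=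
  {q | q ∈ subQ ι S ∧ act.IsInvariant q}

/-- The linear form `x Y - y X - h y Y` in the variables `x o`, `y o`. -/
def linForm (ι : HAlg h I →ₐ[ℂ] K) (o : I) (X Y : K) : K :=
  ι (x h o) * Y - ι (y h o) * X - h • (ι (y h o) * Y)

end Forms

end NCForm

/-! The idea is to realize `H_I` in an algebra where the invariants become scalars of an
algebraically closed field `L`. A binary form is then an ordinary binary form over `L`, and it
splits into linear factors.

The ambient algebra consists of skew Laurent polynomials in `y` over `R[X]`, with `y p(X) = p(X - 1)
y`. One sends `y_i` to `t_i y` and `x_i` to `h t_i y X + s_i y⁻¹`. There `e^{hF}` is conjugation by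
`y`, `F` is `h⁻¹ d/dX`, and `E`, `H` have the form `b ↦ y⁻¹ ([b, w] + δ b) y⁻¹` with a derivation
`δ`. Here `R = L[q]`, `t_i = p_i + s_i q`, and `δ` is `d/dq` for `E` and zero for `H`. An element
killed by all three operators involves neither `X` nor `y` nor `q`, so it lies in `L`
(`exists_model_eq_algebraMap`). If the `p_i`, `s_i` are algebraically independent, the map is
injective (`model_injective`): ordered monomials span `H_I`, and a representation on commutative
polynomials, visible inside the skew Laurent polynomials, separates them.

Now let the parameters `(a, b)` of the index `0` vary. The value of `f` is a homogeneous function of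
degree `n` with values in `L`, and `ξ` becomes a linear form `a W + b V`. On the line through the
point of index `1` in the direction `(V, -W)`, where this linear form is constant, `f` is a
polynomial `G(t)` with `G(0) = f_1`. The point of index `0` is `ξ / f_1` times the point of the line
with `t = -η / ξ`. Hence `f = (ξ / f_1)^n G(-η / ξ)`, and factoring `G` over `L` gives `f =
f_1^{1-n} ∏ (ξ - σ_i η)`. The direction `(V, -W)` is itself represented by elements of `H_{I∖{0}}`,
so the coefficients of `∏ (T - σ_i)` are fractions of elements of that subalgebra
(`exists_factorization`).

The skew fields come from polynomial growth, which forces the Ore conditions both for the skew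
Laurent polynomials and for their subalgebras. The big skew field `D` is an Ore localization to
which the action extends. In it `Q_I` is the set of right fractions of `H_I`, and `Q_I[σ]` is a skew
field because it is finite dimensional over `Q_I` and has no zero divisors. The action restricts to
it by stability. -/

namespace NCForm

/-! ### Skew Laurent polynomials for the shift `X ↦ X - 1` -/

section ShiftAction

variable (R : Type*) [CommRing R]

/-- The integer `m` acts on `R[X]` by `X ↦ X - m`. -/
@[reducible] noncomputable def shiftAction : MulSemiringAction (Multiplicative ℤ) R[X] where
  smul m p := taylor (-(m.toAdd : R)) p
  one_smul p := by
    change taylor (-((0 : ℤ) : R)) p = p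
    simp
  mul_smul m n p := by
    change taylor (-((m.toAdd + n.toAdd : ℤ) : R)) p = taylor _ (taylor _ p)
    rw [taylor_taylor]
    congr 2
    push_cast
    ring
  smul_zero m := map_zero (taylor _)
  smul_add m p q := map_add (taylor _) p q
  smul_one m := map_one (taylorAlgHom (-(m.toAdd : R)))
  smul_mul m p q := taylor_mul _ p q

attribute [local instance] shiftAction

theorem shiftAction_smul (m : Multiplicative ℤ) (p : R[X]) :
    m • p = taylor (-(m.toAdd : R)) p := rfl

/-- The algebra of skew Laurent polynomials `∑ p_m(X) y^m` with `y p(X) = p(X - 1) y`. -/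
def ShiftAlg : Type _ := SkewMonoidAlgebra R[X] (Multiplicative ℤ)

noncomputable instance : Ring (ShiftAlg R) :=
  inferInstanceAs (Ring (SkewMonoidAlgebra R[X] (Multiplicative ℤ)))

theorem smul_taylor {k : Type*} [CommSemiring k] [Algebra k R] (r : R) (c : k) (p : R[X]) :
    taylor r (c • p) = c • taylor r p := by
  rw [← algebraMap_smul R c p, map_smul, algebraMap_smul]

instance {k : Type*} [CommSemiring k] [Algebra k R] : SMulCommClass (Multiplicative ℤ) k R[X] where
  smul_comm m c p := by simp only [shiftAction_smul, smul_taylor]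

noncomputable instance {k : Type*} [CommSemiring k] [Algebra k R] : Algebra k (ShiftAlg R) :=
  inferInstanceAs (Algebra k (SkewMonoidAlgebra R[X] (Multiplicative ℤ)))

instance [Nontrivial R] : Nontrivial (ShiftAlg R) :=
  inferInstanceAs (Nontrivial (SkewMonoidAlgebra R[X] (Multiplicative ℤ)))

namespace ShiftAlg

variable {R}

/-- The element `p y^m`. -/
noncomputable def mono (m : ℤ) : R[X] →+ ShiftAlg R :=
  SkewMonoidAlgebra.singleAddHom (Multiplicative.ofAdd m)

/-- The coefficient of `y^m`. -/
noncomputable def coeff (m : ℤ) : ShiftAlg R →+ R[X] where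
  toFun b := SkewMonoidAlgebra.coeff (k := R[X]) (G := Multiplicative ℤ) b (Multiplicative.ofAdd m)
  map_zero' := rfl
  map_add' a b := by
    rw [← Finsupp.add_apply]
    exact congrArg (fun f : Multiplicative ℤ →₀ R[X] => f (Multiplicative.ofAdd m))
      (SkewMonoidAlgebra.coeff_add a b)

theorem coeff_mono (m n : ℤ) (p : R[X]) : coeff m (mono n p) = if n = m then p else 0 := by
  have := SkewMonoidAlgebra.coeff_single_apply (k := R[X]) (a := Multiplicative.ofAdd n)
    (a' := Multiplicative.ofAdd m) (b := p)
  exact this.trans (by congr)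

theorem coeff_ext {a b : ShiftAlg R} (hab : ∀ m, coeff m a = coeff m b) : a = b :=
  SkewMonoidAlgebra.ext fun m => hab m.toAdd

theorem induction {P : ShiftAlg R → Prop} (hm : ∀ m p, P (mono m p))
    (hadd : ∀ a b, P a → P b → P (a + b)) (a : ShiftAlg R) : P a :=
  SkewMonoidAlgebra.induction_on' (p := P) a (fun m p => hm m.toAdd p) hadd

theorem mono_mul_mono (m n : ℤ) (p q : R[X]) :
    mono m p * mono n q = mono (m + n) (p * taylor (-(m : R)) q) :=
  SkewMonoidAlgebra.single_mul_single

theorem one_def : (1 : ShiftAlg R) = mono 0 1 := rfl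

theorem smul_mono {k : Type*} [CommSemiring k] [Algebra k R] (c : k) (m : ℤ) (p : R[X]) :
    c • mono m p = mono m (c • p) :=
  SkewMonoidAlgebra.smul_single c _ p

theorem coeff_smul {k : Type*} [CommSemiring k] [Algebra k R] (c : k) (m : ℤ) (a : ShiftAlg R) :
    coeff m (c • a) = c • coeff m a := by
  induction a using induction with
  | hm n p =>
    rw [smul_mono, coeff_mono, coeff_mono]
    split_ifs <;> simp
  | hadd a b ha hb => rw [smul_add, map_add, map_add, ha, hb, smul_add]

/-- The finite set of exponents that occur in an element. -/
noncomputable def supp (a : ShiftAlg R) : Finset ℤ :=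
  (SkewMonoidAlgebra.support (k := R[X]) (G := Multiplicative ℤ) a).map
    Multiplicative.toAdd.toEmbedding

theorem mem_supp {a : ShiftAlg R} {m : ℤ} : m ∈ supp a ↔ coeff m a ≠ 0 := by
  refine (Finset.mem_map_equiv).trans ?_
  exact SkewMonoidAlgebra.mem_support_iff

theorem sum_mono (a : ShiftAlg R) : ∑ m ∈ supp a, mono m (coeff m a) = a := by
  refine coeff_ext fun n => ?_
  rw [map_sum]
  simp only [coeff_mono]
  rw [Finset.sum_ite_eq' (supp a) n]
  split_ifs with hn
  · rfl
  · rw [mem_supp, not_not] at hn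
    exact hn.symm

theorem coeff_mul (a b : ShiftAlg R) (l : ℤ) :
    coeff l (a * b) = ∑ m ∈ supp a, ∑ n ∈ supp b,
      if m + n = l then coeff m a * taylor (-(m : R)) (coeff n b) else 0 := by
  conv_lhs => rw [← sum_mono a, ← sum_mono b]
  simp only [Finset.sum_mul_sum, map_sum, mono_mul_mono, coeff_mono]

theorem supp_nonempty {a : ShiftAlg R} (ha : a ≠ 0) : (supp a).Nonempty := by
  rw [Finset.nonempty_iff_ne_empty]
  intro h
  exact ha (by rw [← sum_mono a, h, Finset.sum_empty])

/-- The highest powers of `y` in two nonzero factors multiply without cancellation, because shifting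
the variable is injective on `R[X]`. -/
instance [IsDomain R] : NoZeroDivisors (ShiftAlg R) where
  eq_zero_or_eq_zero_of_mul_eq_zero {a b} hab := by
    by_contra! hne
    obtain ⟨ha, hb⟩ := hne
    set m := (supp a).max' (supp_nonempty ha) with hm
    set n := (supp b).max' (supp_nonempty hb) with hn
    have hma : m ∈ supp a := Finset.max'_mem _ _
    have hnb : n ∈ supp b := Finset.max'_mem _ _
    have key := coeff_mul a b (m + n)
    rw [hab, map_zero, Finset.sum_eq_single m, Finset.sum_eq_single n, if_pos rfl] at key
    · exact mul_ne_zero (mem_supp.1 hma)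
        (fun h => mem_supp.1 hnb ((taylor_eq_zero _ _).1 h)) key.symm
    · intro n' hn' hne
      rw [if_neg (by omega)]
    · exact fun h => absurd hnb h
    · intro m' hm' hne
      refine Finset.sum_eq_zero fun n' hn' => ?_
      have h1 := Finset.le_max' _ _ hm'
      have h2 := Finset.le_max' _ _ hn'
      rw [← hm] at h1
      rw [← hn] at h2
      rw [if_neg (by omega)]
    · exact fun h => absurd hma h

/-- A linear map of `R[X]` acting on all coefficients. -/
noncomputable def mapCoeff {k : Type*} [CommSemiring k] [Algebra k R] (d : R[X] →ₗ[k] R[X]) :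
    ShiftAlg R →ₗ[k] ShiftAlg R :=
  (SkewMonoidAlgebra.coeffLinearEquiv (G := Multiplicative ℤ) (k := R[X]) (S := k)).symm.toLinearMap
    ∘ₗ Finsupp.mapRange.linearMap d ∘ₗ
    (SkewMonoidAlgebra.coeffLinearEquiv (G := Multiplicative ℤ) (k := R[X]) (S := k)).toLinearMap

variable {k : Type*} [CommSemiring k] [Algebra k R] (d : R[X] →ₗ[k] R[X])

theorem coeff_mapCoeff (m : ℤ) (a : ShiftAlg R) : coeff m (mapCoeff d a) = d (coeff m a) := rfl

theorem mapCoeff_mono (m : ℤ) (p : R[X]) : mapCoeff d (mono m p) = mono m (d p) := by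
  refine coeff_ext fun n => ?_
  rw [coeff_mapCoeff, coeff_mono, coeff_mono]
  split_ifs <;> simp

/-- Multiplication twists coefficients only by integer shifts of `X`, so a derivation of `R[X]`
commuting with those shifts extends with `y` as a constant. -/
theorem mapCoeff_mul (hd : ∀ p q, d (p * q) = d p * q + p * d q)
    (ht : ∀ (m : ℤ) p, d (taylor (m : R) p) = taylor (m : R) (d p)) (a b : ShiftAlg R) :
    mapCoeff d (a * b) = mapCoeff d a * b + a * mapCoeff d b := by
  induction a using induction with
  | hadd a a' ha ha' => rw [add_mul, map_add, ha, ha', map_add, add_mul, add_mul]; abel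
  | hm m p =>
    induction b using induction with
    | hadd b b' hb hb' => rw [mul_add, map_add, hb, hb', map_add, mul_add, mul_add]; abel
    | hm n q =>
      have := ht (-m) q
      push_cast at this
      simp only [mono_mul_mono, mapCoeff_mono, hd, map_add, this]

end ShiftAlg

end ShiftAction

/-! ### Polynomial growth and common multiples -/

/-- If the images of `α` and `β` met only in zero, then `U (d + 1)` would contain a direct sum of
two copies of `U d`. Dimensions would double at every step, against the polynomial bound. -/
theorem exists_map_eq_map_of_growth {k A : Type*} [Field k] [AddCommGroup A] [Module k A]
    (α β : A →ₗ[k] A) (hα : Function.Injective α) (hβ : Function.Injective β)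
    (U : ℕ → Submodule k A) (hfin : ∀ d, FiniteDimensional k (U d))
    (hUα : ∀ d, ∀ v ∈ U d, α v ∈ U (d + 1)) (hUβ : ∀ d, ∀ v ∈ U d, β v ∈ U (d + 1))
    (h0 : U 0 ≠ ⊥) (c r : ℕ) (hdim : ∀ d, Module.finrank k (U d) ≤ c * (d + 1) ^ r) :
    ∃ v w, α v = β w ∧ α v ≠ 0 := by
  by_contra! hcon
  have step : ∀ d, 2 * Module.finrank k (U d) ≤ Module.finrank k (U (d + 1)) := by
    intro d
    have hα' : (U d).map α ≤ U (d + 1) := Submodule.map_le_iff_le_comap.2 (hUα d)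
    have hβ' : (U d).map β ≤ U (d + 1) := Submodule.map_le_iff_le_comap.2 (hUβ d)
    have hinf : (U d).map α ⊓ (U d).map β = ⊥ := by
      rw [eq_bot_iff]
      rintro _ ⟨⟨v, -, rfl⟩, ⟨w, -, hw⟩⟩
      exact hcon v w hw.symm
    have h1 := Submodule.finrank_sup_add_finrank_inf_eq ((U d).map α) ((U d).map β)
    rw [hinf, finrank_bot, add_zero, ← (Submodule.equivMapOfInjective α hα (U d)).finrank_eq,
      ← (Submodule.equivMapOfInjective β hβ (U d)).finrank_eq] at h1
    have h2 := Submodule.finrank_mono (sup_le hα' hβ')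
    omega
  have hpow : ∀ d, 2 ^ d ≤ Module.finrank k (U d) := by
    intro d
    induction d with
    | zero =>
      rw [pow_zero, Nat.one_le_iff_ne_zero, Ne, Submodule.finrank_eq_zero]
      exact h0
    | succ d ih => exact (by rw [pow_succ']; omega : 2 ^ (d + 1) ≤ _).trans (step d)
  -- The threshold `1 / (2 (c + 1))`, applied at `d + 1`, gives `(c + 1) (d + 1) ^ r < 2 ^ d`. This
  -- contradicts `2 ^ d ≤ c (d + 1) ^ r`.
  have hlim := tendsto_pow_const_div_const_pow_of_one_lt r (one_lt_two : (1 : ℝ) < 2)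
  have hlim' := (hlim.comp (Filter.tendsto_add_atTop_nat 1)).eventually
    (gt_mem_nhds (show (0 : ℝ) < 1 / (2 * (c + 1)) by positivity))
  obtain ⟨d, hd⟩ := hlim'.exists
  have h1 : ((2 : ℝ) ^ d) ≤ c * ((d : ℝ) + 1) ^ r := by exact_mod_cast (hpow d).trans (hdim d)
  simp only [Function.comp_apply, Nat.cast_add, Nat.cast_one] at hd
  rw [div_lt_div_iff₀ (by positivity) (by positivity), pow_succ] at hd
  have h2 : (0 : ℝ) ≤ ((d : ℝ) + 1) ^ r := by positivity
  nlinarith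

/-! ### Polynomial growth and the Ore conditions for skew Laurent polynomials. -/

namespace ShiftAlg

variable {R : Type*} [CommRing R]

/-- Monomials of bounded degree with coefficients in a finite set. -/
def atoms (T : Finset R) (N : ℕ) : Set (ShiftAlg R) :=
  {a | ∃ t ∈ T, ∃ i ≤ N, ∃ j : ℤ, |j| ≤ N ∧ a = mono j (C t * X ^ i)}

theorem atoms_mono {T T' : Finset R} {N N' : ℕ} (hT : T ⊆ T') (hN : N ≤ N') :
    atoms T N ⊆ atoms T' N' := by
  rintro a ⟨t, ht, i, hi, j, hj, rfl⟩
  exact ⟨t, hT ht, i, hi.trans hN, j, hj.trans (by exact_mod_cast hN), rfl⟩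

variable [Algebra ℂ R]

theorem exists_mem_span_atoms_add {a b : ShiftAlg R}
    (ha : ∃ T N, a ∈ Submodule.span ℂ (atoms T N)) (hb : ∃ T N, b ∈ Submodule.span ℂ (atoms T N)) :
    ∃ T N, a ∈ Submodule.span ℂ (atoms T N) ∧ b ∈ Submodule.span ℂ (atoms T N) := by
  classical
  obtain ⟨T, N, ha⟩ := ha
  obtain ⟨T', N', hb⟩ := hb
  exact ⟨T ∪ T', max N N',
    Submodule.span_mono (atoms_mono Finset.subset_union_left (le_max_left _ _)) ha,
    Submodule.span_mono (atoms_mono Finset.subset_union_right (le_max_right _ _)) hb⟩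

theorem exists_mem_span_atoms (a : ShiftAlg R) : ∃ T N, a ∈ Submodule.span ℂ (atoms T N) := by
  induction a using induction with
  | hadd a b ha hb =>
    obtain ⟨T, N, ha, hb⟩ := exists_mem_span_atoms_add ha hb
    exact ⟨T, N, add_mem ha hb⟩
  | hm m p =>
    induction p using Polynomial.induction_on' with
    | add p q hp hq =>
      obtain ⟨T, N, ha, hb⟩ := exists_mem_span_atoms_add hp hq
      exact ⟨T, N, by rw [map_add]; exact add_mem ha hb⟩
    | monomial i t =>
      refine ⟨{t}, max i m.natAbs, Submodule.subset_span
        ⟨t, Finset.mem_singleton_self t, i, le_max_left _ _, m, ?_, ?_⟩⟩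
      · push_cast
        rw [Int.abs_eq_natAbs]
        exact le_max_right _ _
      · rw [C_mul_X_pow_eq_monomial]

/-- The finite-dimensional space of elements of degree at most `N * d`, with coefficients that are
monomials in `T` of degree at most `d` in each element of `T`. -/
noncomputable def box (T : Finset R) (N d : ℕ) : Submodule ℂ (ShiftAlg R) :=
  Submodule.span ℂ {a | ∃ e : R → ℕ, (∀ t ∈ T, e t ≤ d) ∧ ∃ q : ℂ[X], q.natDegree ≤ N * d ∧
    ∃ j : ℤ, |j| ≤ N * d ∧ a = mono j (C (∏ t ∈ T, t ^ e t) * q.map (algebraMap ℂ R))}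

theorem one_mem_box (T : Finset R) (N d : ℕ) : (1 : ShiftAlg R) ∈ box T N d :=
  Submodule.subset_span ⟨fun _ => 0, fun _ _ => Nat.zero_le _, 1, by simp, 0,
    by simp; positivity, by simp [one_def]⟩

theorem box_le_span (T : Finset R) (N d : ℕ) :
    box T N d ≤ Submodule.span ℂ (Set.range
      fun e : (T → Fin (d + 1)) × Fin (N * d + 1) × Fin (2 * (N * d) + 1) =>
        mono (((e.2.2 : ℕ) : ℤ) - N * d) (C (∏ t : T, (t : R) ^ (e.1 t : ℕ)) * X ^ (e.2.1 : ℕ))) := by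
  refine Submodule.span_le.2 ?_
  rintro _ ⟨e, he, q, hq, j, hj, rfl⟩
  rw [abs_le] at hj
  rw [as_sum_range' q (N * d + 1) (by omega), Polynomial.map_sum, Finset.mul_sum, map_sum]
  refine sum_mem fun i hi => ?_
  rw [← C_mul_X_pow_eq_monomial, Polynomial.map_mul, map_C, Polynomial.map_pow, map_X,
    ← Polynomial.algebraMap_apply, ← Algebra.smul_def, mul_smul_comm, ← smul_mono]
  refine Submodule.smul_mem _ _ (Submodule.subset_span
    ⟨⟨fun t => ⟨e t, Nat.lt_succ_of_le (he t t.2)⟩, ⟨i, Finset.mem_range.1 hi⟩,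
      ⟨(j + N * d).toNat, ?_⟩⟩, ?_⟩)
  · zify
    rw [Int.toNat_of_nonneg (by linarith)]
    linarith
  · dsimp only
    rw [Int.toNat_of_nonneg (by linarith), add_sub_cancel_right]
    rw [← Finset.prod_coe_sort T fun t => t ^ e t]

instance (T : Finset R) (N d : ℕ) : FiniteDimensional ℂ (box T N d) :=
  have := FiniteDimensional.span_of_finite ℂ (Set.finite_range
      fun e : (T → Fin (d + 1)) × Fin (N * d + 1) × Fin (2 * (N * d) + 1) =>
        mono (((e.2.2 : ℕ) : ℤ) - N * d) (C (∏ t : T, (t : R) ^ (e.1 t : ℕ)) * X ^ (e.2.1 : ℕ)))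
  Submodule.finiteDimensional_of_le (box_le_span T N d)

/-- The exponent counts the independent choices of size linear in `d`: one exponent for each element
of `T`, the power of `X` and the power of `y`. -/
theorem finrank_box_le (T : Finset R) (N d : ℕ) :
    Module.finrank ℂ (box T N d) ≤ (2 * N + 1) ^ 2 * (d + 1) ^ (T.card + 2) := by
  have := FiniteDimensional.span_of_finite ℂ (Set.finite_range
      fun e : (T → Fin (d + 1)) × Fin (N * d + 1) × Fin (2 * (N * d) + 1) =>
        mono (((e.2.2 : ℕ) : ℤ) - N * d) (C (∏ t : T, (t : R) ^ (e.1 t : ℕ)) * X ^ (e.2.1 : ℕ)))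
  classical
  refine (Submodule.finrank_mono (box_le_span T N d)).trans ((finrank_range_le_card _).trans ?_)
  simp only [Fintype.card_prod, Fintype.card_fun, Fintype.card_fin, Fintype.card_coe]
  have h1 : N * d + 1 ≤ (2 * N + 1) * (d + 1) := by nlinarith
  have h2 : 2 * (N * d) + 1 ≤ (2 * N + 1) * (d + 1) := by nlinarith
  calc (d + 1) ^ T.card * ((N * d + 1) * (2 * (N * d) + 1))
      ≤ (d + 1) ^ T.card * (((2 * N + 1) * (d + 1)) * ((2 * N + 1) * (d + 1))) := by gcongr
    _ = _ := by ring

/-- Commuting a power of `y` past a polynomial shifts `X` by an integer. This preserves the degree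
and keeps complex coefficients complex, so no new elements of `R` arise. This is why the polynomial
part of a box has coefficients in `ℂ`. -/
theorem mul_mem_box {T : Finset R} {N d : ℕ} {a b : ShiftAlg R}
    (ha : a ∈ Submodule.span ℂ (atoms T N)) (hb : b ∈ box T N d) :
    a * b ∈ box T N (d + 1) ∧ b * a ∈ box T N (d + 1) := by
  classical
  have prod_aux : ∀ (e : R → ℕ) (t : R), t ∈ T →
      ∏ s ∈ T, s ^ (e s + if s = t then 1 else 0) = t * ∏ s ∈ T, s ^ e s := by
    intro e t ht
    simp only [pow_add, Finset.prod_mul_distrib, pow_ite, pow_one, pow_zero,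
      Finset.prod_ite_eq' T t (fun s => s), if_pos ht, mul_comm]
  have map_taylor : ∀ (m : ℤ) (q : ℂ[X]), taylor (-(m : R)) (q.map (algebraMap ℂ R)) =
      (taylor (-(m : ℂ)) q).map (algebraMap ℂ R) := by
    intro m q
    simp [taylor_apply, Polynomial.map_comp]
  induction ha using Submodule.span_induction with
  | zero => simp
  | add a a' _ _ h h' =>
    rw [add_mul, mul_add]
    exact ⟨add_mem h.1 h'.1, add_mem h.2 h'.2⟩
  | smul c a _ h =>
    rw [smul_mul_assoc, mul_smul_comm]
    exact ⟨Submodule.smul_mem _ c h.1, Submodule.smul_mem _ c h.2⟩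
  | mem a ha =>
    obtain ⟨t, ht, i, hi, j, hj, rfl⟩ := ha
    induction hb using Submodule.span_induction with
    | zero => simp
    | add b b' _ _ h h' =>
      rw [add_mul, mul_add]
      exact ⟨add_mem h.1 h'.1, add_mem h.2 h'.2⟩
    | smul c b _ h =>
      rw [smul_mul_assoc, mul_smul_comm]
      exact ⟨Submodule.smul_mem _ c h.1, Submodule.smul_mem _ c h.2⟩
    | mem b hb =>
      obtain ⟨e, he, q, hq, l, hl, rfl⟩ := hb
      have hdeg : |j + l| ≤ N * ((d : ℤ) + 1) := (abs_add_le j l).trans (by linarith)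
      refine ⟨Submodule.subset_span ⟨fun s => e s + if s = t then 1 else 0, fun s hs => ?_,
        X ^ i * taylor (-(j : ℂ)) q, ?_, j + l, ?_, ?_⟩,
        Submodule.subset_span ⟨fun s => e s + if s = t then 1 else 0, fun s hs => ?_,
        q * taylor (-(l : ℂ)) (X ^ i), ?_, l + j, ?_, ?_⟩⟩
      · have := he s hs
        dsimp only
        split_ifs <;> omega
      · refine natDegree_mul_le.trans ?_
        rw [natDegree_X_pow, natDegree_taylor]
        nlinarith
      · push_cast
        exact hdeg
      · rw [mono_mul_mono, prod_aux e t ht, taylor_mul, taylor_C, map_taylor, Polynomial.map_mul,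
          Polynomial.map_pow, map_X, C_mul]
        congr 1
        ring
      · have := he s hs
        dsimp only
        split_ifs <;> omega
      · refine natDegree_mul_le.trans ?_
        rw [natDegree_taylor, natDegree_X_pow]
        nlinarith
      · push_cast
        rwa [add_comm]
      · rw [mono_mul_mono, prod_aux e t ht, taylor_mul, taylor_C, Polynomial.map_mul,
          ← map_taylor, Polynomial.map_pow, map_X, C_mul]
        congr 1
        ring

/-- Subalgebras of the skew Laurent polynomials satisfy the right Ore condition. -/
theorem exists_right_common_multiple [IsDomain R] {A : Type*} [Ring A] [Algebra ℂ A]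
    (φ : A →ₐ[ℂ] ShiftAlg R) (hφ : Function.Injective φ) {a b : A} (ha : a ≠ 0) (hb : b ≠ 0) :
    ∃ v w, a * v = b * w ∧ a * v ≠ 0 := by
  have : NoZeroDivisors A := hφ.noZeroDivisors φ (map_zero _) (map_mul _)
  have : Nontrivial A := ⟨a, 0, ha⟩
  obtain ⟨T, N, hTa, hTb⟩ := exists_mem_span_atoms_add (exists_mem_span_atoms (φ a))
    (exists_mem_span_atoms (φ b))
  -- The finite set `T` is fixed by `a` and `b` alone, so `A` need not be finitely generated. The
  -- preimages of the boxes inherit their polynomial growth.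
  let U : ℕ → Submodule ℂ A := fun d => (box T N d).comap φ.toLinearMap
  let f : ∀ d, U d →ₗ[ℂ] box T N d := fun d =>
    φ.toLinearMap.restrict (p := U d) (q := box T N d) fun v hv => hv
  have hf : ∀ d, Function.Injective (f d) := fun d v w hvw =>
    Subtype.ext (hφ (congrArg Subtype.val hvw))
  refine exists_map_eq_map_of_growth (LinearMap.mulLeft ℂ a) (LinearMap.mulLeft ℂ b)
    (mul_right_injective₀ ha) (mul_right_injective₀ hb) U
    (fun d => Module.Finite.of_injective (f d) (hf d)) (fun d v hv => ?_) (fun d v hv => ?_) ?_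
    ((2 * N + 1) ^ 2) (T.card + 2)
    (fun d => (LinearMap.finrank_le_finrank_of_injective (hf d)).trans (finrank_box_le T N d))
  · change φ (a * v) ∈ box T N (d + 1)
    rw [map_mul]
    exact (mul_mem_box hTa hv).1
  · change φ (b * v) ∈ box T N (d + 1)
    rw [map_mul]
    exact (mul_mem_box hTb hv).1
  · rw [Submodule.ne_bot_iff]
    refine ⟨1, ?_, one_ne_zero⟩
    change φ 1 ∈ box T N 0
    rw [map_one]
    exact one_mem_box T N 0

/-- The left Ore condition for skew Laurent polynomials. -/
theorem exists_left_common_multiple [IsDomain R] {a b : ShiftAlg R} (ha : a ≠ 0) (hb : b ≠ 0) :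
    ∃ v w, v * a = w * b ∧ v * a ≠ 0 := by
  obtain ⟨T, N, hTa, hTb⟩ := exists_mem_span_atoms_add (exists_mem_span_atoms a)
    (exists_mem_span_atoms b)
  refine exists_map_eq_map_of_growth (LinearMap.mulRight ℂ a) (LinearMap.mulRight ℂ b)
    (mul_left_injective₀ ha) (mul_left_injective₀ hb) (box T N) (fun d => inferInstance)
    (fun d v hv => (mul_mem_box hTa hv).2) (fun d v hv => (mul_mem_box hTb hv).2) ?_
    ((2 * N + 1) ^ 2) (T.card + 2) (finrank_box_le T N)
  rw [Submodule.ne_bot_iff]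
  exact ⟨1, one_mem_box T N 0, one_ne_zero⟩

end ShiftAlg

/-! ### The skew field of fractions -/

section OreDerivation

open OreLocalization nonZeroDivisors

variable {k B : Type*} [CommRing k] [Ring B] [Algebra k B] [OreSet B⁰]

/-- The embedding of a domain into its Ore localization. -/
noncomputable def toFractions (k B : Type*) [CommRing k] [Ring B] [Algebra k B] [OreSet B⁰] :
    B →ₐ[k] OreLocalization B⁰ B where
  __ := numeratorRingHom
  commutes' _ := rfl

theorem toFractions_injective : Function.Injective (toFractions k B) :=
  numeratorHom_inj inf_le_left

variable [Nontrivial B]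

theorem exists_toFractions_mul_eq (z : OreLocalization B⁰ B) :
    ∃ s a : B, s ≠ 0 ∧ toFractions k B s * z = toFractions k B a := by
  induction z using OreLocalization.ind with
  | _ a s => exact ⟨s, a, nonZeroDivisors.coe_ne_zero s, OreLocalization.mul_cancel⟩

variable [NoZeroDivisors B]

/-- Clearing the left denominator of `z` reduces the claim to the centrality of `c` in `B`. -/
theorem toFractions_commute {c : B} (hc : ∀ b, c * b = b * c) (z : OreLocalization B⁰ B) :
    toFractions k B c * z = z * toFractions k B c := by
  obtain ⟨s, a, hs, hz⟩ := exists_toFractions_mul_eq (k := k) z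
  have hs' : toFractions k B s ≠ 0 := by
    rwa [Ne, map_eq_zero_iff _ toFractions_injective]
  refine mul_left_cancel₀ hs' ?_
  rw [← mul_assoc, ← map_mul, ← hc s, map_mul, mul_assoc, hz, ← mul_assoc, hz, ← map_mul, ← map_mul,
    hc]

/-- Derivations extend to the Ore localization. -/
theorem exists_extend_derivation (δ : B →ₗ[k] B) (hδ : ∀ a b, δ (a * b) = δ a * b + a * δ b) :
    ∃ δ' : OreLocalization B⁰ B →ₗ[k] OreLocalization B⁰ B,
      (∀ a b, δ' (a * b) = δ' a * b + a * δ' b) ∧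
      ∀ b, δ' (toFractions k B b) = toFractions k B (δ b) := by
  let D := OreLocalization B⁰ B
  have hδ1 : δ 1 = 0 := by simpa using hδ 1 1
  -- The map `b ↦ b + ε δ b` with `ε² = 0` is multiplicative exactly because `δ` is a derivation. It
  -- sends nonzero elements to units, so it extends to fractions, and the `ε`-part of the extension
  -- is the required derivation.
  let g : B →+* TrivSqZeroExt D D :=
    { toFun := fun b => (toFractions k B b, toFractions k B (δ b))
      map_one' := by
        ext
        · exact map_one (toFractions k B)
        · change toFractions k B (δ 1) = 0
          rw [hδ1, map_zero]
      map_zero' := by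
        ext
        · exact map_zero (toFractions k B)
        · change toFractions k B (δ 0) = 0
          rw [map_zero, map_zero]
      map_add' := fun a b => by
        ext
        · exact map_add (toFractions k B) a b
        · change toFractions k B (δ (a + b)) = _
          rw [map_add, map_add]
          rfl
      map_mul' := fun a b => by
        ext
        · exact map_mul (toFractions k B) a b
        · change toFractions k B (δ (a * b)) = toFractions k B a * toFractions k B (δ b) +
            toFractions k B (δ a) * toFractions k B b
          rw [hδ, map_add, map_mul, map_mul, add_comm] }
  have hg : ∀ b, g b = (toFractions k B b, toFractions k B (δ b)) := fun _ => rfl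
  have hu : ∀ s : B⁰, IsUnit ((g : B →* TrivSqZeroExt D D).comp B⁰.subtype s) := by
    intro s
    rw [TrivSqZeroExt.isUnit_iff_isUnit_fst]
    refine IsUnit.mk0 (toFractions k B s) ?_
    rw [Ne, map_eq_zero_iff _ toFractions_injective]
    exact nonZeroDivisors.coe_ne_zero s
  let G : D →+* TrivSqZeroExt D D := universalHom g (IsUnit.liftRight _ hu) (fun s => rfl)
  have hG : ∀ b, G (toFractions k B b) = g b := fun b => universalHom_commutes g _ _
  have hfst : ∀ z, (G z).fst = z := by
    intro z
    obtain ⟨s, a, hs, hz⟩ := exists_toFractions_mul_eq (k := k) z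
    have hs' : toFractions k B s ≠ 0 := by
      rwa [Ne, map_eq_zero_iff _ toFractions_injective]
    have := congrArg (fun w => (G w).fst) hz
    simp only [map_mul, hG, TrivSqZeroExt.fst_mul] at this
    exact mul_left_cancel₀ hs' (this.trans hz.symm)
  have hmul : ∀ a b, (G (a * b)).snd = (G a).snd * b + a * (G b).snd := by
    intro a b
    rw [map_mul, TrivSqZeroExt.snd_mul, hfst, hfst, add_comm]
    rfl
  have hsnd : ∀ b, (G (toFractions k B b)).snd = toFractions k B (δ b) := fun b => by
    rw [hG, hg]
    rfl
  refine ⟨{ toFun := fun z => (G z).snd, map_add' := fun a b => by simp, map_smul' := fun c z => ?_ },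
    hmul, hsnd⟩
  have hc : (G (algebraMap k D c)).snd = 0 := by
    rw [← (toFractions k B).commutes, hsnd, Algebra.algebraMap_eq_smul_one, map_smul, hδ1, smul_zero,
      map_zero]
  rw [Algebra.smul_def, hmul, hc, zero_mul, zero_add, RingHom.id_apply, Algebra.smul_def]

end OreDerivation

/-- The skew Laurent polynomials embed into a skew field to which derivations extend. -/
theorem ShiftAlg.exists_skewField (R : Type u) [CommRing R] [IsDomain R] [Algebra ℂ R] :
    ∃ (D : Type u) (_ : DivisionRing D) (_ : Algebra ℂ D) (ι : ShiftAlg R →ₐ[ℂ] D),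
      Function.Injective ι ∧ (∀ c, (∀ b, c * b = b * c) → ∀ z, ι c * z = z * ι c) ∧
      ∀ δ : ShiftAlg R →ₗ[ℂ] ShiftAlg R, (∀ a b, δ (a * b) = δ a * b + a * δ b) →
        ∃ δ' : D →ₗ[ℂ] D, (∀ a b, δ' (a * b) = δ' a * b + a * δ' b) ∧
          ∀ b, δ' (ι b) = ι (δ b) := by
  have hore : Nonempty (OreLocalization.OreSet (nonZeroDivisors (ShiftAlg R))) := by
    rw [OreLocalization.nonempty_oreSet_iff_of_noZeroDivisors]
    intro r s
    by_cases hr : r = 0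
    · exact ⟨0, 1, by simp [hr]⟩
    · obtain ⟨v, w, hvw, hne⟩ :=
        ShiftAlg.exists_left_common_multiple hr (nonZeroDivisors.coe_ne_zero s)
      exact ⟨w, ⟨v, mem_nonZeroDivisors_of_ne_zero (left_ne_zero_of_mul hne)⟩, hvw⟩
  obtain ⟨hore⟩ := hore
  exact ⟨OreLocalization (nonZeroDivisors (ShiftAlg R)) (ShiftAlg R), inferInstance, inferInstance,
    toFractions ℂ (ShiftAlg R), toFractions_injective, fun _ => toFractions_commute,
    exists_extend_derivation⟩

/-! ### The quantum group action on skew Laurent polynomials -/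

/-- The operator `b ↦ y⁻¹ ([b, w] + δ b) y⁻¹`. It satisfies the product rule of `E` and `H` if `δ`
is a derivation. -/
def twistedDer {A : Type*} [Ring A] [Algebra ℂ A] (y : Aˣ) (w : A) (δ : A →ₗ[ℂ] A) : A →ₗ[ℂ] A where
  toFun b := ↑y⁻¹ * (b * w - w * b + δ b) * ↑y⁻¹
  map_add' a b := by simp only [map_add]; noncomm_ring
  map_smul' c b := by
    simp only [map_smul, smul_mul_assoc, mul_smul_comm, ← smul_sub, ← smul_add, RingHom.id_apply]

theorem twistedDer_apply {A : Type*} [Ring A] [Algebra ℂ A] (y : Aˣ) (w : A) (δ : A →ₗ[ℂ] A)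
    (b : A) : twistedDer y w δ b = ↑y⁻¹ * (b * w - w * b + δ b) * ↑y⁻¹ := rfl

theorem twistedDer_eq_iff {A : Type*} [Ring A] [Algebra ℂ A] (y : Aˣ) (w : A) (δ : A →ₗ[ℂ] A)
    (b c : A) : twistedDer y w δ b = c ↔ b * w - w * b + δ b = y * c * y := by
  rw [twistedDer_apply, Units.mul_inv_eq_iff_eq_mul, Units.inv_mul_eq_iff_eq_mul, mul_assoc]

/-- The map `∂ b = [b, w] + δ b` is a derivation. Inserting `y⁻¹ y` or `y y⁻¹` in `y⁻¹ (∂a b + a ∂b)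
y⁻¹` turns the remaining factors into conjugates by `y`, which play the role of `e^{∓hF}`. -/
theorem twistedDer_mul {A : Type*} [Ring A] [Algebra ℂ A] (y : Aˣ) (w : A) (δ : A →ₗ[ℂ] A)
    (hδ : ∀ a b, δ (a * b) = δ a * b + a * δ b) (a b : A) :
    twistedDer y w δ (a * b) =
      twistedDer y w δ a * (↑y * b * ↑y⁻¹) + (↑y⁻¹ * a * ↑y) * twistedDer y w δ b := by
  rw [twistedDer_eq_iff, twistedDer_apply, twistedDer_apply, hδ]
  simp only [mul_add, add_mul, mul_assoc, Units.mul_inv_cancel_left, Units.inv_mul_cancel_left,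
    Units.inv_mul, mul_one, mul_sub, sub_mul]
  abel

/-- Skew derivations of `H_I` with values in an algebra are determined on the generators. -/
theorem skew_ext {h c : ℂ} {I : Type*} [LinearOrder I] {A : Type*} [Ring A] [Algebra ℂ A]
    (φ : HAlg h I →ₐ[ℂ] A) (δ₁ δ₂ : HAlg h I →ₗ[ℂ] A)
    (h₁ : ∀ a b, δ₁ (a * b) = δ₁ a * φ (shift h (-c) b) + φ (shift h c a) * δ₁ b)
    (h₂ : ∀ a b, δ₂ (a * b) = δ₂ a * φ (shift h (-c) b) + φ (shift h c a) * δ₂ b)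
    (hx : ∀ i, δ₁ (x h i) = δ₂ (x h i)) (hy : ∀ i, δ₁ (y h i) = δ₂ (y h i)) (a : HAlg h I) :
    δ₁ a = δ₂ a := by
  have aux : ∀ δ : HAlg h I →ₗ[ℂ] A,
      (∀ a b, δ (a * b) = δ a * φ (shift h (-c) b) + φ (shift h c a) * δ b) → δ 1 = 0 := by
    intro δ hδ
    simpa using hδ 1 1
  induction a using induction_on with
  | hc r => rw [Algebra.algebraMap_eq_smul_one, map_smul, map_smul, aux _ h₁, aux _ h₂]
  | hx i => exact hx i
  | hy i => exact hy i
  | hadd a b ha hb => rw [map_add, map_add, ha, hb]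
  | hmul a b ha hb => rw [h₁, h₂, ha, hb]

namespace ShiftAlg

variable {R : Type*} [CommRing R]

theorem taylor_sub (r : R) (p q : R[X]) : taylor r (p - q) = taylor r p - taylor r q :=
  map_sub _ p q

theorem coeff_smul_eq {k : Type*} [CommSemiring k] [Algebra k R] (c : k) (m : ℤ) (a : ShiftAlg R) :
    coeff m (c • a) = C (algebraMap k R c) * coeff m a := by
  rw [coeff_smul, Algebra.smul_def, Polynomial.algebraMap_apply]

/-- The variable `y` as a unit. -/
noncomputable def yUnit (R : Type*) [CommRing R] : (ShiftAlg R)ˣ where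
  val := mono 1 1
  inv := mono (-1) 1
  val_inv := by simp [mono_mul_mono, one_def]
  inv_val := by simp [mono_mul_mono, one_def]

theorem coe_yUnit : (yUnit R : ShiftAlg R) = mono 1 1 := rfl

theorem coe_yUnit_inv : (↑(yUnit R)⁻¹ : ShiftAlg R) = mono (-1) 1 := rfl

variable [Algebra ℂ R]

/-- The derivation `h⁻¹ d/dX`. -/
noncomputable def derX (h : ℂ) : ShiftAlg R →ₗ[ℂ] ShiftAlg R :=
  mapCoeff (h⁻¹ • derivative.restrictScalars ℂ)

theorem derX_mul (h : ℂ) (a b : ShiftAlg R) : derX h (a * b) = derX h a * b + a * derX h b := by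
  refine mapCoeff_mul _ (fun p q => ?_) (fun m p => ?_) a b
  · simp [derivative_mul, smul_add]
  · simp [taylor_apply, derivative_comp]

/-- The coefficientwise extension of a derivation of `R` to `R[X]`. -/
noncomputable def polyDer (d : Derivation ℂ R R) : Derivation ℂ R[X] R[X] :=
  PolynomialModule.equivPolynomialSelf.compDer d.mapCoeffs

theorem coeff_polyDer (d : Derivation ℂ R R) (p : R[X]) (n : ℕ) :
    (polyDer d p).coeff n = d (p.coeff n) := rfl

theorem polyDer_C (d : Derivation ℂ R R) (r : R) : polyDer d (C r) = C (d r) := by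
  ext n
  rw [coeff_polyDer, coeff_C, coeff_C]
  split_ifs <;> simp

theorem polyDer_X (d : Derivation ℂ R R) : polyDer d X = 0 := by
  ext n
  rw [coeff_polyDer, coeff_X]
  split_ifs <;> simp

theorem polyDer_X_sub_one (d : Derivation ℂ R R) : polyDer d (X - 1) = 0 := by
  rw [map_sub, polyDer_X, Derivation.map_one_eq_zero, sub_zero]

/-- Derivations kill integers, so `X + m` is a constant of `polyDer d` just as `X` is. -/
theorem polyDer_taylor (d : Derivation ℂ R R) (m : ℤ) (p : R[X]) :
    polyDer d (taylor (m : R) p) = taylor (m : R) (polyDer d p) := by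
  induction p using Polynomial.induction_on' with
  | add p q hp hq => simp only [map_add, hp, hq]
  | monomial n r =>
    have h1 : polyDer d (X + C (m : R)) = 0 := by
      rw [map_add, polyDer_X, polyDer_C, Derivation.map_intCast, C_0, add_zero]
    rw [← C_mul_X_pow_eq_monomial]
    simp only [taylor_mul, taylor_C, taylor_pow, taylor_X, Derivation.leibniz,
      Derivation.leibniz_pow, h1, polyDer_C, polyDer_X, smul_eq_mul, mul_zero,
      smul_zero, zero_add]

/-- The coefficientwise extension of a derivation of `R` to the skew Laurent polynomials. -/
noncomputable def derCoeff (d : Derivation ℂ R R) : ShiftAlg R →ₗ[ℂ] ShiftAlg R :=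
  mapCoeff (polyDer d).toLinearMap

theorem derCoeff_mul (d : Derivation ℂ R R) (a b : ShiftAlg R) :
    derCoeff d (a * b) = derCoeff d a * b + a * derCoeff d b := by
  refine mapCoeff_mul _ (fun p q => ?_) (polyDer_taylor d) a b
  change polyDer d (p * q) = polyDer d p * q + p * polyDer d q
  rw [Derivation.leibniz, smul_eq_mul, smul_eq_mul]
  ring

theorem derCoeff_mono (d : Derivation ℂ R R) (m : ℤ) (p : R[X]) :
    derCoeff d (mono m p) = mono m (polyDer d p) := mapCoeff_mono _ m p

/-- The element whose commutator induces `H`. -/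
noncomputable def wH (R : Type*) [CommRing R] [Algebra ℂ R] : ShiftAlg R :=
  mono 2 (X - C (algebraMap ℂ R (3 / 2)))

/-- The element whose commutator induces the inner part of `E`. -/
noncomputable def wE (R : Type*) [CommRing R] [Algebra ℂ R] (h : ℂ) : ShiftAlg R :=
  mono 2 (C (algebraMap ℂ R (-h / 2)) * ((X - 1) * (X - C 2)))

variable {I : Type*} [LinearOrder I]

/-- The realization of `H_I` by skew Laurent polynomials, with `y i ↦ t i y` and
`x i ↦ h t i y X + s i y⁻¹`. -/
noncomputable def realize (h : ℂ) (t s : I → R) : HAlg h I →ₐ[ℂ] ShiftAlg R :=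
  liftH h (fun i => mono 1 (C (algebraMap ℂ R h * t i) * (X - 1)) + mono (-1) (C (s i)))
    (fun i => mono 1 (C (t i)))
    (fun i j => by simp only [mono_mul_mono, taylor_C, mul_comm])
    (fun i j => by
      simp only [add_mul, mul_add, mono_mul_mono, taylor_C, taylor_mul, taylor_sub, taylor_X,
        taylor_one, Int.reduceAdd, Int.reduceNeg, Int.cast_one, Int.cast_neg]
      refine coeff_ext fun m => ?_
      simp only [map_add, coeff_smul_eq, coeff_mono]
      split_ifs <;> first | omega | (simp only [C_mul, C_neg, C_1]; ring) | ring)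
    (fun i j => by
      simp only [add_mul, mul_add, mono_mul_mono, taylor_C, taylor_mul, taylor_sub, taylor_X,
        taylor_one, Int.reduceAdd, Int.reduceNeg, Int.cast_one, Int.cast_neg]
      refine coeff_ext fun m => ?_
      simp only [map_add, map_sub, coeff_smul_eq, coeff_mono]
      split_ifs <;> first | omega | (simp only [C_mul, C_neg, C_1, map_pow]; ring))

theorem realize_x (h : ℂ) (t s : I → R) (i : I) : realize h t s (x h i) =
    mono 1 (C (algebraMap ℂ R h * t i) * (X - 1)) + mono (-1) (C (s i)) := liftH_x ..

theorem realize_y (h : ℂ) (t s : I → R) (i : I) : realize h t s (y h i) = mono 1 (C (t i)) :=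
  liftH_y ..

/-! ### Compatibility of the realization with the quantum group action. -/

section Intertwine

variable (h : ℂ) (t s : I → R)

/-- Conjugation by `y` replaces `X` by `X + 1`. It therefore adds `h t_i y`, the image of `h y_i`,
to the image of `x_i`, and fixes the image of `y_i`. -/
theorem realize_shift (a : HAlg h I) :
    realize h t s (shift h h a) = ↑(yUnit R)⁻¹ * realize h t s a * ↑(yUnit R) := by
  induction a using induction_on with
  | hc c => rw [AlgHom.commutes, AlgHom.commutes, ← Algebra.commutes, mul_assoc, Units.inv_mul,
      mul_one]
  | hx i =>
    rw [shift_x, map_add, map_smul, realize_x, realize_y, coe_yUnit, coe_yUnit_inv]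
    simp only [add_mul, mul_add, mono_mul_mono, taylor_C, taylor_mul, taylor_sub, taylor_X,
        taylor_one, Int.reduceAdd, Int.reduceNeg, Int.cast_one, Int.cast_neg]
    refine coeff_ext fun m => ?_
    simp only [map_add, coeff_smul_eq, coeff_mono]
    split_ifs <;> first | omega | (simp only [C_mul, C_neg, C_1]; ring) | ring
  | hy i =>
    rw [shift_y, realize_y, coe_yUnit, coe_yUnit_inv]
    simp [mono_mul_mono]
  | hadd a b ha hb => rw [map_add, map_add, map_add, mul_add, add_mul, ha, hb]
  | hmul a b ha hb =>
    rw [map_mul, map_mul, map_mul, ha, hb]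
    simp only [mul_assoc, Units.mul_inv_cancel_left]

theorem shift_shift (c d : ℂ) (a : HAlg h I) : shift h c (shift h d a) = shift h (c + d) a := by
  induction a using induction_on with
  | hc c => simp
  | hx i => simp only [shift_x, map_add, map_smul, shift_y]; module
  | hy i => simp
  | hadd a b ha hb => simp only [map_add, ha, hb]
  | hmul a b ha hb => simp only [map_mul, ha, hb]

theorem realize_shift_neg (a : HAlg h I) :
    realize h t s (shift h (-h) a) = ↑(yUnit R) * realize h t s a * ↑(yUnit R)⁻¹ := by
  have := realize_shift h t s (shift h (-h) a)
  rw [shift_shift, add_neg_cancel, shift_zero] at this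
  rw [this]
  simp only [mul_assoc, Units.mul_inv_cancel_left, Units.mul_inv, mul_one]

theorem realize_opF (hh : h ≠ 0) (a : HAlg h I) :
    derX h (realize h t s a) = realize h t s (opF h a) := by
  refine skew_ext (c := 0) (realize h t s) (derX h ∘ₗ (realize h t s).toLinearMap)
    ((realize h t s).toLinearMap ∘ₗ opF h) (fun a b => ?_) (fun a b => ?_) (fun i => ?_)
    (fun i => ?_) a
  · simp [derX_mul]
  · simp [opF_mul]
  · have : algebraMap ℂ R h⁻¹ * algebraMap ℂ R h = 1 := by
      rw [← map_mul, inv_mul_cancel₀ hh, map_one]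
    simp only [LinearMap.comp_apply, AlgHom.toLinearMap_apply, realize_x, opF_x, realize_y, derX,
      map_add, mapCoeff_mono]
    have this' : C (algebraMap ℂ R h⁻¹) * C (algebraMap ℂ R h) = 1 := by rw [← C_mul, this, C_1]
    have e : (h⁻¹ • derivative.restrictScalars ℂ) (C (algebraMap ℂ R h * t i) * (X - 1)) =
        C (t i) := by
      rw [LinearMap.smul_apply, Algebra.smul_def, Polynomial.algebraMap_apply,
        LinearMap.restrictScalars_apply, derivative_C_mul, derivative_sub, derivative_X,
        derivative_one, sub_zero, mul_one, C_mul, ← mul_assoc, this', one_mul]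
    rw [e]
    simp
  · simp [realize_y, derX, mapCoeff_mono]

/-- Both sides obey the same twisted product rule, since `e^{±hF}` is realized by conjugation.
Agreement on generators therefore suffices. -/
theorem realize_skew (w : ShiftAlg R) (δ : ShiftAlg R →ₗ[ℂ] ShiftAlg R)
    (hδ : ∀ a b, δ (a * b) = δ a * b + a * δ b) (D : HAlg h I →ₗ[ℂ] HAlg h I)
    (hD : ∀ a b, D (a * b) = D a * shift h (-h) b + shift h h a * D b)
    (hx : ∀ i, twistedDer (yUnit R) w δ (realize h t s (x h i)) = realize h t s (D (x h i)))
    (hy : ∀ i, twistedDer (yUnit R) w δ (realize h t s (y h i)) = realize h t s (D (y h i)))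
    (a : HAlg h I) : twistedDer (yUnit R) w δ (realize h t s a) = realize h t s (D a) := by
  refine skew_ext (c := h) (realize h t s) (twistedDer (yUnit R) w δ ∘ₗ (realize h t s).toLinearMap)
    ((realize h t s).toLinearMap ∘ₗ D) (fun a b => ?_) (fun a b => ?_) hx hy a
  · simp only [LinearMap.comp_apply, AlgHom.toLinearMap_apply, map_mul,
      twistedDer_mul _ _ _ hδ, realize_shift, realize_shift_neg]
  · simp [hD]

theorem realize_opH (a : HAlg h I) :
    twistedDer (yUnit R) (wH R) 0 (realize h t s a) = realize h t s (opH h a) := by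
  -- With `w = (X - a) y²` the part `h t_i (X - 1) y` of `x_i` has commutator `h t_i (X + 1 - 2a)
  -- y³`, which must equal `h t_i (X - 2) y³`. Hence `a = 3/2`. The other terms do not restrict `a`.
  have h32 : C (algebraMap ℂ R (3 / 2)) * 2 = (3 : R[X]) := by
    rw [← Polynomial.algebraMap_apply, ← map_ofNat (algebraMap ℂ R[X]) 2,
      ← map_ofNat (algebraMap ℂ R[X]) 3, ← map_mul]
    norm_num
  refine realize_skew h t s _ _ (by simp) (opH h) (opH_mul h) (fun i => ?_) (fun i => ?_) a
  · rw [twistedDer_eq_iff, opH_x, realize_x, wH, coe_yUnit, LinearMap.zero_apply, add_zero]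
    simp only [add_mul, mul_add, mono_mul_mono, taylor_C, taylor_mul, taylor_sub, taylor_X,
        taylor_one, Int.reduceAdd, Int.reduceNeg, Int.cast_one, Int.cast_neg, Int.cast_ofNat]
    refine coeff_ext fun m => ?_
    simp only [map_add, map_sub, coeff_mono]
    split_ifs <;> first | omega | skip
    · simp only [C_mul, C_neg, C_1, map_ofNat]
      linear_combination -(C (algebraMap ℂ R h) * C (t i) * h32)
    · simp only [C_neg, C_1]
      ring
    · ring
  · rw [twistedDer_eq_iff, opH_y, map_neg, realize_y, wH, coe_yUnit, LinearMap.zero_apply, add_zero]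
    simp only [mul_neg, neg_mul, mono_mul_mono, taylor_C, taylor_sub, taylor_X,
        taylor_one, Int.reduceAdd, Int.cast_one]
    refine coeff_ext fun m => ?_
    simp only [map_neg, map_sub, coeff_mono]
    split_ifs
    · simp only [C_1]
      ring
    · ring

/-- For `w = -(h/2) (X - 1) (X - 2) y²`, the commutator of `t_i y` with `w` produces the `X`-part of
`y x_i y`, and `d t_i = s_i` produces the rest. On `x_i` the term `h t_i (X - 1) y` commutes with
`w`, while the commutator of `s_i y⁻¹` cancels the contribution of `d`. -/
theorem realize_opE (d : Derivation ℂ R R) (ht : ∀ i, d (t i) = s i) (hs : ∀ i, d (s i) = 0)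
    (a : HAlg h I) :
    twistedDer (yUnit R) (wE R h) (derCoeff d) (realize h t s a) = realize h t s (opE h a) := by
  have h2 : C (algebraMap ℂ R (-h / 2)) * 2 = - C (algebraMap ℂ R h) := by
    rw [← Polynomial.algebraMap_apply, ← Polynomial.algebraMap_apply,
      ← map_ofNat (algebraMap ℂ R[X]) 2, ← map_mul, ← map_neg]
    congr 1
    ring
  refine realize_skew h t s _ _ (derCoeff_mul d) (opE h) (opE_mul h) (fun i => ?_) (fun i => ?_) a
  · rw [twistedDer_eq_iff, opE_x, map_zero, mul_zero, zero_mul, realize_x, wE, map_add,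
      derCoeff_mono, derCoeff_mono]
    simp only [add_mul, mul_add, mono_mul_mono, taylor_C, taylor_mul, taylor_sub, taylor_X,
        taylor_one, Int.reduceAdd, Int.reduceNeg, Int.cast_one, Int.cast_neg, Int.cast_ofNat,
        Derivation.leibniz, polyDer_C, polyDer_X_sub_one, hs, ht,
        Derivation.map_algebraMap]
    refine coeff_ext fun m => ?_
    simp only [map_add, map_sub, coeff_mono]
    split_ifs <;> first | omega | skip
    all_goals try simp only [C_mul, C_neg, C_1, map_ofNat, map_zero, smul_eq_mul, mul_zero]
    · ring
    · linear_combination C (s i) * (X - 1) * h2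
    · ring
    · ring
  · rw [twistedDer_eq_iff, opE_y, realize_y, realize_x, wE, derCoeff_mono, coe_yUnit]
    simp only [add_mul, mul_add, mono_mul_mono, taylor_C, taylor_mul, taylor_sub, taylor_X,
        taylor_one, Int.reduceAdd, Int.reduceNeg, Int.cast_one, Int.cast_ofNat,
        polyDer_C, ht]
    refine coeff_ext fun m => ?_
    simp only [map_add, map_sub, coeff_mono]
    split_ifs <;> first | omega | skip
    all_goals try simp only [C_mul, C_neg, C_1, map_ofNat]
    · linear_combination -(C (t i) * (X - 2) * h2)
    · ring
    · ring

end Intertwine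

variable {R : Type*} [CommRing R] [Algebra ℂ R]

/-- An element annihilated by the three operators is a constant of the derivation. -/
theorem exists_const_of_invariant [IsDomain R] {h : ℂ} (hh : h ≠ 0) (d : Derivation ℂ R R)
    {b : ShiftAlg R} (hF : derX h b = 0) (hH : twistedDer (yUnit R) (wH R) 0 b = 0)
    (hE : twistedDer (yUnit R) (wE R h) (derCoeff d) b = 0) :
    ∃ r, d r = 0 ∧ b = mono 0 (C r) := by
  have : CharZero R := charZero_of_injective_algebraMap (algebraMap ℂ R).injective
  have hC : ∀ m, ∃ r, coeff m b = C r := by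
    intro m
    have h1 := congrArg (coeff m) hF
    rw [derX, coeff_mapCoeff, map_zero, LinearMap.smul_apply, LinearMap.restrictScalars_apply,
      smul_eq_zero_iff_right (inv_ne_zero hh)] at h1
    exact ⟨_, eq_C_of_natDegree_eq_zero (derivative_eq_zero.1 h1)⟩
  choose r hr using hC
  rw [twistedDer_eq_iff, LinearMap.zero_apply, add_zero, mul_zero, zero_mul] at hH
  -- The commutator of `r y^m` with `wH` is `-m r y^(m+2)`, so in characteristic zero only the power
  -- `m = 0` survives.
  have hr0 : ∀ m, m ≠ 0 → r m = 0 := by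
    intro m hm
    have key : ∀ a : ShiftAlg R, coeff (m + 2) (a * wH R - wH R * a) =
        coeff m a * taylor (-(m : R)) (X - C (algebraMap ℂ R (3 / 2))) -
          (X - C (algebraMap ℂ R (3 / 2))) * taylor (-(2 : R)) (coeff m a) := by
      intro a
      induction a using induction with
      | hm n p =>
        rw [wH, mono_mul_mono, mono_mul_mono, map_sub, coeff_mono, coeff_mono, coeff_mono]
        by_cases hn : n = m
        · subst hn
          simp [add_comm]
        · rw [if_neg (by omega), if_neg (by omega), if_neg hn]
          simp
      | hadd a a' ha ha' =>
        rw [add_mul, mul_add, add_sub_add_comm, map_add, ha, ha', map_add, map_add]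
        ring
    have h1 := key b
    rw [hH, map_zero, hr, taylor_sub, taylor_X, taylor_C, taylor_C] at h1
    have h2 : C (r m * (m : R)) = (0 : R[X]) := by
      rw [C_neg] at h1
      rw [C_mul]
      linear_combination h1
    rw [C_eq_zero, mul_eq_zero] at h2
    exact h2.resolve_right (by exact_mod_cast hm)
  have hb : b = mono 0 (C (r 0)) := by
    refine coeff_ext fun m => ?_
    rw [coeff_mono]
    split_ifs with hm
    · rw [← hm, hr]
    · rw [hr, hr0 m (Ne.symm hm), C_0]
  refine ⟨r 0, ?_, hb⟩
  -- A constant in `R` commutes with the coefficient of `wE`, so the condition from `E` has only the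
  -- term `d r` in degree zero of `y`.
  rw [twistedDer_eq_iff, hb, derCoeff_mono, polyDer_C, wE, mono_mul_mono, mono_mul_mono, taylor_C,
    mul_zero, zero_mul] at hE
  have h1 := congrArg (coeff 0) hE
  rw [map_add, map_sub, coeff_mono, coeff_mono, coeff_mono, if_neg (by norm_num),
    if_neg (by norm_num), if_pos rfl, map_zero, sub_zero, zero_add, C_eq_zero] at h1
  exact h1

/-! ### The models of `H_I` over a field of parameters -/

variable {L : Type*} [Field L] [Algebra ℂ L] {I : Type*} [LinearOrder I]

/-- The realization of `H_I` in which the index `i` corresponds to the combination with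
coefficients `p i` and `s i` of two fixed vectors. -/
noncomputable def model (h : ℂ) (p s : I → L) : HAlg h I →ₐ[ℂ] ShiftAlg L[X] :=
  realize h (fun i => C (p i) + C (s i) * X) (fun i => C (s i))

/-- The derivation of the coefficients that enters the action of `E`. -/
noncomputable def derParam (L : Type*) [Field L] [Algebra ℂ L] : Derivation ℂ L[X] L[X] :=
  derivative'.restrictScalars ℂ

theorem derParam_apply (q : L[X]) : derParam L q = derivative q := rfl

theorem model_opF {h : ℂ} (hh : h ≠ 0) (p s : I → L) (a : HAlg h I) :
    derX h (model h p s a) = model h p s (opF h a) :=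
  realize_opF h _ _ hh a

theorem model_opH (h : ℂ) (p s : I → L) (a : HAlg h I) :
    twistedDer (yUnit L[X]) (wH L[X]) 0 (model h p s a) = model h p s (opH h a) :=
  realize_opH h _ _ a

theorem model_opE (h : ℂ) (p s : I → L) (a : HAlg h I) :
    twistedDer (yUnit L[X]) (wE L[X] h) (derCoeff (derParam L)) (model h p s a) =
      model h p s (opE h a) :=
  realize_opE h _ _ _ (fun i => by simp [derParam_apply]) (fun i => by simp [derParam_apply]) a

theorem algebraMap_param {L : Type*} [Field L] (l : L) : algebraMap L (ShiftAlg L[X]) l = mono 0 (C (C l)) := rfl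

/-- Invariant elements are represented by scalars. -/
theorem exists_model_eq_algebraMap {h : ℂ} (hh : h ≠ 0) (p s : I → L) {a : HAlg h I}
    (ha : IsInvariant h a) : ∃ l : L, model h p s a = algebraMap L (ShiftAlg L[X]) l := by
  obtain ⟨r, hr, hb⟩ := exists_const_of_invariant (b := model h p s a) hh (derParam L)
    (by rw [model_opF hh, ha.2.1, map_zero]) (by rw [model_opH, ha.2.2, map_zero])
    (by rw [model_opE, ha.1, map_zero])
  have : CharZero L := charZero_of_injective_algebraMap (algebraMap ℂ L).injective
  rw [eq_C_of_natDegree_eq_zero (derivative_eq_zero.1 hr)] at hb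
  exact ⟨_, hb⟩

end ShiftAlg

/-! ### Injectivity of the model -/

/-! ### Ordered monomials span the coordinate algebra. -/

section OrderedMonomials

variable (h : ℂ) {I : Type*} [LinearOrder I]

/-- The product of the `y i` followed by the product of the `x i` that occur in a word. -/
def orderedProd (w : List (I ⊕ I)) : HAlg h I :=
  (w.map (Sum.elim (y h) 1)).prod * (w.map (Sum.elim 1 (x h))).prod

/-- The number of letters `x i` in a word. -/
def xCount (w : List (I ⊕ I)) : ℕ := (w.map (Sum.elim 0 1)).sum

/-- The number of letters `y i` in a word. -/
def yCount (w : List (I ⊕ I)) : ℕ := (w.map (Sum.elim 1 0)).sum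

/-- The span of the ordered products with fewer than `d` letters `x i`. -/
def orderedSpan (d : ℕ) : Submodule ℂ (HAlg h I) :=
  Submodule.span ℂ {a | ∃ w : List (I ⊕ I), xCount w < d ∧ a = orderedProd h w}

theorem orderedProd_mem {w : List (I ⊕ I)} {d : ℕ} (hw : xCount w < d) :
    orderedProd h w ∈ orderedSpan h d :=
  Submodule.subset_span ⟨w, hw, rfl⟩

theorem y_mul_orderedProd (i : I) (w : List (I ⊕ I)) :
    y h i * orderedProd h w = orderedProd h (Sum.inl i :: w) := by
  simp [orderedProd, mul_assoc]

theorem y_mul_prod_y (i : I) (w : List (I ⊕ I)) :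
    y h i * (w.map (Sum.elim (y h) 1)).prod = (w.map (Sum.elim (y h) 1)).prod * y h i := by
  induction w with
  | nil => simp
  | cons a w ih =>
    rcases a with j | j
    · simp only [List.map_cons, Sum.elim_inl, List.prod_cons]
      rw [← mul_assoc, ← y_comm h i j, mul_assoc, ih, mul_assoc]
    · simpa using ih

/-- Each of the `yCount w` letters `y_j` that `x_i` passes contributes one correction `h y_i y_j`.
As the `y`'s commute, all these corrections are equal after multiplication by the other letters. -/
theorem x_mul_prod_y (i : I) (w : List (I ⊕ I)) :
    x h i * (w.map (Sum.elim (y h) 1)).prod = (w.map (Sum.elim (y h) 1)).prod * x h i +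
      (h * yCount w) • (y h i * (w.map (Sum.elim (y h) 1)).prod) := by
  induction w with
  | nil => simp [yCount]
  | cons a w ih =>
    rcases a with j | j
    · simp only [List.map_cons, Sum.elim_inl, List.prod_cons, yCount, List.sum_cons, Pi.one_apply]
      rw [yCount] at ih
      rw [← mul_assoc, x_mul_y, add_mul, mul_assoc, ih, mul_add, smul_mul_assoc, mul_smul_comm,
        ← mul_assoc (y h j) (y h i), y_comm h i j, mul_assoc, mul_assoc]
      push_cast
      module
    · simpa [yCount] using ih

theorem x_mul_orderedProd (i : I) (w : List (I ⊕ I)) :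
    x h i * orderedProd h w = orderedProd h (Sum.inr i :: w) +
      (h * yCount w) • (y h i * orderedProd h w) := by
  rw [orderedProd, ← mul_assoc, x_mul_prod_y]
  simp [orderedProd, add_mul, mul_assoc]

theorem y_mul_mem_orderedSpan (i : I) {d : ℕ} {a : HAlg h I} (ha : a ∈ orderedSpan h d) :
    y h i * a ∈ orderedSpan h d := by
  induction ha using Submodule.span_induction with
  | zero => simp
  | add a b _ _ ha hb => rw [mul_add]; exact add_mem ha hb
  | smul c a _ ha => rw [mul_smul_comm]; exact Submodule.smul_mem _ c ha
  | mem a ha =>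
    obtain ⟨w, hw, rfl⟩ := ha
    rw [y_mul_orderedProd]
    exact orderedProd_mem h (by simpa [xCount] using hw)

theorem orderedSpan_mono {d e : ℕ} (hde : d ≤ e) :
    (orderedSpan h d : Submodule ℂ (HAlg h I)) ≤ orderedSpan h e :=
  Submodule.span_mono fun _ ⟨w, hw, ha⟩ => ⟨w, hw.trans_le hde, ha⟩

theorem x_mul_mem_orderedSpan (i : I) {d : ℕ} {a : HAlg h I} (ha : a ∈ orderedSpan h d) :
    x h i * a ∈ orderedSpan h (d + 1) := by
  induction ha using Submodule.span_induction with
  | zero => simp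
  | add a b _ _ ha hb => rw [mul_add]; exact add_mem ha hb
  | smul c a _ ha => rw [mul_smul_comm]; exact Submodule.smul_mem _ c ha
  | mem a ha =>
    obtain ⟨w, hw, rfl⟩ := ha
    rw [x_mul_orderedProd]
    refine add_mem (orderedProd_mem h ?_) (Submodule.smul_mem _ _
      (y_mul_mem_orderedSpan h i (orderedProd_mem h (Nat.lt_succ_of_lt hw))))
    simp only [xCount, List.map_cons, Sum.elim_inr, Pi.one_apply, List.sum_cons] at hw ⊢
    omega

theorem exists_mem_orderedSpan (a : HAlg h I) : ∃ d, a ∈ orderedSpan h d := by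
  suffices H : ∀ b, (∃ d, b ∈ orderedSpan h d) → ∃ d, a * b ∈ orderedSpan h d by
    simpa using H 1 ⟨1, by
      simpa [orderedProd] using orderedProd_mem h (w := []) (d := 1) (by simp [xCount])⟩
  induction a using induction_on with
  | hc c =>
    rintro b ⟨d, hd⟩
    exact ⟨d, by rw [← Algebra.smul_def]; exact Submodule.smul_mem _ c hd⟩
  | hx i => exact fun b ⟨d, hd⟩ => ⟨d + 1, x_mul_mem_orderedSpan h i hd⟩
  | hy i => exact fun b ⟨d, hd⟩ => ⟨d, y_mul_mem_orderedSpan h i hd⟩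
  | hadd a a' ha ha' =>
    intro b hb
    obtain ⟨d, hd⟩ := ha b hb
    obtain ⟨e, he⟩ := ha' b hb
    exact ⟨max d e, by
      rw [add_mul]
      exact add_mem (orderedSpan_mono h (le_max_left _ _) hd)
        (orderedSpan_mono h (le_max_right _ _) he)⟩
  | hmul a a' ha ha' =>
    intro b hb
    rw [mul_assoc]
    exact ha _ (ha' b hb)

/-- The commutator `x_j x_i - x_i x_j = h (y_i x_j - y_j x_i)` has one letter `x` fewer. Modulo
fewer letters `x`, the order in a word is thus irrelevant. -/
theorem orderedProd_sub_mem_of_perm {w w' : List (I ⊕ I)} (hw : w.Perm w') :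
    orderedProd h w - orderedProd h w' ∈ orderedSpan h (xCount w) := by
  induction hw with
  | nil => simp
  | @cons a w w' hw ih =>
    rcases a with i | i
    · rw [← y_mul_orderedProd, ← y_mul_orderedProd, ← mul_sub]
      exact y_mul_mem_orderedSpan h i (by simpa [xCount] using ih)
    · have e : ∀ v : List (I ⊕ I), orderedProd h (Sum.inr i :: v) =
          x h i * orderedProd h v - (h * yCount v) • (y h i * orderedProd h v) := fun v => by
        rw [x_mul_orderedProd, add_sub_cancel_right]
      have hc : yCount w = yCount w' := (hw.map _).sum_eq
      rw [e, e, hc, sub_sub_sub_comm, ← smul_sub, ← mul_sub, ← mul_sub]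
      have hx : xCount (Sum.inr i :: w) = xCount w + 1 := by simp [xCount, add_comm]
      rw [hx]
      exact sub_mem (x_mul_mem_orderedSpan h i ih) (Submodule.smul_mem _ _
        (y_mul_mem_orderedSpan h i (orderedSpan_mono h (Nat.le_succ _) ih)))
  | swap a b w =>
    rcases a with i | i <;> rcases b with j | j
    · simp [orderedProd, ← mul_assoc, y_comm h i j]
    · simp [orderedProd]
    · simp [orderedProd]
    · have e : orderedProd h (Sum.inr j :: Sum.inr i :: w) -
          orderedProd h (Sum.inr i :: Sum.inr j :: w) =
          h • (orderedProd h (Sum.inl i :: Sum.inr j :: w) -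
            orderedProd h (Sum.inl j :: Sum.inr i :: w)) := by
        have e1 : x h j * x h i - x h i * x h j = h • (y h i * x h j - y h j * x h i) := by
          rw [x_mul_x h i j, x_mul_y h i j]
          module
        simp only [orderedProd, List.map_cons, Sum.elim_inl, Sum.elim_inr, Pi.one_apply,
          List.prod_cons, one_mul, y_mul_prod_y]
        simp only [mul_assoc, ← mul_sub, ← mul_smul_comm]
        congr 1
        simp only [← mul_assoc, ← sub_mul, e1, smul_mul_assoc]
      rw [e]
      refine Submodule.smul_mem _ _ (sub_mem (orderedProd_mem h ?_) (orderedProd_mem h ?_)) <;>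
        simp [xCount]
  | trans h1 _ ih1 ih2 =>
    have := add_mem ih1 (by rwa [xCount, ← (h1.map _).sum_eq] at ih2)
    rwa [sub_add_sub_cancel] at this

open MvPolynomial (basisMonomials) in
/-- The linear map from commutative polynomials that sends a monomial to an ordered product. -/
noncomputable def orderedMap : MvPolynomial (I ⊕ I) ℂ →ₗ[ℂ] HAlg h I :=
  (basisMonomials (I ⊕ I) ℂ).constr ℂ fun m => orderedProd h (Finsupp.toMultiset m).toList

theorem orderedMap_monomial (m : I ⊕ I →₀ ℕ) :
    orderedMap h (MvPolynomial.monomial m 1) = orderedProd h (Finsupp.toMultiset m).toList :=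
  (MvPolynomial.basisMonomials (I ⊕ I) ℂ).constr_basis ℂ _ m

/-- Induction on the number of letters `x`: a word is replaced by the chosen ordering of its
multiset, and the difference has fewer letters `x`. -/
theorem orderedSpan_le_range (d : ℕ) :
    orderedSpan h d ≤ LinearMap.range (orderedMap (I := I) h) := by
  induction d with
  | zero =>
    refine Submodule.span_le.2 ?_
    rintro _ ⟨w, hw, -⟩
    exact absurd hw (Nat.not_lt_zero _)
  | succ d ih =>
    refine Submodule.span_le.2 ?_
    rintro _ ⟨w, hw, rfl⟩
    classical
    have hp : w.Perm (Finsupp.toMultiset (Multiset.toFinsupp (w : Multiset (I ⊕ I)))).toList := by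
      rw [Multiset.toFinsupp_toMultiset, ← Multiset.coe_eq_coe, Multiset.coe_toList]
    have h1 := ih (orderedSpan_mono h (Nat.lt_succ_iff.1 hw) (orderedProd_sub_mem_of_perm h hp))
    rw [← orderedMap_monomial] at h1
    exact (Submodule.sub_mem_iff_left _ (LinearMap.mem_range_self _ _)).1 h1

theorem orderedMap_surjective : Function.Surjective (orderedMap (I := I) h) := fun a => by
  obtain ⟨d, hd⟩ := exists_mem_orderedSpan h a
  exact orderedSpan_le_range h d hd

end OrderedMonomials

/-! ### A faithful representation on commutative polynomials. -/

section PolynomialRepresentation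

open MvPolynomial (monomial)

variable {I : Type*}

/-- The weight of a monomial: the letters `y i` count `1`, the letters `x i` count `-1`. -/
noncomputable def weightDiff : (I ⊕ I →₀ ℕ) →+ ℤ := Finsupp.weight (Sum.elim 1 (-1))

/-- The degree of a monomial in the letters `x i`. -/
noncomputable def xDegree : (I ⊕ I →₀ ℕ) →+ ℕ := Finsupp.weight (Sum.elim 0 1)

/-- The derivation that multiplies a monomial by its weight. -/
noncomputable def euler : Derivation ℂ (MvPolynomial (I ⊕ I) ℂ) (MvPolynomial (I ⊕ I) ℂ) :=
  MvPolynomial.mkDerivation ℂ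
    (Sum.elim (fun i => MvPolynomial.X (Sum.inl i)) (fun i => -MvPolynomial.X (Sum.inr i)))

theorem euler_X_inl (i : I) :
    euler (MvPolynomial.X (Sum.inl i)) = (MvPolynomial.X (Sum.inl i) : MvPolynomial (I ⊕ I) ℂ) := by
  rw [euler, MvPolynomial.mkDerivation_X, Sum.elim_inl]

theorem euler_X_inr (i : I) :
    euler (MvPolynomial.X (Sum.inr i)) =
      -(MvPolynomial.X (Sum.inr i) : MvPolynomial (I ⊕ I) ℂ) := by
  rw [euler, MvPolynomial.mkDerivation_X, Sum.elim_inr]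

theorem euler_monomial (m : I ⊕ I →₀ ℕ) :
    euler (monomial m 1) = (weightDiff m : ℂ) • (monomial m 1 : MvPolynomial (I ⊕ I) ℂ) := by
  induction m using Finsupp.induction_linear with
  | zero =>
    rw [map_zero, Int.cast_zero, zero_smul]
    exact Derivation.map_one_eq_zero _
  | add m n hm hn =>
    have e : (monomial (m + n) 1 : MvPolynomial (I ⊕ I) ℂ) = monomial m 1 * monomial n 1 := by
      rw [MvPolynomial.monomial_mul, one_mul]
    rw [e, Derivation.leibniz, hm, hn, map_add, smul_eq_mul, smul_eq_mul, mul_smul_comm,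
      mul_smul_comm, mul_comm (monomial n 1)]
    push_cast
    module
  | single a k =>
    rw [← MvPolynomial.X_pow_eq_monomial, weightDiff, Finsupp.weight_single, nsmul_eq_mul]
    induction k with
    | zero => simp
    | succ k ih =>
      rw [pow_succ, Derivation.leibniz, ih]
      rcases a with i | i
      · rw [euler_X_inl]
        simp only [smul_eq_mul, Sum.elim_inl, Pi.one_apply, mul_smul_comm, mul_one]
        rw [mul_comm (MvPolynomial.X (Sum.inl i))]
        push_cast
        module
      · rw [euler_X_inr]
        simp only [smul_eq_mul, Sum.elim_inr, Pi.neg_apply, Pi.one_apply, mul_smul_comm, mul_neg,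
          mul_one]
        rw [mul_comm (MvPolynomial.X (Sum.inr i))]
        push_cast
        module

/-- The span of the monomials of degree less than `d` in the letters `x i`. -/
noncomputable def xFiltration (I : Type*) (d : ℕ) : Submodule ℂ (MvPolynomial (I ⊕ I) ℂ) :=
  Submodule.span ℂ {r | ∃ m, xDegree m < d ∧ r = monomial m 1}

theorem xFiltration_mono {d e : ℕ} (hde : d ≤ e) : xFiltration I d ≤ xFiltration I e :=
  Submodule.span_mono fun _ ⟨m, hm, hr⟩ => ⟨m, hm.trans_le hde, hr⟩

theorem euler_mem_xFiltration {d : ℕ} {r : MvPolynomial (I ⊕ I) ℂ} (hr : r ∈ xFiltration I d) :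
    euler r ∈ xFiltration I d := by
  induction hr using Submodule.span_induction with
  | zero => rw [map_zero]; exact zero_mem _
  | add a b _ _ ha hb => rw [map_add]; exact add_mem ha hb
  | smul c a _ ha => rw [Derivation.map_smul]; exact Submodule.smul_mem _ c ha
  | mem a ha =>
    obtain ⟨m, hm, rfl⟩ := ha
    rw [euler_monomial]
    exact Submodule.smul_mem _ _ (Submodule.subset_span ⟨m, hm, rfl⟩)

theorem X_inl_mul_mem_xFiltration (i : I) {d : ℕ} {r : MvPolynomial (I ⊕ I) ℂ}
    (hr : r ∈ xFiltration I d) :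
    MvPolynomial.X (Sum.inl i) * r ∈ xFiltration I d := by
  induction hr using Submodule.span_induction with
  | zero => rw [mul_zero]; exact zero_mem _
  | add a b _ _ ha hb => rw [mul_add]; exact add_mem ha hb
  | smul c a _ ha => rw [mul_smul_comm]; exact Submodule.smul_mem _ c ha
  | mem b hb =>
    obtain ⟨m, hm, rfl⟩ := hb
    refine Submodule.subset_span ⟨Finsupp.single (Sum.inl i) 1 + m, ?_, ?_⟩
    · rw [map_add, xDegree, Finsupp.weight_single, one_smul, Sum.elim_inl]
      rw [xDegree] at hm
      simp only [Pi.zero_apply]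
      omega
    · rw [MvPolynomial.X, MvPolynomial.monomial_mul, one_mul]

theorem X_inr_mul_mem_xFiltration (i : I) {d : ℕ} {r : MvPolynomial (I ⊕ I) ℂ}
    (hr : r ∈ xFiltration I d) :
    MvPolynomial.X (Sum.inr i) * r ∈ xFiltration I (d + 1) := by
  induction hr using Submodule.span_induction with
  | zero => rw [mul_zero]; exact zero_mem _
  | add a b _ _ ha hb => rw [mul_add]; exact add_mem ha hb
  | smul c a _ ha => rw [mul_smul_comm]; exact Submodule.smul_mem _ c ha
  | mem b hb =>
    obtain ⟨m, hm, rfl⟩ := hb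
    refine Submodule.subset_span ⟨Finsupp.single (Sum.inr i) 1 + m, ?_, ?_⟩
    · rw [map_add, xDegree, Finsupp.weight_single, one_smul, Sum.elim_inr]
      rw [xDegree] at hm
      simp only [Pi.one_apply]
      omega
    · rw [MvPolynomial.X, MvPolynomial.monomial_mul, one_mul]

theorem exists_mem_xFiltration (r : MvPolynomial (I ⊕ I) ℂ) : ∃ d, r ∈ xFiltration I d := by
  induction r using MvPolynomial.induction_on' with
  | monomial m c =>
    refine ⟨xDegree m + 1, ?_⟩
    rw [← mul_one c, ← smul_eq_mul, ← MvPolynomial.smul_monomial]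
    exact Submodule.smul_mem _ _ (Submodule.subset_span ⟨m, Nat.lt_succ_self _, rfl⟩)
  | add a b ha hb =>
    obtain ⟨d, hd⟩ := ha
    obtain ⟨e, he⟩ := hb
    exact ⟨max d e, add_mem (xFiltration_mono (le_max_left _ _) hd)
      (xFiltration_mono (le_max_right _ _) he)⟩

theorem prod_map_X_toList (m : I ⊕ I →₀ ℕ) :
    ((Finsupp.toMultiset m).toList.map MvPolynomial.X).prod =
      (monomial m 1 : MvPolynomial (I ⊕ I) ℂ) := by
  rw [← Multiset.prod_coe, ← Multiset.map_coe, Multiset.coe_toList]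
  induction m using Finsupp.induction_linear with
  | zero => simp
  | add m n hm hn =>
    rw [map_add, Multiset.map_add, Multiset.prod_add, hm, hn, MvPolynomial.monomial_mul, one_mul]
  | single a k =>
    rw [Finsupp.toMultiset_single, Multiset.map_nsmul, Multiset.prod_nsmul, Multiset.map_singleton,
      Multiset.prod_singleton, MvPolynomial.X_pow_eq_monomial]

theorem xCount_toList (m : I ⊕ I →₀ ℕ) : xCount (Finsupp.toMultiset m).toList = xDegree m := by
  rw [xCount, ← Multiset.sum_coe, ← Multiset.map_coe, Multiset.coe_toList]
  induction m using Finsupp.induction_linear with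
  | zero => simp
  | add m n hm hn => rw [map_add, Multiset.map_add, Multiset.sum_add, hm, hn, map_add]
  | single a k =>
    rw [Finsupp.toMultiset_single, Multiset.map_nsmul, Multiset.sum_nsmul, Multiset.map_singleton,
      Multiset.sum_singleton, xDegree, Finsupp.weight_single]

variable (h : ℂ) [LinearOrder I]

/-- The representation of `H_I` on commutative polynomials. -/
noncomputable def polyRep : HAlg h I →ₐ[ℂ] Module.End ℂ (MvPolynomial (I ⊕ I) ℂ) :=
  liftH h
    -- The correction uses an Euler operator of weight `1` on the letters `y` and `-1` on the
    -- letters `x`. Commuting it past `y_j` yields the term `h y_i y_j`, and commuting it past `x_j`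
    -- yields the `h`-terms between two `x`'s.
    (fun i => LinearMap.mulLeft ℂ (MvPolynomial.X (Sum.inr i)) +
      h • (LinearMap.mulLeft ℂ (MvPolynomial.X (Sum.inl i)) ∘ₗ (euler (I := I) : MvPolynomial (I ⊕ I) ℂ →ₗ[ℂ] MvPolynomial (I ⊕ I) ℂ)))
    (fun i => LinearMap.mulLeft ℂ (MvPolynomial.X (Sum.inl i)))
    (fun i j => by
      refine LinearMap.ext fun r => ?_
      simp only [Module.End.mul_apply, LinearMap.mulLeft_apply]
      ring)
    (fun i j => by
      refine LinearMap.ext fun r => ?_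
      simp only [Module.End.mul_apply, LinearMap.mulLeft_apply, LinearMap.add_apply,
        LinearMap.smul_apply, LinearMap.comp_apply,
        Derivation.coeFn_coe, Derivation.leibniz, euler_X_inl, smul_eq_mul,
        MvPolynomial.smul_eq_C_mul]
      ring)
    (fun i j => by
      refine LinearMap.ext fun r => ?_
      simp only [Module.End.mul_apply, LinearMap.mulLeft_apply, LinearMap.add_apply,
        LinearMap.sub_apply, map_add, MvPolynomial.smul_eq_C_mul, MvPolynomial.derivation_C,
        LinearMap.smul_apply, LinearMap.comp_apply,
        Derivation.coeFn_coe, Derivation.leibniz, euler_X_inl, euler_X_inr, smul_eq_mul, map_pow]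
      ring)

theorem polyRep_y (i : I) (r : MvPolynomial (I ⊕ I) ℂ) :
    polyRep h (y h i) r = MvPolynomial.X (Sum.inl i) * r := by
  rw [polyRep, liftH_y, LinearMap.mulLeft_apply]

theorem polyRep_x (i : I) (r : MvPolynomial (I ⊕ I) ℂ) :
    polyRep h (x h i) r =
      MvPolynomial.X (Sum.inr i) * r + h • (MvPolynomial.X (Sum.inl i) * euler r) := by
  rw [polyRep, liftH_x]
  rfl

/-- The correction in the action of `x_i` multiplies by `y_i` and rescales monomials, so it does not
raise the degree in the letters `x`. The leading part is the commutative product. The second clause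
supplies the bound needed for the next letter. -/
theorem polyRep_prod_x_sub_mem (w : List (I ⊕ I)) :
    polyRep h (w.map (Sum.elim 1 (x h))).prod 1 -
      (w.map (Sum.elim 1 fun i => MvPolynomial.X (Sum.inr i))).prod ∈
        xFiltration I (xCount w) ∧
    polyRep h (w.map (Sum.elim 1 (x h))).prod 1 ∈ xFiltration I (xCount w + 1) := by
  induction w with
  | nil => exact ⟨by simp, Submodule.subset_span ⟨0, by simp, by simp⟩⟩
  | cons a w ih =>
    rcases a with i | i
    · simpa [xCount] using ih
    · have hx : xCount (Sum.inr i :: w) = xCount w + 1 := by simp [xCount, add_comm]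
      rw [hx]
      simp only [List.map_cons, List.prod_cons, Sum.elim_inr, map_mul, Module.End.mul_apply,
        polyRep_x]
      have h1 := Submodule.smul_mem _ h
        (X_inl_mul_mem_xFiltration i (euler_mem_xFiltration ih.2))
      refine ⟨?_, add_mem (X_inr_mul_mem_xFiltration i ih.2)
        (xFiltration_mono (Nat.le_succ _) h1)⟩
      rw [add_sub_right_comm, ← mul_sub]
      exact add_mem (X_inr_mul_mem_xFiltration i ih.1) h1

theorem polyRep_orderedProd_sub_mem (w : List (I ⊕ I)) :
    polyRep h (orderedProd h w) 1 - (w.map MvPolynomial.X).prod ∈ xFiltration I (xCount w) := by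
  have e : (w.map MvPolynomial.X).prod =
      (w.map (Sum.elim (fun i => MvPolynomial.X (Sum.inl i)) 1)).prod *
      (w.map (Sum.elim 1 fun i => (MvPolynomial.X (Sum.inr i) : MvPolynomial (I ⊕ I) ℂ))).prod := by
    rw [← List.prod_map_mul]
    congr 1
    refine List.map_congr_left fun a _ => ?_
    rcases a with i | i <;> simp
  rw [e, orderedProd, map_mul, Module.End.mul_apply]
  suffices H : ∀ (v : List (I ⊕ I)) (d : ℕ) (r s : MvPolynomial (I ⊕ I) ℂ), r - s ∈ xFiltration I d →
      polyRep h (v.map (Sum.elim (y h) 1)).prod r -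
        (v.map (Sum.elim (fun i => MvPolynomial.X (Sum.inl i)) 1)).prod * s ∈ xFiltration I d from
    H w _ _ _ (polyRep_prod_x_sub_mem h w).1
  intro v d r s hrs
  induction v with
  | nil => simpa using hrs
  | cons a v ih =>
    rcases a with i | i
    · simp only [List.map_cons, List.prod_cons, Sum.elim_inl, map_mul, Module.End.mul_apply,
        polyRep_y, mul_assoc, ← mul_sub]
      have hl := X_inl_mul_mem_xFiltration i ih
      exact hl
    · simpa using ih

/-- Acting on `1` after `orderedMap` is unipotent for the filtration by degree in the letters `x`,
hence injective. -/
theorem polyRep_orderedMap_sub_mem {d : ℕ} {r : MvPolynomial (I ⊕ I) ℂ}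
    (hr : r ∈ xFiltration I (d + 1)) :
    polyRep h (orderedMap h r) 1 - r ∈ xFiltration I d := by
  induction hr using Submodule.span_induction with
  | zero => simp
  | add a b _ _ ha hb =>
    rw [map_add, map_add, LinearMap.add_apply, add_sub_add_comm]
    exact add_mem ha hb
  | smul c a _ ha =>
    rw [map_smul, map_smul, LinearMap.smul_apply, ← smul_sub]
    exact Submodule.smul_mem _ c ha
  | mem a ha =>
    obtain ⟨m, hm, rfl⟩ := ha
    have := polyRep_orderedProd_sub_mem h (Finsupp.toMultiset m).toList
    rw [prod_map_X_toList, xCount_toList, ← orderedMap_monomial] at this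
    exact xFiltration_mono (Nat.lt_succ_iff.1 hm) this

/-- The polynomial representation is faithful, even on the vector `1`. -/
theorem eq_zero_of_polyRep_one_eq_zero {a : HAlg h I} (ha : polyRep h a 1 = 0) : a = 0 := by
  obtain ⟨r, rfl⟩ := orderedMap_surjective h a
  obtain ⟨d, hd⟩ := exists_mem_xFiltration r
  suffices r = 0 by rw [this, map_zero]
  induction d with
  | zero =>
    have : xFiltration I 0 = ⊥ := by
      rw [xFiltration, Submodule.span_eq_bot]
      rintro _ ⟨m, hm, -⟩
      exact absurd hm (Nat.not_lt_zero _)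
    rw [this] at hd
    exact hd
  | succ d ih =>
    have := polyRep_orderedMap_sub_mem h hd
    rw [ha, zero_sub, neg_mem_iff] at this
    exact ih this

end PolynomialRepresentation

namespace ShiftAlg

/-! ### The polynomial representation inside the skew Laurent polynomials. -/

section Injective

open MvPolynomial (monomial)

/-- The value of the coefficient of `y ^ m` at the point `m`. -/
noncomputable def diagEval {R : Type*} [CommRing R] (m : ℤ) : ShiftAlg R →+ R :=
  (evalRingHom (m : R)).toAddMonoidHom.comp (coeff m)

theorem diagEval_apply {R : Type*} [CommRing R] (m : ℤ) (a : ShiftAlg R) :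
    diagEval m a = (coeff m a).eval (m : R) := rfl

theorem diagEval_mono {R : Type*} [CommRing R] (m n : ℤ) (p : R[X]) :
    diagEval m (mono n p) = if n = m then p.eval (m : R) else 0 := by
  rw [diagEval_apply, coeff_mono]
  split_ifs <;> simp

/-- Since `p(X) y^m = y^m p(X + m)`, evaluating the coefficient of `y^m` at `m` is reduction modulo
the left ideal generated by `X`. The formula is the left action on this quotient. -/
theorem diagEval_mono_mul {R : Type*} [CommRing R] (l k : ℤ) (p : R[X]) (b : ShiftAlg R) :
    diagEval l (mono k p * b) = p.eval (l : R) * diagEval (l - k) b := by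
  induction b using induction with
  | hm n q =>
    rw [mono_mul_mono, diagEval_mono, diagEval_mono]
    by_cases hl : k + n = l
    · subst hl
      simp [taylor_eval]
    · rw [if_neg hl, if_neg (by omega), mul_zero]
  | hadd a b ha hb => rw [mul_add, map_add, ha, hb, map_add, mul_add]

theorem diagEval_mul_eq_zero {R : Type*} [CommRing R] (a : ShiftAlg R) {b : ShiftAlg R}
    (hb : ∀ m, diagEval m b = 0) (m : ℤ) : diagEval m (a * b) = 0 := by
  induction a using induction with
  | hm k p => rw [diagEval_mono_mul, hb, mul_zero]
  | hadd a a' ha ha' => rw [add_mul, map_add, ha, ha', add_zero]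

variable {R : Type*} [CommRing R] [Algebra ℂ R] {I : Type*} (h : ℂ) (t s : I → R)

/-- The realization of the polynomial representation inside the algebra `ShiftAlg R`. -/
noncomputable def polyEmbed : MvPolynomial (I ⊕ I) ℂ →ₗ[ℂ] ShiftAlg R :=
  (MvPolynomial.basisMonomials (I ⊕ I) ℂ).constr ℂ fun d =>
    mono (weightDiff d) (C (MvPolynomial.aeval (Sum.elim t s) (monomial d (1 : ℂ))))

theorem polyEmbed_monomial (d : I ⊕ I →₀ ℕ) : polyEmbed t s (monomial d 1) =
    mono (weightDiff d) (C (MvPolynomial.aeval (Sum.elim t s) (monomial d (1 : ℂ)))) :=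
  (MvPolynomial.basisMonomials (I ⊕ I) ℂ).constr_basis ℂ _ d

theorem induction_monomial {P : MvPolynomial (I ⊕ I) ℂ → Prop} (hm : ∀ d, P (monomial d 1))
    (hs : ∀ (c : ℂ) a, P a → P (c • a)) (hadd : ∀ a b, P a → P b → P (a + b))
    (r : MvPolynomial (I ⊕ I) ℂ) : P r := by
  induction r using MvPolynomial.induction_on' with
  | monomial m c =>
    rw [← mul_one c, ← smul_eq_mul, ← MvPolynomial.smul_monomial]
    exact hs c _ (hm m)
  | add a b ha hb => exact hadd a b ha hb

theorem polyEmbed_X_inl_mul (i : I) (r : MvPolynomial (I ⊕ I) ℂ) :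
    polyEmbed t s (MvPolynomial.X (Sum.inl i) * r) = mono 1 (C (t i)) * polyEmbed t s r := by
  induction r using induction_monomial with
  | hm d =>
    rw [MvPolynomial.X, MvPolynomial.monomial_mul, one_mul, polyEmbed_monomial, polyEmbed_monomial,
      mono_mul_mono, taylor_C, ← C_mul, map_add, weightDiff, Finsupp.weight_single,
      ← one_mul (1 : ℂ), ← MvPolynomial.monomial_mul, map_mul, ← MvPolynomial.X,
      MvPolynomial.aeval_X, one_mul]
    simp
  | hs c a ha => rw [mul_smul_comm, map_smul, ha, map_smul, mul_smul_comm]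
  | hadd a b ha hb => rw [mul_add, map_add, ha, hb, map_add, mul_add]

theorem polyEmbed_X_inr_mul (i : I) (r : MvPolynomial (I ⊕ I) ℂ) :
    polyEmbed t s (MvPolynomial.X (Sum.inr i) * r) = mono (-1) (C (s i)) * polyEmbed t s r := by
  induction r using induction_monomial with
  | hm d =>
    rw [MvPolynomial.X, MvPolynomial.monomial_mul, one_mul, polyEmbed_monomial, polyEmbed_monomial,
      mono_mul_mono, taylor_C, ← C_mul, map_add, weightDiff, Finsupp.weight_single,
      ← one_mul (1 : ℂ), ← MvPolynomial.monomial_mul, map_mul, ← MvPolynomial.X,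
      MvPolynomial.aeval_X, one_mul]
    simp
  | hs c a ha => rw [mul_smul_comm, map_smul, ha, map_smul, mul_smul_comm]
  | hadd a b ha hb => rw [mul_add, map_add, ha, hb, map_add, mul_add]

theorem diagEval_smul (c : ℂ) (m : ℤ) (a : ShiftAlg R) :
    diagEval m (c • a) = algebraMap ℂ R c * diagEval m a := by
  rw [diagEval_apply, coeff_smul, eval_smul, Algebra.smul_def, diagEval_apply]

/-- At `X = m` the factor `X - 1` equals `m - 1`, which is the weight of any monomial that `y_i`
carries into weight `m`. So `X - 1` reproduces the Euler operator. -/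
theorem diagEval_polyEmbed_euler (i : I) (r : MvPolynomial (I ⊕ I) ℂ) (m : ℤ) :
    diagEval m (polyEmbed t s (h • (MvPolynomial.X (Sum.inl i) * euler r))) =
      diagEval m (mono 1 (C (algebraMap ℂ R h * t i) * (X - 1)) * polyEmbed t s r) := by
  induction r using induction_monomial with
  | hm d =>
    rw [euler_monomial, map_smul (polyEmbed t s), mul_smul_comm, map_smul (polyEmbed t s),
      polyEmbed_X_inl_mul, polyEmbed_monomial,
      diagEval_smul, diagEval_smul, diagEval_mono_mul, diagEval_mono_mul, diagEval_mono]
    by_cases hm : weightDiff d = m - 1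
    · rw [if_pos hm, hm]
      simp
      ring
    · rw [if_neg hm]
      simp
  | hs c a ha =>
    rw [Derivation.map_smul, mul_smul_comm, smul_comm, map_smul, diagEval_smul, ha, map_smul,
      mul_smul_comm, diagEval_smul]
  | hadd a b ha hb =>
    rw [map_add, mul_add, smul_add, map_add, map_add, ha, hb, map_add, mul_add, map_add]

/-- The realization acts on the quotient as the polynomial representation does. It is checked on
generators, and products are allowed because the common kernel of the evaluations is a left ideal.
-/
theorem diagEval_realize_mul [LinearOrder I] (a : HAlg h I) (r : MvPolynomial (I ⊕ I) ℂ) (m : ℤ) :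
    diagEval m (realize h t s a * polyEmbed t s r) =
      diagEval m (polyEmbed t s (polyRep h a r)) := by
  induction a using induction_on generalizing r m with
  | hc c =>
    rw [AlgHom.commutes, AlgHom.commutes, ← Algebra.smul_def, Module.algebraMap_end_apply,
      map_smul (polyEmbed t s)]
  | hx i =>
    rw [polyRep_x, realize_x, map_add, map_add, diagEval_polyEmbed_euler, polyEmbed_X_inr_mul,
      add_mul, map_add, add_comm]
  | hy i => rw [polyRep_y, realize_y, polyEmbed_X_inl_mul]
  | hadd a b ha hb =>
    rw [map_add, map_add, add_mul, map_add, ha, hb, LinearMap.add_apply, map_add, map_add]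
  | hmul a b ha hb =>
    rw [map_mul (realize h t s), map_mul (polyRep h), Module.End.mul_apply, ← ha, mul_assoc, ← sub_eq_zero, ← map_sub,
      ← mul_sub]
    exact diagEval_mul_eq_zero _ (fun k => by rw [map_sub, hb, sub_self]) m

/-- Each evaluation at `m` is the value of the part of `r` of weight `m`. Summing over the weights
that occur recovers the value of `r`. -/
theorem aeval_eq_zero_of_diagEval {r : MvPolynomial (I ⊕ I) ℂ}
    (hr : ∀ m, diagEval m (polyEmbed t s r) = 0) : MvPolynomial.aeval (Sum.elim t s) r = 0 := by
  classical
  have key : ∀ m, diagEval m (polyEmbed t s r) = ∑ d ∈ r.support,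
      if weightDiff d = m then MvPolynomial.aeval (Sum.elim t s) (monomial d (r.coeff d)) else 0 := by
    intro m
    conv_lhs => rw [r.as_sum]
    rw [map_sum, map_sum]
    refine Finset.sum_congr rfl fun d _ => ?_
    rw [← mul_one (r.coeff d), ← smul_eq_mul, ← MvPolynomial.smul_monomial, map_smul,
      polyEmbed_monomial, diagEval_smul, diagEval_mono, map_smul, Algebra.smul_def, mul_ite, mul_zero, eval_C]
  have h1 : ∑ m ∈ r.support.image weightDiff, diagEval m (polyEmbed t s r) = 0 :=
    Finset.sum_eq_zero fun m _ => hr m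
  simp only [key] at h1
  rw [Finset.sum_comm] at h1
  conv_lhs => rw [r.as_sum]
  rw [map_sum, ← h1]
  refine Finset.sum_congr rfl fun d hd => ?_
  rw [Finset.sum_ite_eq, if_pos (Finset.mem_image_of_mem _ hd)]

theorem realize_injective [LinearOrder I] (hts : AlgebraicIndependent ℂ (Sum.elim t s)) :
    Function.Injective (realize h t s) := by
  refine (injective_iff_map_eq_zero _).2 fun a ha => eq_zero_of_polyRep_one_eq_zero h ?_
  refine (injective_iff_map_eq_zero _).1 hts _ (aeval_eq_zero_of_diagEval t s fun m => ?_)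
  rw [← diagEval_realize_mul, ha, zero_mul, map_zero]

/-- Specializing the auxiliary variable at `0` turns the family `p_i + s_i q`, `s_i` into `p_i`,
`s_i`, so independence lifts. -/
theorem model_injective {L : Type*} [Field L] [Algebra ℂ L] [LinearOrder I] (p s : I → L)
    (hps : AlgebraicIndependent ℂ (Sum.elim p s)) : Function.Injective (model h p s) := by
  refine realize_injective h _ _ (AlgebraicIndependent.of_comp
    ((Polynomial.aeval (0 : L)).restrictScalars ℂ) ?_)
  convert hps using 1
  ext (i | i) <;> simp

end Injective

end ShiftAlg

/-! ### Polarization -/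

section Polarization

variable (h : ℂ) {I : Type u} [LinearOrder I]

theorem polarize_algebraMap (k l : I) (c : ℂ) : polarize h k l (algebraMap ℂ _ c) = 0 := by
  rw [Algebra.algebraMap_eq_smul_one, map_smul, polarize, skewDer_one, smul_zero]

theorem opE_algebraMap (c : ℂ) : opE h (algebraMap ℂ (HAlg h I) c) = 0 := by
  rw [Algebra.algebraMap_eq_smul_one, map_smul, opE, skewDer_one, smul_zero]

theorem opF_algebraMap (c : ℂ) : opF h (algebraMap ℂ (HAlg h I) c) = 0 := by
  rw [Algebra.algebraMap_eq_smul_one, map_smul, opF, skewDer_one, smul_zero]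

theorem opH_algebraMap (c : ℂ) : opH h (algebraMap ℂ (HAlg h I) c) = 0 := by
  rw [Algebra.algebraMap_eq_smul_one, map_smul, opH, skewDer_one, smul_zero]

theorem polarize_shift (k l : I) (c : ℂ) (a : HAlg h I) :
    polarize h k l (shift h c a) = shift h c (polarize h k l a) := by
  induction a using induction_on with
  | hc c => rw [AlgHom.commutes, polarize_algebraMap, map_zero]
  | hx i =>
    rw [shift_x, map_add, map_smul, polarize_x, polarize_y]
    split_ifs <;> simp
  | hy i =>
    rw [shift_y, polarize_y]
    split_ifs <;> simp
  | hadd a b ha hb => rw [map_add, map_add, ha, hb, map_add, map_add]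
  | hmul a b ha hb => rw [map_mul, polarize_mul, ha, hb, polarize_mul, map_add, map_mul, map_mul]

theorem polarize_opF (k l : I) (a : HAlg h I) :
    polarize h k l (opF h a) = opF h (polarize h k l a) := by
  induction a using induction_on with
  | hc c => rw [polarize_algebraMap, opF_algebraMap, map_zero, map_zero]
  | hx i =>
    rw [opF_x, polarize_x, polarize_y]
    split_ifs <;> simp
  | hy i =>
    rw [opF_y, polarize_y]
    split_ifs <;> simp
  | hadd a b ha hb => rw [map_add, map_add, ha, hb, map_add, map_add]
  | hmul a b ha hb =>
    rw [opF_mul, map_add, polarize_mul, polarize_mul, polarize_mul, map_add, opF_mul, opF_mul,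
      ha, hb]
    abel

theorem polarize_opE (k l : I) (a : HAlg h I) :
    polarize h k l (opE h a) = opE h (polarize h k l a) := by
  induction a using induction_on with
  | hc c => rw [polarize_algebraMap, opE_algebraMap, map_zero, map_zero]
  | hx i =>
    rw [opE_x, polarize_x, map_zero]
    split_ifs <;> simp
  | hy i =>
    rw [opE_y, polarize_x, polarize_y]
    split_ifs <;> simp
  | hadd a b ha hb => rw [map_add, map_add, ha, hb, map_add, map_add]
  | hmul a b ha hb =>
    rw [opE_mul, map_add, polarize_mul, polarize_mul, polarize_mul, map_add, opE_mul, opE_mul,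
      ha, hb, polarize_shift, polarize_shift]
    abel

theorem polarize_opH (k l : I) (a : HAlg h I) :
    polarize h k l (opH h a) = opH h (polarize h k l a) := by
  induction a using induction_on with
  | hc c => rw [polarize_algebraMap, opH_algebraMap, map_zero, map_zero]
  | hx i =>
    rw [opH_x, polarize_x]
    split_ifs <;> simp
  | hy i =>
    rw [opH_y, map_neg, polarize_y]
    split_ifs <;> simp
  | hadd a b ha hb => rw [map_add, map_add, ha, hb, map_add, map_add]
  | hmul a b ha hb =>
    rw [opH_mul, map_add, polarize_mul, polarize_mul, polarize_mul, map_add, opH_mul, opH_mul,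
      ha, hb, polarize_shift, polarize_shift]
    abel

variable {h} in
theorem IsInvariant.smul_polarize (k l : I) (c : ℂ) {a : HAlg h I} (ha : IsInvariant h a) :
    IsInvariant h (c • polarize h k l a) := by
  refine ⟨?_, ?_, ?_⟩
  · rw [map_smul, ← polarize_opE, ha.1, map_zero, smul_zero]
  · rw [map_smul, ← polarize_opF, ha.2.1, map_zero, smul_zero]
  · rw [map_smul, ← polarize_opH, ha.2.2, map_zero, smul_zero]

variable {h} in
theorem IsInvariant.polar (k l : I) (d m : ℕ) {a : HAlg h I} (ha : IsInvariant h a) :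
    IsInvariant h (polar h k l d m a) := by
  induction m generalizing d a with
  | zero => exact ha
  | succ m ih => exact ih _ (ha.smul_polarize k l _)

/-- The definition of `polar` peels off the first polarization. Here the last one is peeled off,
applied in the remaining degree `d - m`. -/
theorem polar_succ (k l : I) (d m : ℕ) (a : HAlg h I) :
    polar h k l d (m + 1) a = (1 / ((d - m : ℕ) : ℂ)) • polarize h k l (polar h k l d m a) := by
  induction m generalizing d a with
  | zero => rfl
  | succ m ih =>
    rw [polar, ih, polar, Nat.sub_sub, add_comm 1 m]

/-- The endomorphism of `H_I` induced by a map of the index set. -/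
def relabel (e : I → I) : HAlg h I →ₐ[ℂ] HAlg h I :=
  liftH h (fun i => x h (e i)) (fun i => y h (e i)) (fun i j => y_comm h (e i) (e j))
    (fun i j => x_mul_y h (e i) (e j)) (fun i j => x_mul_x h (e i) (e j))

@[simp] theorem relabel_x (e : I → I) (i : I) : relabel h e (x h i) = x h (e i) := by simp [relabel]

@[simp] theorem relabel_y (e : I → I) (i : I) : relabel h e (y h i) = y h (e i) := by simp [relabel]

theorem algHom_eq_of_mem_subH {B : Type*} [Ring B] [Algebra ℂ B] {φ ψ : HAlg h I →ₐ[ℂ] B}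
    {S : Set I} (hx : ∀ i ∈ S, φ (x h i) = ψ (x h i)) (hy : ∀ i ∈ S, φ (y h i) = ψ (y h i))
    {a : HAlg h I} (ha : a ∈ subH h S) : φ a = ψ a := by
  have : subH h S ≤ AlgHom.equalizer φ ψ := by
    refine Algebra.adjoin_le ?_
    rintro _ (⟨i, hi, rfl⟩ | ⟨i, hi, rfl⟩)
    · exact hx i hi
    · exact hy i hi
  exact this ha

theorem x_mem_subH {S : Set I} {i : I} (hi : i ∈ S) : x h i ∈ subH h S :=
  Algebra.subset_adjoin (Or.inl ⟨i, hi, rfl⟩)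

theorem y_mem_subH {S : Set I} {i : I} (hi : i ∈ S) : y h i ∈ subH h S :=
  Algebra.subset_adjoin (Or.inr ⟨i, hi, rfl⟩)

theorem subH_mono {S T : Set I} (hST : S ⊆ T) : subH h S ≤ subH h T :=
  Algebra.adjoin_mono (Set.union_subset_union (Set.image_mono hST) (Set.image_mono hST))

theorem polarize_eq_zero_of_mem_subH (k l : I) {a : HAlg h I} (ha : a ∈ subH h {k}ᶜ) :
    polarize h k l a = 0 := by
  induction ha using Algebra.adjoin_induction with
  | mem a ha =>
    rcases ha with ⟨i, hi, rfl⟩ | ⟨i, hi, rfl⟩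
    · rw [polarize_x, if_neg (show i ≠ k from hi)]
    · rw [polarize_y, if_neg (show i ≠ k from hi)]
  | algebraMap c => exact polarize_algebraMap h k l c
  | add a b _ _ ha hb => rw [map_add, ha, hb, add_zero]
  | mul a b _ _ ha hb => rw [polarize_mul, ha, hb, zero_mul, mul_zero, add_zero]

/-- The elements of degree `d` with respect to the index `k`, written with `x k` and `y k`
on the left. -/
def degPart (k : I) (d : ℕ) : Submodule ℂ (HAlg h I) :=
  Submodule.span ℂ {x h k, y h k} ^ d * Subalgebra.toSubmodule (subH h {k}ᶜ)

theorem mem_degPart_zero {k : I} {a : HAlg h I} : a ∈ degPart h k 0 ↔ a ∈ subH h {k}ᶜ := by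
  rw [degPart, pow_zero, one_mul, Subalgebra.mem_toSubmodule]

theorem degPart_induction {k : I} {P : ℕ → HAlg h I → Prop}
    (zero : ∀ a ∈ subH h {k}ᶜ, P 0 a)
    (hx : ∀ d, ∀ a ∈ degPart h k d, P d a → P (d + 1) (x h k * a))
    (hy : ∀ d, ∀ a ∈ degPart h k d, P d a → P (d + 1) (y h k * a))
    (hadd : ∀ d a b, P d a → P d b → P d (a + b))
    {d : ℕ} {a : HAlg h I} (ha : a ∈ degPart h k d) : P d a := by
  induction d generalizing a with
  | zero => exact zero a ((mem_degPart_zero h).1 ha)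
  | succ d ih =>
    rw [degPart, pow_succ', mul_assoc, ← degPart] at ha
    refine Submodule.mul_induction_on ha (fun g hg v hv => ?_) (hadd _)
    obtain ⟨b, c, rfl⟩ := Submodule.mem_span_pair.1 hg
    rw [add_mul, smul_mul_assoc, smul_mul_assoc, ← mul_smul_comm, ← mul_smul_comm]
    exact hadd _ _ _ (hx d _ (Submodule.smul_mem _ b hv) (ih (Submodule.smul_mem _ b hv)))
      (hy d _ (Submodule.smul_mem _ c hv) (ih (Submodule.smul_mem _ c hv)))

theorem x_mul_mem_degPart {k : I} {d : ℕ} {a : HAlg h I} (ha : a ∈ degPart h k d) :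
    x h k * a ∈ degPart h k (d + 1) := by
  rw [degPart, pow_succ', mul_assoc, ← degPart]
  exact Submodule.mul_mem_mul (Submodule.subset_span (Or.inl rfl)) ha

theorem y_mul_mem_degPart {k : I} {d : ℕ} {a : HAlg h I} (ha : a ∈ degPart h k d) :
    y h k * a ∈ degPart h k (d + 1) := by
  rw [degPart, pow_succ', mul_assoc, ← degPart]
  exact Submodule.mul_mem_mul (Submodule.subset_span (Or.inr rfl)) ha

/-- The defining relations are homogeneous in each index, so letters of index other than `k` move to
the right of `x_k`, `y_k` without changing the number of the latter. -/
theorem mul_mem_degPart {k : I} {a : HAlg h I} (ha : a ∈ subH h {k}ᶜ) {d : ℕ} {b : HAlg h I}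
    (hb : b ∈ degPart h k d) : a * b ∈ degPart h k d := by
  induction ha using Algebra.adjoin_induction generalizing b with
  | mem a ha =>
    obtain ⟨j, hj, hja⟩ : ∃ j, j ≠ k ∧ (a = x h j ∨ a = y h j) := by
      rcases ha with ⟨j, hj, rfl⟩ | ⟨j, hj, rfl⟩
      · exact ⟨j, hj, Or.inl rfl⟩
      · exact ⟨j, hj, Or.inr rfl⟩
    clear ha
    have key : x h j * b ∈ degPart h k d ∧ y h j * b ∈ degPart h k d := by
      refine degPart_induction h (P := fun d b => x h j * b ∈ degPart h k d ∧
        y h j * b ∈ degPart h k d) (fun a ha => ?_) (fun d a ha hxy => ?_) (fun d a ha hxy => ?_)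
        (fun d a b ha hb => ?_) hb
      · exact ⟨(mem_degPart_zero h).2 (mul_mem (x_mem_subH h hj) ha),
          (mem_degPart_zero h).2 (mul_mem (y_mem_subH h hj) ha)⟩
      · have e1 : x h j * (x h k * a) = x h k * (x h j * a) - h • (x h k * (y h j * a)) +
            h • (y h k * (x h j * a)) + h ^ 2 • (y h k * (y h j * a)) := by
          rw [← mul_assoc, x_mul_x h k j]
          simp only [add_mul, sub_mul, smul_mul_assoc, mul_assoc]
        have e2 : y h j * (x h k * a) = x h k * (y h j * a) - h • (y h k * (y h j * a)) := by
          rw [← mul_assoc, ← mul_assoc (x h k), x_mul_y h k j]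
          simp only [add_mul, smul_mul_assoc, mul_assoc, add_sub_cancel_right]
        rw [e1, e2]
        exact ⟨add_mem (add_mem (sub_mem (x_mul_mem_degPart h hxy.1)
          (Submodule.smul_mem _ _ (x_mul_mem_degPart h hxy.2)))
          (Submodule.smul_mem _ _ (y_mul_mem_degPart h hxy.1)))
          (Submodule.smul_mem _ _ (y_mul_mem_degPart h hxy.2)),
          sub_mem (x_mul_mem_degPart h hxy.2)
          (Submodule.smul_mem _ _ (y_mul_mem_degPart h hxy.2))⟩
      · have e1 : x h j * (y h k * a) = y h k * (x h j * a) + h • (y h k * (y h j * a)) := by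
          rw [← mul_assoc, x_mul_y h j k, y_comm h k j]
          simp only [add_mul, smul_mul_assoc, mul_assoc]
        have e2 : y h j * (y h k * a) = y h k * (y h j * a) := by
          rw [← mul_assoc, y_comm h k j, mul_assoc]
        rw [e1, e2]
        exact ⟨add_mem (y_mul_mem_degPart h hxy.1)
          (Submodule.smul_mem _ _ (y_mul_mem_degPart h hxy.2)), y_mul_mem_degPart h hxy.2⟩
      · rw [mul_add, mul_add]
        exact ⟨add_mem ha.1 hb.1, add_mem ha.2 hb.2⟩
    rcases hja with rfl | rfl
    · exact key.1
    · exact key.2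
  | algebraMap c => rw [← Algebra.smul_def]; exact Submodule.smul_mem _ c hb
  | add a a' _ _ ha ha' => rw [add_mul]; exact add_mem (ha hb) (ha' hb)
  | mul a a' _ _ ha ha' => rw [mul_assoc]; exact ha (ha' hb)

/-- Polarizing the leading letter leaves a letter of index `l` in front, which `mul_mem_degPart`
absorbs. The other term of the product rule is covered by induction. -/
theorem polarize_mem_degPart {k l : I} (hkl : k ≠ l) {d : ℕ} {a : HAlg h I}
    (ha : a ∈ degPart h k (d + 1)) : polarize h k l a ∈ degPart h k d := by
  have hl : l ∈ ({k}ᶜ : Set I) := hkl.symm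
  have step : ∀ (d : ℕ) (a : HAlg h I), a ∈ degPart h k d →
      (∀ e, d = e + 1 → polarize h k l a ∈ degPart h k e) →
      (d = 0 → polarize h k l a = 0) →
      ∀ g, (g = x h k ∧ polarize h k l g = x h l ∨ g = y h k ∧ polarize h k l g = y h l) →
      polarize h k l (g * a) ∈ degPart h k d := by
    intro d a ha h1 h0 g hg
    rw [polarize_mul]
    refine add_mem (mul_mem_degPart h ?_ ha) ?_
    · rcases hg with ⟨-, hg⟩ | ⟨-, hg⟩ <;> rw [hg]
      · exact x_mem_subH h hl
      · exact y_mem_subH h hl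
    · cases d with
      | zero => rw [h0 rfl, mul_zero]; exact zero_mem _
      | succ e =>
        rcases hg with ⟨rfl, -⟩ | ⟨rfl, -⟩
        · exact x_mul_mem_degPart h (h1 e rfl)
        · exact y_mul_mem_degPart h (h1 e rfl)
  refine (degPart_induction h (P := fun d a => (∀ e, d = e + 1 → polarize h k l a ∈ degPart h k e) ∧
    (d = 0 → polarize h k l a = 0)) (fun a ha => ?_) (fun d a ha hd => ?_) (fun d a ha hd => ?_)
    (fun d a b ha hb => ?_) ha).1 d rfl
  · exact ⟨fun e he => by omega, fun _ => polarize_eq_zero_of_mem_subH h k l ha⟩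
  · refine ⟨fun e he => ?_, fun he => by omega⟩
    obtain rfl : d = e := by omega
    exact step d a ha hd.1 hd.2 _ (Or.inl ⟨rfl, by rw [polarize_x, if_pos rfl]⟩)
  · refine ⟨fun e he => ?_, fun he => by omega⟩
    obtain rfl : d = e := by omega
    exact step d a ha hd.1 hd.2 _ (Or.inr ⟨rfl, by rw [polarize_y, if_pos rfl]⟩)
  · refine ⟨fun e he => ?_, fun he => ?_⟩
    · rw [map_add]; exact add_mem (ha.1 e he) (hb.1 e he)
    · rw [map_add, ha.2 he, hb.2 he, add_zero]

/-- The substitution of the index `l` for the index `k`. -/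
def substIdx (k l : I) : HAlg h I →ₐ[ℂ] HAlg h I := relabel h (Function.update id k l)

theorem substIdx_eq_self {k l : I} {a : HAlg h I} (ha : a ∈ subH h {k}ᶜ) :
    substIdx h k l a = a := by
  refine algHom_eq_of_mem_subH h (ψ := AlgHom.id ℂ _) (fun i hi => ?_) (fun i hi => ?_) ha
  · rw [substIdx, relabel_x, Function.update_of_ne hi]; rfl
  · rw [substIdx, relabel_y, Function.update_of_ne hi]; rfl

/-- Euler's identity: once the indices `k` and `l` are identified, polarization only counts the
letters of index `k`. -/
theorem substIdx_polarize {k l : I} (hkl : k ≠ l) {d : ℕ} {a : HAlg h I}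
    (ha : a ∈ degPart h k d) :
    substIdx h k l (polarize h k l a) = (d : ℂ) • substIdx h k l a := by
  have hx : substIdx h k l (x h l) = substIdx h k l (x h k) := by
    simp [substIdx, Function.update_of_ne hkl.symm]
  have hy : substIdx h k l (y h l) = substIdx h k l (y h k) := by
    simp [substIdx, Function.update_of_ne hkl.symm]
  refine degPart_induction h (P := fun d a => substIdx h k l (polarize h k l a) =
    (d : ℂ) • substIdx h k l a) (fun a ha => ?_) (fun d a ha hd => ?_) (fun d a ha hd => ?_)
    (fun d a b ha hb => ?_) ha
  · rw [polarize_eq_zero_of_mem_subH h k l ha, map_zero, Nat.cast_zero, zero_smul]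
  · rw [polarize_mul, polarize_x, if_pos rfl, map_add, map_mul, map_mul, hd, hx, map_mul,
      mul_smul_comm]
    push_cast
    module
  · rw [polarize_mul, polarize_y, if_pos rfl, map_add, map_mul, map_mul, hd, hy, map_mul,
      mul_smul_comm]
    push_cast
    module
  · rw [map_add, map_add, ha, hb, map_add, smul_add]

/-- The normalization `1 / d` cancels the factor in Euler's identity, so polars keep their value
under the substitution of `l` for `k`. -/
theorem polar_mem_degPart {k l : I} (hkl : k ≠ l) {d m : ℕ} (hmd : m ≤ d) {a : HAlg h I}
    (ha : a ∈ degPart h k d) :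
    polar h k l d m a ∈ degPart h k (d - m) ∧
      substIdx h k l (polar h k l d m a) = substIdx h k l a := by
  induction m generalizing d a with
  | zero => exact ⟨ha, rfl⟩
  | succ m ih =>
    obtain ⟨d, rfl⟩ : ∃ e, d = e + 1 := ⟨d - 1, by omega⟩
    have h1 := ih (d := d) (by omega)
      (Submodule.smul_mem _ (1 / ((d + 1 : ℕ) : ℂ)) (polarize_mem_degPart h hkl ha))
    rw [Nat.add_sub_add_right, polar]
    refine ⟨h1.1, h1.2.trans ?_⟩
    rw [map_smul, substIdx_polarize h hkl ha, smul_smul, one_div,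
      inv_mul_cancel₀ (by exact_mod_cast d.succ_ne_zero), one_smul]

theorem exists_eq_of_mem_degPart_one {k : I} {a : HAlg h I} (ha : a ∈ degPart h k 1) :
    ∃ b ∈ subH h {k}ᶜ, ∃ c ∈ subH h {k}ᶜ, a = x h k * b + y h k * c := by
  rw [degPart, pow_one] at ha
  refine Submodule.mul_induction_on ha (fun g hg v hv => ?_) ?_
  · obtain ⟨r, s, rfl⟩ := Submodule.mem_span_pair.1 hg
    rw [Subalgebra.mem_toSubmodule] at hv
    exact ⟨r • v, Subalgebra.smul_mem _ hv r, s • v, Subalgebra.smul_mem _ hv s, by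
      rw [add_mul, smul_mul_assoc, smul_mul_assoc, mul_smul_comm, mul_smul_comm]⟩
  · rintro _ _ ⟨b, hb, c, hc, rfl⟩ ⟨b', hb', c', hc', rfl⟩
    exact ⟨b + b', add_mem hb hb', c + c', add_mem hc hc', by rw [mul_add, mul_add]; abel⟩

end Polarization

/-! ### Polars of a binary form. -/

section Forms

variable {h : ℂ} {I : Type u} [LinearOrder I] {k l : I} {n : ℕ} {f : HAlg h I}

theorem IsForm.mem_degPart (hf : IsForm h k {k, l}ᶜ n f) : f ∈ degPart h k n := by
  obtain ⟨A, hA, rfl⟩ := hf.exists_coeff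
  refine sum_mem fun i hi => ?_
  have hA' : A i ∈ subH h {k}ᶜ :=
    subH_mono h (show ({k, l}ᶜ : Set I) ⊆ {k}ᶜ from fun j hj hk => hj (Or.inl hk)) (hA i)
  refine nsmul_mem (Submodule.mul_mem_mul ?_ ((Subalgebra.mem_toSubmodule _).2 hA')) _
  have := Submodule.mul_mem_mul
    (Submodule.pow_mem_pow (Submodule.span ℂ {x h k, y h k})
      (Submodule.subset_span (Set.mem_insert _ _)) (n - i))
    (Submodule.pow_mem_pow (Submodule.span ℂ {x h k, y h k})
      (Submodule.subset_span (Set.mem_insert_of_mem _ rfl)) i)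
  rwa [← pow_add, Nat.sub_add_cancel (Nat.lt_succ_iff.1 (Finset.mem_range.1 hi))] at this

/-- The form does not involve the index `l`, so substituting `k` back for `l` recovers it. -/
theorem IsForm.substIdx_ne_zero (hkl : k ≠ l) (hf : IsForm h k {k, l}ᶜ n f) :
    substIdx h k l f ≠ 0 := by
  have hmem : f ∈ subH h {l}ᶜ := by
    obtain ⟨A, hA, rfl⟩ := hf.exists_coeff
    refine sum_mem fun i _ => nsmul_mem (mul_mem (mul_mem (pow_mem (x_mem_subH h hkl) _)
      (pow_mem (y_mem_subH h hkl) _)) (subH_mono h ?_ (hA i))) _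
    exact Set.compl_subset_compl.2 (Set.singleton_subset_iff.2 (Or.inr rfl))
  have e : substIdx h l k (substIdx h k l f) = f := by
    refine algHom_eq_of_mem_subH h (φ := (substIdx h l k).comp (substIdx h k l))
      (ψ := AlgHom.id ℂ _) (fun i hi => ?_) (fun i hi => ?_) hmem <;>
    · by_cases hik : i = k
      · subst hik
        simp [substIdx]
      · simp [substIdx, Function.update_of_ne hik, Function.update_of_ne hi]
  intro h0
  rw [h0, map_zero] at e
  exact hf.ne_zero e.symm

theorem IsForm.polar_mem (hkl : k ≠ l) (hf : IsForm h k {k, l}ᶜ n f) :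
    polar h k l n n f ∈ subH h {k}ᶜ := by
  have := (polar_mem_degPart h hkl le_rfl hf.mem_degPart).1
  rwa [Nat.sub_self, mem_degPart_zero] at this

theorem IsForm.polar_eq_substIdx (hkl : k ≠ l) (hf : IsForm h k {k, l}ᶜ n f) :
    polar h k l n n f = substIdx h k l f := by
  rw [← (polar_mem_degPart h hkl le_rfl hf.mem_degPart).2, substIdx_eq_self h (hf.polar_mem hkl)]

/-- The next to last polar is a linear form, and the last one is obtained by substitution. -/
theorem IsForm.exists_polar_pred (hkl : k ≠ l) (hf : IsForm h k {k, l}ᶜ n f) (hn : n ≠ 0) :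
    ∃ b ∈ subH h {k}ᶜ, ∃ c ∈ subH h {k}ᶜ, polar h k l n (n - 1) f = x h k * b + y h k * c ∧
      polar h k l n n f = x h l * b + y h l * c := by
  have h1 := (polar_mem_degPart h hkl (Nat.sub_le n 1) hf.mem_degPart).1
  have e : n - (n - 1) = 1 := by omega
  rw [e] at h1
  obtain ⟨b, hb, c, hc, hbc⟩ := exists_eq_of_mem_degPart_one h h1
  refine ⟨b, hb, c, hc, hbc, ?_⟩
  have h2 := polar_succ h k l n (n - 1) f
  rw [Nat.sub_add_cancel (Nat.pos_of_ne_zero hn), e, hbc, Nat.cast_one, div_one, one_smul, map_add,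
    polarize_mul, polarize_mul, polarize_x, polarize_y, if_pos rfl, if_pos rfl,
    polarize_eq_zero_of_mem_subH h k l hb, polarize_eq_zero_of_mem_subH h k l hc, mul_zero,
    mul_zero, add_zero, add_zero] at h2
  exact h2

end Forms

/-! ### The factorization of a form in a model -/

section LinearAlgebra

/-- The solution of a linear system with coefficients in a noncommutative ring. -/
theorem solve_linear_system {S B : Type*} [CommRing S] [Ring B] [Algebra S B] {u u' w b c : B}
    {q W V η : S} (h1 : u * u' = 1) (h2 : u' * u = 1) (hw : w * u = u * w + η • (u * u))
    (e1 : w * b + u * c = algebraMap S B W) (e2 : (q • w + u') * b + (q • u) * c = algebraMap S B V) :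
    b = (V - q * W) • u ∧ -c - η • b = (V - q * W) • w - W • u' := by
  -- Subtracting `q` times the first equation from the second leaves `u' * b = V - q W`.
  have hb : b = (V - q * W) • u := by
    have : u' * b = algebraMap S B (V - q * W) := by
      rw [map_sub, map_mul, ← Algebra.smul_def, ← e1, ← e2, add_mul, smul_mul_assoc,
        smul_mul_assoc, smul_add]
      abel
    calc b = u * (u' * b) := by rw [← mul_assoc, h1, one_mul]
      _ = (V - q * W) • u := by rw [this, ← Algebra.commutes, Algebra.smul_def]
  refine ⟨hb, ?_⟩
  have hc : c = W • u' - (V - q * W) • (w + η • u) := by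
    calc c = u' * (w * b + u * c) - u' * (w * b) := by
          rw [mul_add, add_sub_cancel_left, ← mul_assoc, h2, one_mul]
      _ = W • u' - (V - q * W) • (u' * (w * u)) := by
          rw [e1, ← Algebra.commutes, ← Algebra.smul_def, hb, mul_smul_comm, mul_smul_comm]
      _ = _ := by
          rw [hw, mul_add, ← mul_assoc, h2, one_mul, mul_smul_comm, ← mul_assoc, h2, one_mul]
  rw [hc, hb]
  module

/-- A polynomial all of whose values at scalars are scalars has scalar coefficients. -/
theorem coeff_mem_range_algebraMap {L B : Type*} [Field L] [Infinite L] [Ring B] [Algebra L B]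
    (P : B[X]) (hP : ∀ l : L, ∃ c : L, P.eval (algebraMap L B l) = algebraMap L B c) (j : ℕ) :
    ∃ c : L, P.coeff j = algebraMap L B c := by
  let N : Submodule L B := LinearMap.range (Algebra.linearMap L B)
  -- Every linear functional vanishing on scalars turns `P` into a polynomial over `L` with all
  -- values zero, hence the zero polynomial as `L` is infinite. Such functionals detect nonscalar
  -- elements.
  suffices H : N.mkQ (P.coeff j) = 0 by
    obtain ⟨c, hc⟩ := (Submodule.Quotient.mk_eq_zero N).1 H
    exact ⟨c, hc.symm⟩
  refine (Module.forall_dual_apply_eq_zero_iff L _).1 fun φ => ?_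
  let g : B →ₗ[L] L := φ ∘ₗ N.mkQ
  let p : L[X] := ∑ i ∈ Finset.range (P.natDegree + 1), monomial i (g (P.coeff i))
  have hp : p = 0 := by
    refine Polynomial.funext fun l => ?_
    obtain ⟨c, hc⟩ := hP l
    have h1 : g (P.eval (algebraMap L B l)) = 0 := by
      have : N.mkQ (algebraMap L B c) = 0 := (Submodule.Quotient.mk_eq_zero N).2 ⟨c, rfl⟩
      rw [hc, LinearMap.comp_apply, this, map_zero]
    rw [eval_zero, ← h1, eval_finsetSum, eval_eq_sum_range, map_sum]
    refine Finset.sum_congr rfl fun i _ => ?_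
    rw [eval_monomial, ← map_pow, ← Algebra.commutes, ← Algebra.smul_def, map_smul, smul_eq_mul,
      mul_comm]
  have h2 : p.coeff j = 0 := by rw [hp, coeff_zero]
  by_cases hj : j < P.natDegree + 1
  · rw [finsetSum_coeff, Finset.sum_eq_single j (fun i _ hij => by
      rw [coeff_monomial, if_neg hij]) (fun hj' => absurd (Finset.mem_range.2 hj) hj'),
      coeff_monomial, if_pos rfl] at h2
    exact h2
  · rw [coeff_eq_zero_of_natDegree_lt (by omega), map_zero, map_zero]

theorem exists_eq_prod_X_sub_C {L : Type*} [Field L] [IsAlgClosed L] {n : ℕ} {P : L[X]}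
    (hP : P.Monic) (hn : P.natDegree = n) : ∃ σ : Fin n → L, P = ∏ i, (X - C (σ i)) := by
  have h1 := IsAlgClosed.splits P
  have h2 := h1.eq_prod_roots_of_monic hP
  have h3 : P.roots.toList.length = n := by
    rw [Multiset.length_toList, ← h1.natDegree_eq_card_roots, hn]
  subst h3
  refine ⟨P.roots.toList.get, ?_⟩
  conv_lhs => rw [h2, ← Multiset.coe_toList P.roots, Multiset.map_coe, Multiset.prod_coe]
  rw [← List.prod_ofFn]
  congr 1
  conv_lhs => rw [← List.ofFn_get P.roots.toList, List.map_ofFn]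
  rfl

/-- The factorization of a binary form with scalar coefficients. -/
theorem exists_eq_prod_sub_mul {L : Type*} [Field L] [IsAlgClosed L] (n : ℕ) (G : ℕ → L)
    (hG : G 0 ≠ 0) : ∃ σ : Fin n → L,
      (∀ j, (∏ i, (X - C (σ i))).coeff j = if j ≤ n then (-1) ^ (n - j) * G (n - j) / G 0 else 0) ∧
      ∀ ξ η : L, ξ ≠ 0 → η ≠ 0 →
        ξ ^ n * ∑ j ∈ Finset.range (n + 1), (-η / ξ) ^ j * G j = G 0 * ∏ i, (ξ - σ i * η) := by
  -- This is `T^n G(-1/T)` divided by `G 0`, which makes it monic. Evaluation at `T = ξ / η` gives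
  -- the asserted product.
  let P : L[X] := ∑ m ∈ Finset.range (n + 1), monomial m ((-1) ^ (n - m) * G (n - m) / G 0)
  have hc : ∀ j, P.coeff j = if j ≤ n then (-1) ^ (n - j) * G (n - j) / G 0 else 0 := by
    intro j
    simp only [P, finsetSum_coeff, coeff_monomial, Finset.sum_ite_eq', Finset.mem_range,
      Nat.lt_succ_iff]
  have hdeg : P.natDegree ≤ n := natDegree_le_iff_coeff_eq_zero.2 fun j hj => by
    rw [hc, if_neg (by omega)]
  have hcn : P.coeff n = 1 := by
    rw [hc, if_pos le_rfl, Nat.sub_self, pow_zero, one_mul, div_self hG]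
  have hm : P.Monic := monic_of_natDegree_le_of_coeff_eq_one n hdeg hcn
  obtain ⟨σ, hσ⟩ := exists_eq_prod_X_sub_C hm (le_antisymm hdeg
    (le_natDegree_of_ne_zero (by rw [hcn]; exact one_ne_zero)))
  refine ⟨σ, fun j => by rw [← hσ, hc], fun ξ η hξ hη => ?_⟩
  have e1 : ∏ i, (ξ - σ i * η) = η ^ n * P.eval (ξ / η) := by
    have e0 : η ^ n = ∏ _i : Fin n, η := by rw [Finset.prod_const, Finset.card_fin]
    rw [hσ, eval_prod, e0, ← Finset.prod_mul_distrib]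
    refine Finset.prod_congr rfl fun i _ => ?_
    rw [eval_sub, eval_X, eval_C]
    field_simp
  rw [e1, eval_finsetSum, Finset.mul_sum, Finset.mul_sum, Finset.mul_sum,
    ← Finset.sum_range_reflect]
  refine Finset.sum_congr rfl fun j hj => ?_
  obtain ⟨e, rfl⟩ := Nat.exists_eq_add_of_le (Nat.lt_succ_iff.1 (Finset.mem_range.1 hj))
  have e2 : j + e + 1 - 1 - j = e := by omega
  have e3 : j + e - j = e := by omega
  rw [eval_monomial, e2, e3, pow_add, pow_add, div_pow, div_pow, neg_pow]
  field_simp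

end LinearAlgebra

namespace ShiftAlg

/-! ### Models with the parameters of one index varying. -/

section Line

variable {L : Type*} [Field L]

instance : IsScalarTower L L[X] (ShiftAlg L[X]) := IsScalarTower.of_algebraMap_eq fun _ => rfl

/-- The second coordinate of the combination of the two basic vectors with coefficients `a`,
`b`. -/
noncomputable def vecY (a b : L) : ShiftAlg L[X] := (C a + C b * X : L[X]) • mono 1 1

theorem vecY_add (a b a' b' : L) : vecY (a + a') (b + b') = vecY a b + vecY a' b' := by
  simp only [vecY, C_add]
  module

theorem vecY_mul (c a b : L) : vecY (c * a) (c * b) = (C c : L[X]) • vecY a b := by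
  simp only [vecY, C_mul]
  module

theorem mono_neg_one_mul : (mono (-1) 1 * mono 1 1 : ShiftAlg L[X]) = 1 := by
  rw [mono_mul_mono, taylor_one, C_1, mul_one, one_def]
  rfl

theorem mono_one_mul : (mono 1 1 * mono (-1) 1 : ShiftAlg L[X]) = 1 := by
  rw [mono_mul_mono, taylor_one, C_1, mul_one, one_def]
  rfl

variable [Algebra ℂ L] (h : ℂ)

instance : IsScalarTower ℂ L[X] (ShiftAlg L[X]) := IsScalarTower.of_algebraMap_eq fun _ => rfl

/-- The first coordinate of the combination of the two basic vectors with coefficients `a`, `b`. -/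
noncomputable def vecX (a b : L) : ShiftAlg L[X] :=
  (C a + C b * X : L[X]) • mono 1 (C (algebraMap ℂ L[X] h) * (X - 1)) + (C b : L[X]) • mono (-1) 1

theorem vecX_add (a b a' b' : L) : vecX h (a + a') (b + b') = vecX h a b + vecX h a' b' := by
  simp only [vecX, C_add]
  module

theorem vecX_mul (c a b : L) : vecX h (c * a) (c * b) = (C c : L[X]) • vecX h a b := by
  simp only [vecX, C_mul]
  module

variable {I : Type*} [LinearOrder I] (p s : I → L)

theorem model_x (i : I) : model h p s (x h i) = vecX h (p i) (s i) := by
  rw [model, realize_x, vecX, smul_mono, smul_mono, smul_eq_C_mul, smul_eq_C_mul, mul_one, C_mul]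
  congr 2
  ring

theorem model_y (i : I) : model h p s (y h i) = vecY (p i) (s i) := by
  rw [model, realize_y, vecY, smul_mono, smul_eq_C_mul, mul_one]

theorem mono_one_relation :
    (mono 1 (C (algebraMap ℂ L[X] h) * (X - 1)) * mono 1 1 : ShiftAlg L[X]) =
      mono 1 1 * mono 1 (C (algebraMap ℂ L[X] h) * (X - 1)) +
        algebraMap ℂ L[X] h • (mono 1 1 * mono 1 1) := by
  simp only [mono_mul_mono, smul_mono, taylor_mul, taylor_sub, taylor_C, taylor_X, taylor_one,
    C_1, mul_one, smul_eq_C_mul, ← map_add]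
  congr 1
  simp
  ring

/-- The bracket of the two basic vectors is a scalar, and each vector has bracket zero with itself.
By bilinearity only the determinant of the parameters remains. -/
theorem model_bracket (i j : I) : model h p s (bracket h i j) =
    algebraMap L _ (s i * p j - p i * s j) := by
  have e1 := mono_one_relation (L := L) h
  rw [bracket, map_sub, map_sub, map_mul, map_mul, map_smul, map_mul, model_x, model_x, model_y,
    model_y, ← algebraMap_smul L[X] h, vecX, vecX, vecY, vecY]
  simp only [add_mul, mul_add, smul_mul_assoc, mul_smul_comm, e1, mono_neg_one_mul, mono_one_mul]
  rw [IsScalarTower.algebraMap_apply L L[X],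
    Algebra.algebraMap_eq_smul_one (R := L[X]) (A := ShiftAlg L[X])]
  simp only [algebraMap_eq, C_sub, C_mul]
  module

variable (k : I)

/-- The model in which the parameters of the index `k` are changed. -/
noncomputable def modelAt (a b : L) : HAlg h I →ₐ[ℂ] ShiftAlg L[X] :=
  model h (Function.update p k a) (Function.update s k b)

theorem modelAt_x (a b : L) : modelAt h p s k a b (x h k) = vecX h a b := by
  simp [modelAt, model_x]

theorem modelAt_y (a b : L) : modelAt h p s k a b (y h k) = vecY a b := by
  simp [modelAt, model_y]

theorem modelAt_eq_self : modelAt h p s k (p k) (s k) = model h p s := by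
  rw [modelAt, Function.update_eq_self, Function.update_eq_self]

end Line

section Line

variable {L : Type*} [Field L] [Algebra ℂ L] (h : ℂ) {I : Type u} [LinearOrder I] (p s : I → L)
  {k : I}

theorem modelAt_of_mem (a b : L) {c : HAlg h I} (hc : c ∈ subH h {k}ᶜ) :
    modelAt h p s k a b c = model h p s c := by
  refine algHom_eq_of_mem_subH h (fun i hi => ?_) (fun i hi => ?_) hc
  · rw [modelAt, model_x, model_x, Function.update_of_ne hi, Function.update_of_ne hi]
  · rw [modelAt, model_y, model_y, Function.update_of_ne hi, Function.update_of_ne hi]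

theorem modelAt_substIdx (l : I) (c : HAlg h I) :
    model h p s (substIdx h k l c) = modelAt h p s k (p l) (s l) c := by
  suffices H : (model h p s).comp (substIdx h k l) = modelAt h p s k (p l) (s l) from
    DFunLike.congr_fun H c
  have key : ∀ (q : I → L) (i : I), q (Function.update id k l i) = Function.update q k (q l) i := by
    intro q i
    by_cases hi : i = k
    · subst hi; simp
    · simp [Function.update_of_ne hi]
  ext c
  induction c using induction_on with
  | hc c => rw [AlgHom.commutes, AlgHom.commutes]
  | hx i => rw [AlgHom.comp_apply, substIdx, relabel_x, modelAt, model_x, model_x, key p,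
    key s]
  | hy i => rw [AlgHom.comp_apply, substIdx, relabel_y, modelAt, model_y, model_y, key p,
    key s]
  | hadd a b ha hb => rw [map_add, ha, hb, map_add]
  | hmul a b ha hb => rw [map_mul, ha, hb, map_mul]

theorem modelAt_mul (c a b : L) {n : ℕ} {f : HAlg h I} (hf : f ∈ degPart h k n) :
    modelAt h p s k (c * a) (c * b) f = (C c : L[X]) ^ n • modelAt h p s k a b f := by
  refine degPart_induction h (P := fun n f => modelAt h p s k (c * a) (c * b) f =
    (C c : L[X]) ^ n • modelAt h p s k a b f) (fun f hf => ?_) (fun d f _ hd => ?_)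
    (fun d f _ hd => ?_) (fun d f g hf hg => ?_) hf
  · rw [modelAt_of_mem h p s _ _ hf, modelAt_of_mem h p s _ _ hf, pow_zero, one_smul]
  · rw [map_mul, map_mul, hd, modelAt_x, modelAt_x, vecX_mul, smul_mul_smul_comm, pow_succ']
  · rw [map_mul, map_mul, hd, modelAt_y, modelAt_y, vecY_mul, smul_mul_smul_comm, pow_succ']
  · rw [map_add, map_add, hf, hg, smul_add]

/-- Along a line, the value of the model at a homogeneous element is a polynomial. -/
theorem exists_modelAt_eq_eval {a b a' b' : L}
    (hX : vecX h a b ∈ (subH h {k}ᶜ).map (model h p s))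
    (hY : vecY a b ∈ (subH h {k}ᶜ).map (model h p s))
    (hX' : vecX h a' b' ∈ (subH h {k}ᶜ).map (model h p s))
    (hY' : vecY a' b' ∈ (subH h {k}ᶜ).map (model h p s))
    {n : ℕ} {f : HAlg h I} (hf : f ∈ degPart h k n) :
    ∃ P : (ShiftAlg L[X])[X], P.natDegree ≤ n ∧
      (∀ j, P.coeff j ∈ (subH h {k}ᶜ).map (model h p s)) ∧
      ∀ l : L, modelAt h p s k (a + l * a') (b + l * b') f = P.eval (algebraMap L _ l) := by
  have step : ∀ (n : ℕ) (f : HAlg h I) (g : HAlg h I) (v v' : ShiftAlg L[X]),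
      v ∈ (subH h {k}ᶜ).map (model h p s) → v' ∈ (subH h {k}ᶜ).map (model h p s) →
      (∀ l : L, modelAt h p s k (a + l * a') (b + l * b') g = v + v' * algebraMap L _ l) →
      (∃ P : (ShiftAlg L[X])[X], P.natDegree ≤ n ∧
        (∀ j, P.coeff j ∈ (subH h {k}ᶜ).map (model h p s)) ∧
        ∀ l : L, modelAt h p s k (a + l * a') (b + l * b') f = P.eval (algebraMap L _ l)) →
      ∃ P : (ShiftAlg L[X])[X], P.natDegree ≤ n + 1 ∧
        (∀ j, P.coeff j ∈ (subH h {k}ᶜ).map (model h p s)) ∧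
        ∀ l : L, modelAt h p s k (a + l * a') (b + l * b') (g * f) =
          P.eval (algebraMap L _ l) := by
    rintro n f g v v' hv hv' hg ⟨P, hdeg, hP, hPf⟩
    refine ⟨C v * P + C v' * P * X, ?_, fun j => ?_, fun l => ?_⟩
    · refine natDegree_add_le_of_degree_le ((natDegree_C_mul_le _ _).trans (by omega)) ?_
      exact natDegree_mul_le_of_le ((natDegree_C_mul_le _ _).trans hdeg) natDegree_X_le
    · rw [coeff_add, coeff_C_mul]
      refine add_mem (mul_mem hv (hP j)) ?_
      cases j with
      | zero => rw [coeff_mul_X_zero]; exact zero_mem _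
      | succ j => rw [coeff_mul_X, coeff_C_mul]; exact mul_mem hv' (hP j)
    · rw [map_mul, hg, hPf, eval_add, eval_mul_X, eval_C_mul, eval_C_mul, add_mul, mul_assoc,
        mul_assoc, Algebra.commutes]
  refine degPart_induction h (P := fun n f => ∃ P : (ShiftAlg L[X])[X], P.natDegree ≤ n ∧
      (∀ j, P.coeff j ∈ (subH h {k}ᶜ).map (model h p s)) ∧
      ∀ l : L, modelAt h p s k (a + l * a') (b + l * b') f = P.eval (algebraMap L _ l))
    (fun f hf => ?_) (fun d f _ hd => step d f _ _ _ hX hX' (fun l => ?_) hd)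
    (fun d f _ hd => step d f _ _ _ hY hY' (fun l => ?_) hd) (fun d f g hf hg => ?_) hf
  · refine ⟨C (model h p s f), (natDegree_C _).le, fun j => ?_, fun l => ?_⟩
    · rw [coeff_C]
      split_ifs
      · exact ⟨f, hf, rfl⟩
      · exact zero_mem _
    · rw [modelAt_of_mem h p s _ _ hf, eval_C]
  · rw [modelAt_x, vecX_add, vecX_mul, ← Algebra.commutes, IsScalarTower.algebraMap_apply L L[X],
      ← Algebra.smul_def, algebraMap_eq]
  · rw [modelAt_y, vecY_add, vecY_mul, ← Algebra.commutes, IsScalarTower.algebraMap_apply L L[X],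
      ← Algebra.smul_def, algebraMap_eq]
  · obtain ⟨P, hP1, hP2, hP3⟩ := hf
    obtain ⟨Q, hQ1, hQ2, hQ3⟩ := hg
    refine ⟨P + Q, natDegree_add_le_of_degree_le hP1 hQ1, fun j => ?_, fun l => ?_⟩
    · rw [coeff_add]; exact add_mem (hP2 j) (hQ2 j)
    · rw [map_add, hP3, hQ3, eval_add]

end Line

/-! ### The factorization over the field of scalars. -/

section Factorization

variable {L : Type*} [Field L] [Algebra ℂ L] {h : ℂ} {I : Type u} [LinearOrder I] {p s : I → L}
  {k l : I} {n : ℕ} {f : HAlg h I}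

theorem det_ne_zero (hkl : k ≠ l) (hps : AlgebraicIndependent ℂ (Sum.elim p s)) :
    s k * p l - p k * s l ≠ 0 := by
  intro h0
  let D : MvPolynomial (I ⊕ I) ℂ := MvPolynomial.X (Sum.inr k) * MvPolynomial.X (Sum.inl l) -
    MvPolynomial.X (Sum.inl k) * MvPolynomial.X (Sum.inr l)
  have h1 : D = 0 := (injective_iff_map_eq_zero _).1 hps D (by simpa [D] using h0)
  -- At the point with `p_l = s_k = 1` and all other coordinates zero, the determinant has the value
  -- `1`.
  have h2 := congrArg (MvPolynomial.eval (Sum.elim (Pi.single l 1) (Pi.single k 1))) h1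
  simp [D, Pi.single_eq_of_ne hkl] at h2

/-- As the parameters of `k` vary, `f` defines a binary form over `L`. Restriction to the line
through the point of `l` on which the next to last polar is constant gives a polynomial in one
variable, and its roots determine the `σ i`. The last clause multiplies by `c` because only the
products with `c`, and not the coefficients of `∏ (X - σ i)` themselves, are shown to come from the
subalgebra without index `k`. -/
theorem exists_factorization [IsAlgClosed L] (hh : h ≠ 0) (hkl : k ≠ l)
    (hps : AlgebraicIndependent ℂ (Sum.elim p s)) (hf : IsForm h k {k, l}ᶜ n f) :
    ∃ (φ c ξ η : L) (σ : Fin n → L),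
      model h p s f = algebraMap L _ φ ∧
      model h p s (polar h k l n n f) = algebraMap L _ c ∧ c ≠ 0 ∧
      model h p s (polar h k l n (n - 1) f) = algebraMap L _ ξ ∧
      model h p s (bracket h k l) = algebraMap L _ η ∧
      φ = c ^ (1 - (n : ℤ)) * ∏ i, (ξ - σ i * η) ∧
      ∀ j, ∃ a ∈ subH h {k}ᶜ,
        model h p s a = algebraMap L _ ((∏ i, (X - C (σ i))).coeff j * c) := by
  have hinj := model_injective h p s hps
  have hBinj : Function.Injective (algebraMap L (ShiftAlg L[X])) := (algebraMap L _).injective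
  obtain ⟨φ, hφ⟩ := exists_model_eq_algebraMap hh p s hf.invariant
  obtain ⟨c, hc⟩ := exists_model_eq_algebraMap hh p s (hf.invariant.polar k l n n)
  obtain ⟨ξ, hξ⟩ := exists_model_eq_algebraMap hh p s (hf.invariant.polar k l n (n - 1))
  have hη := model_bracket h p s k l
  set η := s k * p l - p k * s l with hη_def
  have hη0 : η ≠ 0 := det_ne_zero hkl hps
  have hc0 : c ≠ 0 := by
    rintro rfl
    rw [map_zero, hf.polar_eq_substIdx hkl] at hc
    exact hf.substIdx_ne_zero hkl ((injective_iff_map_eq_zero _).1 hinj _ hc)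
  refine ⟨φ, c, ξ, η, ?_⟩
  rcases Nat.eq_zero_or_pos n with rfl | hn
  · have hφc : φ = c := hBinj (by rw [← hφ, ← hc]; rfl)
    refine ⟨Fin.elim0, hφ, hc, hc0, hξ, hη, by simp [hφc], fun j => ?_⟩
    simp only [Finset.univ_eq_empty, Finset.prod_empty, coeff_one]
    split_ifs
    · exact ⟨_, hf.polar_mem hkl, by rw [hc, one_mul]⟩
    · exact ⟨0, zero_mem _, by rw [zero_mul, map_zero, map_zero]⟩
  obtain ⟨b, hb, d, hd, hbd, hbd'⟩ := hf.exists_polar_pred hkl hn.ne'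
  have hat : ∀ a a', modelAt h p s k a a' (polar h k l n (n - 1) f) =
      vecX h a a' * model h p s b + vecY a a' * model h p s d := by
    intro a a'
    rw [hbd, map_add, map_mul, map_mul, modelAt_x, modelAt_y, modelAt_of_mem h p s _ _ hb,
      modelAt_of_mem h p s _ _ hd]
  -- Representing invariants by scalars requires no algebraic independence, so the parameters of `k`
  -- may be set to `(1, 0)` and `(0, 1)`.
  obtain ⟨W, hW⟩ : ∃ W : L, vecX h 1 0 * model h p s b + vecY 1 0 * model h p s d =
      algebraMap L _ W := by
    rw [← hat]
    exact exists_model_eq_algebraMap hh _ _ (hf.invariant.polar k l n (n - 1))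
  obtain ⟨V, hV⟩ : ∃ V : L, vecX h 0 1 * model h p s b + vecY 0 1 * model h p s d =
      algebraMap L _ V := by
    rw [← hat]
    exact exists_model_eq_algebraMap hh _ _ (hf.invariant.polar k l n (n - 1))
  have hlin : ∀ a a', vecX h a a' * model h p s b + vecY a a' * model h p s d =
      algebraMap L _ (a * W + a' * V) := by
    intro a a'
    have e1 : vecX h a a' = (C a : L[X]) • vecX h 1 0 + (C a' : L[X]) • vecX h 0 1 := by
      rw [← vecX_mul, ← vecX_mul, ← vecX_add]; simp
    have e2 : vecY a a' = (C a : L[X]) • vecY 1 0 + (C a' : L[X]) • vecY 0 1 := by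
      rw [← vecY_mul, ← vecY_mul, ← vecY_add]; simp
    rw [map_add, map_mul, map_mul, ← hW, ← hV, e1, e2, ← Algebra.smul_def, ← Algebra.smul_def,
      ← algebraMap_smul L[X] a, ← algebraMap_smul L[X] a', algebraMap_eq]
    simp only [add_mul, smul_mul_assoc]
    module
  have hξ' : ξ = p k * W + s k * V := hBinj (by
    rw [← hξ, ← hlin, ← hat, modelAt_eq_self])
  have hc' : c = p l * W + s l * V := hBinj (by
    rw [← hc, ← hlin, hbd', map_add, map_mul, map_mul, model_x, model_y])
  -- The last polar is a polarization of the next to last one, so the vanishing of `ξ` would force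
  -- `c = 0`.
  have hξ0 : ξ ≠ 0 := by
    intro h0
    rw [h0, map_zero] at hξ
    have h1 := polar_succ h k l n (n - 1) f
    rw [(injective_iff_map_eq_zero _).1 hinj _ hξ, map_zero, smul_zero,
      Nat.sub_add_cancel hn] at h1
    rw [h1, map_zero] at hc
    exact hc0 (hBinj (by rw [← hc, map_zero]))
  have hsolve := solve_linear_system (mono_one_mul (L := L)) mono_neg_one_mul
    (mono_one_relation h) (b := model h p s b) (c := model h p s d) (q := X) (W := C W) (V := C V)
    (by
      have := hW
      rw [vecX, vecY, C_1, C_0, zero_mul, add_zero, one_smul, zero_smul, add_zero, one_smul,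
        IsScalarTower.algebraMap_apply L L[X], algebraMap_eq] at this
      exact this)
    (by
      have := hV
      rw [vecX, vecY, C_1, C_0, one_mul, zero_add, one_smul,
        IsScalarTower.algebraMap_apply L L[X], algebraMap_eq] at this
      exact this)
  -- The solved system shows that the direction `(V, -W)` is the vector with coordinates `-d - h b`
  -- and `b`. Both lie in the subalgebra without index `k`, and so do the coefficients of the
  -- polynomial along the line.
  have hvX : vecX h V (-W) = model h p s (-d - h • b) := by
    rw [map_sub, map_neg, map_smul, ← algebraMap_smul L[X] h, hsolve.2, vecX, C_neg]
    module
  have hvY : vecY V (-W) = model h p s b := by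
    rw [hsolve.1, vecY, C_neg]
    module
  have hl : l ∈ ({k}ᶜ : Set I) := hkl.symm
  have hmem : -d - h • b ∈ subH h {k}ᶜ := sub_mem (neg_mem hd) (Subalgebra.smul_mem _ hb h)
  obtain ⟨P, hPdeg, hPmem, hP⟩ := exists_modelAt_eq_eval h p s (k := k) (a := p l) (b := s l)
    (a' := V) (b' := -W) ⟨_, x_mem_subH h hl, model_x h p s l⟩ ⟨_, y_mem_subH h hl, model_y h p s l⟩
    ⟨_, hmem, hvX.symm⟩ ⟨_, hb, hvY.symm⟩
    hf.mem_degPart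
  have hG : ∀ j, ∃ g : L, P.coeff j = algebraMap L _ g := coeff_mem_range_algebraMap P fun t => by
    rw [← hP]
    exact exists_model_eq_algebraMap hh _ _ hf.invariant
  choose G hG using hG
  have hPG : ∀ t : L, modelAt h p s k (p l + t * V) (s l + t * -W) f =
      algebraMap L _ (∑ j ∈ Finset.range (n + 1), t ^ j * G j) := by
    intro t
    rw [hP, eval_eq_sum_range' (Nat.lt_succ_iff.2 hPdeg), map_sum]
    refine Finset.sum_congr rfl fun j _ => ?_
    rw [hG, ← map_pow, ← map_mul, mul_comm]
  -- At `t = 0` the point of the line is that of `l`, and `f` takes the value of its last polar.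
  have hG0 : G 0 = c := hBinj (by
    have := hPG 0
    rw [zero_mul, zero_mul, add_zero, add_zero, ← modelAt_substIdx, ← hf.polar_eq_substIdx hkl,
      hc, Finset.sum_eq_single 0 (fun j _ hj => by rw [zero_pow hj, zero_mul])
      (fun h0 => absurd (Finset.mem_range.2 n.succ_pos) h0), pow_zero, one_mul] at this
    exact this.symm)
  obtain ⟨σ, hσ, hprod⟩ := exists_eq_prod_sub_mul n G (by rwa [hG0])
  refine ⟨σ, hφ, hc, hc0, hξ, hη, ?_, fun j => ?_⟩
  -- The linear form has the value `c` on the whole line, so the multiple of the point of `k` on the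
  -- line is found by scaling with `c / ξ`. Comparing coordinates gives the parameter `t = -η / ξ`.
  · have e1 : p k = ξ / c * (p l + -η / ξ * V) := by
      field_simp
      rw [hξ', hc', hη_def]
      ring
    have e2 : s k = ξ / c * (s l + -η / ξ * -W) := by
      field_simp
      rw [hξ', hc', hη_def]
      ring
    have e3 : φ = (ξ / c) ^ n * ∑ j ∈ Finset.range (n + 1), (-η / ξ) ^ j * G j := hBinj (by
      have := modelAt_mul h p s (ξ / c) (p l + -η / ξ * V) (s l + -η / ξ * -W) hf.mem_degPart
      rw [← e1, ← e2, modelAt_eq_self, hPG, hφ] at this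
      rw [this, Algebra.smul_def, map_mul (algebraMap L _), ← C_pow, ← algebraMap_eq,
        ← IsScalarTower.algebraMap_apply])
    have e4 := hprod ξ η hξ0 hη0
    rw [hG0] at e4
    rw [e3, div_pow, div_mul_eq_mul_div, e4, zpow_sub₀ hc0, zpow_one, zpow_natCast]
    ring
  · rw [hσ, hG0]
    split_ifs with hj
    · obtain ⟨a, ha, haG⟩ := hPmem (n - j)
      refine ⟨(-1) ^ (n - j) * a, mul_mem (pow_mem (neg_mem (one_mem _)) _) ha, ?_⟩
      rw [div_mul_cancel₀ _ hc0, map_mul, map_pow, map_neg, map_one]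
      change _ * model h p s a = _
      have haG' : model h p s a = P.coeff (n - j) := haG
      rw [haG', hG, map_mul, map_pow, map_neg, map_one]
    · exact ⟨0, zero_mem _, by rw [zero_mul, map_zero, map_zero]⟩

end Factorization

end ShiftAlg

/-! ### Skew subfields -/

section Subfields

variable {D : Type u} [DivisionRing D] [Algebra ℂ D]

theorem exists_divisionRing_of_subfield (S : Subfield D) (hS : ∀ c : ℂ, algebraMap ℂ D c ∈ S) :
    ∃ (K : Type u) (_ : DivisionRing K) (_ : Algebra ℂ K) (e : K →ₐ[ℂ] D), ∀ d, d ∈ e.range ↔ d ∈ S :=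
  let alg : Algebra ℂ S := RingHom.toAlgebra' ((algebraMap ℂ D).codRestrict S.toSubring hS)
    fun c x => Subtype.ext (Algebra.commutes c (x : D))
  ⟨S, inferInstance, alg, { S.subtype with commutes' := fun _ => rfl }, fun d =>
    ⟨fun ⟨k, hk⟩ => hk ▸ k.2, fun hd => ⟨⟨d, hd⟩, rfl⟩⟩⟩

/-- A homomorphism with values in the range of an injective homomorphism factors through it. -/
theorem exists_algHom_comp_eq {A K : Type*} [Ring A] [Algebra ℂ A] [DivisionRing K] [Algebra ℂ K]
    (e : K →ₐ[ℂ] D) (ψ : A →ₐ[ℂ] D) (hψ : ∀ a, ψ a ∈ e.range) :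
    ∃ ψ' : A →ₐ[ℂ] K, ∀ a, e (ψ' a) = ψ a := by
  let E := AlgEquiv.ofInjective e (RingHom.injective e.toRingHom)
  refine ⟨E.symm.toAlgHom.comp (ψ.codRestrict e.range hψ), fun a => ?_⟩
  have := congrArg Subtype.val (E.apply_symm_apply (ψ.codRestrict e.range hψ a))
  exact this

theorem exists_linearMap_comp_eq {K : Type*} [DivisionRing K] [Algebra ℂ K]
    (e : K →ₐ[ℂ] D) (ψ : D →ₗ[ℂ] D) (hψ : ∀ a ∈ e.range, ψ a ∈ e.range) :
    ∃ ψ' : K →ₗ[ℂ] K, ∀ a, e (ψ' a) = ψ (e a) := by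
  let E := AlgEquiv.ofInjective e (RingHom.injective e.toRingHom)
  refine ⟨E.symm.toLinearMap ∘ₗ (ψ ∘ₗ e.toLinearMap).codRestrict (Subalgebra.toSubmodule e.range)
    fun a => hψ _ ⟨a, rfl⟩, fun a => ?_⟩
  have := congrArg Subtype.val (E.apply_symm_apply ⟨ψ (e a), hψ _ ⟨a, rfl⟩⟩)
  exact this

/-- The right fractions form a skew subfield if common right multiples exist. -/
theorem exists_subfield_fractions {A : Type*} [Ring A] [Algebra ℂ A] (φ : A →ₐ[ℂ] D)
    (hφ : Function.Injective φ)
    (hA : ∀ a b : A, a ≠ 0 → b ≠ 0 → ∃ v w, a * v = b * w ∧ a * v ≠ 0) :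
    ∃ S : Subfield D, ∀ d, d ∈ S ↔ ∃ a b, b ≠ 0 ∧ d = φ a * (φ b)⁻¹ := by
  have h0 : ∀ a, a ≠ 0 → φ a ≠ 0 := fun a ha h => ha ((injective_iff_map_eq_zero _).1 hφ a h)
  have hone : (1 : A) ≠ 0 := by
    intro h
    have := congrArg φ h
    rw [map_one, map_zero] at this
    exact one_ne_zero this
  have hmul0 : ∀ a b : A, a * b ≠ 0 → a ≠ 0 ∧ b ≠ 0 := fun a b h =>
    ⟨left_ne_zero_of_mul h, right_ne_zero_of_mul h⟩
  have hmul : ∀ a b : A, a ≠ 0 → b ≠ 0 → a * b ≠ 0 := fun a b ha hb h => by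
    have := congrArg φ h
    rw [map_mul, map_zero] at this
    exact mul_ne_zero (h0 a ha) (h0 b hb) this
  refine ⟨{ carrier := {d | ∃ a b, b ≠ 0 ∧ d = φ a * (φ b)⁻¹}
            mul_mem' := ?_, one_mem' := ?_, add_mem' := ?_, zero_mem' := ?_, neg_mem' := ?_,
            inv_mem' := ?_ }, fun d => Iff.rfl⟩
  · rintro _ _ ⟨a, b, hb, rfl⟩ ⟨c, d, hd, rfl⟩
    by_cases hc : c = 0
    · exact ⟨0, 1, hone, by rw [hc]; simp⟩
    · obtain ⟨v, w, hvw, hbv⟩ := hA b c hb hc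
      have hw := (hmul0 _ _ (hvw ▸ hbv)).2
      refine ⟨a * v, d * w, hmul d w hd hw, ?_⟩
      have e : φ b * φ v = φ c * φ w := by rw [← map_mul, hvw, map_mul]
      -- The common right multiple rewrites a left fraction as a right fraction, which makes the
      -- product again a right fraction.
      have e' : (φ b)⁻¹ * φ c = φ v * (φ w)⁻¹ := by
        rw [inv_mul_eq_iff_eq_mul₀ (h0 b hb), ← mul_assoc, e, mul_assoc, mul_inv_cancel₀ (h0 w hw),
          mul_one]
      rw [map_mul, map_mul, mul_inv_rev, mul_assoc, ← mul_assoc (φ b)⁻¹, e']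
      simp only [mul_assoc]
  · exact ⟨1, 1, hone, by simp⟩
  · rintro _ _ ⟨a, b, hb, rfl⟩ ⟨c, d, hd, rfl⟩
    obtain ⟨v, w, hvw, hbv⟩ := hA b d hb hd
    refine ⟨a * v + c * w, b * v, hbv, ?_⟩
    have hv := (hmul0 _ _ hbv).2
    have hw := (hmul0 _ _ (hvw ▸ hbv)).2
    rw [map_add, add_mul]
    congr 1
    · rw [map_mul, map_mul, mul_inv_rev, mul_assoc, ← mul_assoc (φ v), mul_inv_cancel₀ (h0 v hv),
        one_mul]
    · rw [hvw, map_mul, map_mul, mul_inv_rev, mul_assoc, ← mul_assoc (φ w),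
        mul_inv_cancel₀ (h0 w hw), one_mul]
  · exact ⟨0, 1, hone, by simp⟩
  · rintro _ ⟨a, b, hb, rfl⟩
    exact ⟨-a, b, hb, by simp⟩
  · rintro _ ⟨a, b, hb, rfl⟩
    by_cases ha : a = 0
    · exact ⟨0, 1, hone, by rw [ha]; simp⟩
    · exact ⟨b, a, ha, by rw [mul_inv_rev, inv_inv]⟩

/-- Adjoining central algebraic elements to a skew subfield gives a skew subfield. -/
theorem exists_subfield_adjoin {D L : Type*} [DivisionRing D] [Field L] (S : Subfield D)
    (Λ : L →+* D) (hΛ : ∀ l z, Λ l * z = z * Λ l) {n : ℕ} (σ : Fin n → L)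
    (hσ : ∀ j, Λ ((∏ i, (X - C (σ i))).coeff j) ∈ S) :
    ∃ T : Subfield D, T.toSubring = Subring.closure ((S : Set D) ∪ Set.range fun i => Λ (σ i)) := by
  let Z : Subfield L := S.comap Λ
  let A : Subalgebra Z L := Algebra.adjoin Z (Set.range σ)
  -- Each `σ i` is a root of `∏ (X - σ i)`, a monic polynomial whose coefficients lie in the
  -- subfield `Z` by `hσ`.
  have hfg : (Subalgebra.toSubmodule A).FG := by
    refine fg_adjoin_of_finite (Set.finite_range σ) ?_
    rintro _ ⟨i, rfl⟩
    have hlift : (∏ i, (X - C (σ i))) ∈ lifts (algebraMap Z L) :=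
      (lifts_iff_coeff_lifts _).2 fun j => ⟨⟨_, hσ j⟩, rfl⟩
    obtain ⟨q, hq, -, hm⟩ := lifts_and_natDegree_eq_and_monic hlift
      (monic_prod_of_monic _ _ fun i _ => monic_X_sub_C _)
    refine ⟨q, hm, ?_⟩
    rw [← eval_map, hq, eval_prod, Finset.prod_eq_zero (Finset.mem_univ i)]
    rw [eval_sub, eval_X, eval_C, sub_self]
  -- This span is finite dimensional over `S` and turns out to equal the ring `T`. Centrality of the
  -- `Λ l` makes it closed under multiplication.
  let N : Submodule S D := Submodule.span S (Λ '' A)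
  let T : Subring D := Subring.closure ((S : Set D) ∪ Set.range fun i => Λ (σ i))
  have hΛN : ∀ a ∈ A, Λ a ∈ N := fun a ha => Submodule.subset_span ⟨a, ha, rfl⟩
  have hNfin : FiniteDimensional S N := by
    obtain ⟨t, ht⟩ := hfg
    have e : N = Submodule.span S (Λ '' t) := by
      refine le_antisymm (Submodule.span_le.2 ?_) (Submodule.span_mono (Set.image_mono fun a ha => ?_))
      · rintro _ ⟨a, ha, rfl⟩
        have ha' : a ∈ Submodule.span Z (t : Set L) := by rw [ht]; exact ha
        induction ha' using Submodule.span_induction with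
        | zero => rw [map_zero]; exact zero_mem _
        | mem a hat => exact Submodule.subset_span ⟨a, hat, rfl⟩
        | add a b ha' hb' iha ihb =>
          rw [map_add]
          rw [ht] at ha' hb'
          exact add_mem (iha ha') (ihb hb')
        | smul c a ha' iha =>
          rw [ht] at ha'
          have : Λ (c • a) = (⟨Λ c, c.2⟩ : S) • Λ a := map_mul Λ (c : L) a
          rw [this]
          exact Submodule.smul_mem _ _ (iha ha')
      · have : a ∈ Subalgebra.toSubmodule A := by rw [← ht]; exact Submodule.subset_span ha
        exact this
    rw [e]
    exact FiniteDimensional.span_of_finite S (t.finite_toSet.image _)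
  have hone : (1 : D) ∈ N := by rw [← map_one Λ]; exact hΛN 1 (one_mem _)
  have hNmul : ∀ a ∈ N, ∀ b ∈ N, a * b ∈ N := by
    intro a ha b hb
    induction ha using Submodule.span_induction with
    | zero => rw [zero_mul]; exact zero_mem _
    | add a a' _ _ iha iha' => rw [add_mul]; exact add_mem iha iha'
    | smul c a _ iha =>
      rw [Subfield.smul_def, smul_eq_mul, mul_assoc]
      exact Submodule.smul_mem _ c iha
    | mem a ha =>
      obtain ⟨a, ha, rfl⟩ := ha
      induction hb using Submodule.span_induction with
      | zero => rw [mul_zero]; exact zero_mem _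
      | add b b' _ _ ihb ihb' => rw [mul_add]; exact add_mem ihb ihb'
      | smul c b _ ihb =>
        rw [Subfield.smul_def, smul_eq_mul, ← mul_assoc, hΛ, mul_assoc]
        exact Submodule.smul_mem _ c ihb
      | mem b hb =>
        obtain ⟨b, hb, rfl⟩ := hb
        rw [← map_mul]
        exact hΛN _ (mul_mem ha hb)
  have hTN : ∀ a ∈ T, a ∈ N := by
    intro a ha
    induction ha using Subring.closure_induction with
    | zero => exact zero_mem _
    | one => exact hone
    | add a b _ _ ha hb => exact add_mem ha hb
    | neg a _ ha => exact neg_mem ha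
    | mul a b _ _ ha hb => exact hNmul a ha b hb
    | mem a ha =>
      rcases ha with ha | ⟨i, rfl⟩
      · have := Submodule.smul_mem N (⟨a, ha⟩ : S) hone
        rwa [Subfield.smul_def, smul_eq_mul, mul_one] at this
      · exact hΛN _ (Algebra.subset_adjoin ⟨i, rfl⟩)
  have hNT : ∀ a ∈ N, a ∈ T := by
    intro a ha
    induction ha using Submodule.span_induction with
    | zero => exact zero_mem _
    | add a a' _ _ iha iha' => exact add_mem iha iha'
    | smul c a _ iha => exact mul_mem (Subring.subset_closure (Or.inl c.2)) iha
    | mem a ha =>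
      obtain ⟨a, ha, rfl⟩ := ha
      induction ha using Algebra.adjoin_induction with
      | mem a ha =>
        obtain ⟨i, rfl⟩ := ha
        exact Subring.subset_closure (Or.inr ⟨i, rfl⟩)
      | algebraMap c => exact Subring.subset_closure (Or.inl c.2)
      | add a b _ _ ha hb => rw [map_add]; exact add_mem ha hb
      | mul a b _ _ ha hb => rw [map_mul]; exact mul_mem ha hb
  refine ⟨{ T with inv_mem' := fun t ht => ?_ }, rfl⟩
  by_cases ht0 : t = 0
  · rw [ht0, inv_zero]; exact zero_mem T
  -- Right multiplication by `t` commutes with the left action of `S` and is injective. By finite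
  -- dimension it is surjective, and a preimage of `1` is the inverse of `t`.
  let g : N →ₗ[S] N :=
    { toFun := fun a => ⟨a * t, hNmul a a.2 t (hTN t ht)⟩
      map_add' := fun a b => Subtype.ext (add_mul _ _ _)
      map_smul' := fun c a => Subtype.ext (smul_mul_assoc c (a : D) t) }
  have hg : Function.Injective g := fun a b hab => by
    have := congrArg Subtype.val hab
    exact Subtype.ext (mul_right_cancel₀ ht0 this)
  obtain ⟨a, ha⟩ := LinearMap.injective_iff_surjective.1 hg ⟨1, hone⟩
  have ha' : (a : D) * t = 1 := congrArg Subtype.val ha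
  rw [← eq_inv_of_mul_eq_one_left ha']
  exact hNT a a.2

end Subfields

/-! ### The action on skew fields -/

section Conjugation

/-- Conjugation by a unit. -/
def conjAlgEquiv {D : Type*} [Ring D] [Algebra ℂ D] (u : Dˣ) : D ≃ₐ[ℂ] D where
  toFun b := ↑u⁻¹ * b * ↑u
  invFun b := ↑u * b * ↑u⁻¹
  left_inv b := by simp [mul_assoc]
  right_inv b := by simp [mul_assoc]
  map_mul' a b := by simp [mul_assoc]
  map_add' a b := by rw [mul_add, add_mul]
  commutes' c := by rw [← Algebra.commutes, mul_assoc, Units.inv_mul, mul_one]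

theorem map_twistedDer {A B : Type*} [Ring A] [Algebra ℂ A] [Ring B] [Algebra ℂ B]
    (ι : A →ₐ[ℂ] B) (v : Aˣ) (w : A) (δ : A →ₗ[ℂ] A) (δ' : B →ₗ[ℂ] B)
    (hδ : ∀ a, δ' (ι a) = ι (δ a)) (a : A) :
    twistedDer (Units.map (ι : A →* B) v) (ι w) δ' (ι a) = ι (twistedDer v w δ a) := by
  rw [twistedDer_apply, twistedDer_apply, hδ, map_mul, map_mul, map_add, map_sub, map_mul, map_mul]
  rfl

theorem twistedDer_central {A : Type*} [Ring A] [Algebra ℂ A] (v : Aˣ) (w : A) (δ : A →ₗ[ℂ] A)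
    {a : A} (ha : a * w = w * a) (hδ : δ a = 0) : twistedDer v w δ a = 0 := by
  rw [twistedDer_apply, ha, hδ, sub_self, add_zero, mul_zero, zero_mul]

end Conjugation

/-! ### Restriction of the action to stable skew subfields. -/

section Stability

variable {h : ℂ} {I : Type u} [LinearOrder I] {D : Type*} [DivisionRing D] [Algebra ℂ D]
  {φ : HAlg h I →ₐ[ℂ] D}

theorem ExtendedAction.τ_symm_apply (act : ExtendedAction φ) (a : HAlg h I) :
    act.τ.symm (φ a) = φ (shift h (-h) a) := by
  rw [AlgEquiv.symm_apply_eq, act.τ_apply, ShiftAlg.shift_shift, add_neg_cancel, shift_zero]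

/-- A skew derivation is determined on quotients. -/
theorem skewDerivation_mul_inv {T : D →ₗ[ℂ] D} {α β : D ≃ₐ[ℂ] D}
    (hT : ∀ a b, T (a * b) = T a * β b + α a * T b) (u : D) {v : D} (hv : v ≠ 0) :
    T (u * v⁻¹) = (T u - α (u * v⁻¹) * T v) * (β v)⁻¹ := by
  have hβ : β v ≠ 0 := (map_ne_zero_iff β β.injective).2 hv
  rw [eq_mul_inv_iff_mul_eq₀ hβ, eq_sub_iff_add_eq, ← hT, mul_assoc, inv_mul_cancel₀ hv, mul_one]

theorem skewDerivation_mem_closure {T : D →ₗ[ℂ] D} {α β : D ≃ₐ[ℂ] D}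
    (hT : ∀ a b, T (a * b) = T a * β b + α a * T b) {s : Set D}
    (hα : ∀ a ∈ s, α a ∈ Subring.closure s) (hβ : ∀ a ∈ s, β a ∈ Subring.closure s)
    (hTs : ∀ a ∈ s, T a ∈ Subring.closure s) {a : D} (ha : a ∈ Subring.closure s) :
    T a ∈ Subring.closure s := by
  have aux : ∀ γ : D ≃ₐ[ℂ] D, (∀ a ∈ s, γ a ∈ Subring.closure s) → ∀ a ∈ Subring.closure s,
      γ a ∈ Subring.closure s := by
    intro γ hγ a ha
    have : Subring.closure s ≤ (Subring.closure s).comap (γ : D →+* D) := Subring.closure_le.2 hγ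
    exact this ha
  have h1 : T 1 = 0 := by simpa using hT 1 1
  induction ha using Subring.closure_induction with
  | mem a ha => exact hTs a ha
  | zero => rw [map_zero]; exact zero_mem _
  | one => rw [h1]; exact zero_mem _
  | add a b _ _ ha hb => rw [map_add]; exact add_mem ha hb
  | neg a _ ha => rw [map_neg]; exact neg_mem ha
  | mul a b ha' hb' ha hb =>
    rw [hT]
    exact add_mem (mul_mem ha (aux β hβ b hb')) (mul_mem (aux α hα a ha') hb)

/-- The product rule of a derivation, in the form of a skew derivation. -/
theorem ExtendedAction.F_mul_refl (act : ExtendedAction φ) (a b : D) :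
    act.F (a * b) = act.F a * AlgEquiv.refl (R := ℂ) b + AlgEquiv.refl (R := ℂ) a * act.F b :=
  act.F_mul a b

/-- A set is stable under the action. -/
structure ExtendedAction.IsStable (act : ExtendedAction φ) (s t : Set D) : Prop where
  τ_mem : ∀ a ∈ s, act.τ a ∈ t
  τ_symm_mem : ∀ a ∈ s, act.τ.symm a ∈ t
  E_mem : ∀ a ∈ s, act.E a ∈ t
  F_mem : ∀ a ∈ s, act.F a ∈ t
  H_mem : ∀ a ∈ s, act.H a ∈ t

/-- The quotient rule expresses the operators on a fraction through their values on numerator and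
denominator and through `e^{±hF}`, all of which are again fractions. -/
theorem ExtendedAction.isStable_fractions (act : ExtendedAction φ) (S : Subfield D)
    (hφ : Function.Injective φ)
    (hS : ∀ d, d ∈ S ↔ ∃ a b, b ≠ 0 ∧ d = φ a * (φ b)⁻¹) :
    act.IsStable S S := by
  have hone : (1 : HAlg h I) ≠ 0 := by
    intro h0
    have := congrArg φ h0
    rw [map_one, map_zero] at this
    exact one_ne_zero this
  have hmem : ∀ a, φ a ∈ S := fun a => (hS _).2 ⟨a, 1, hone, by simp⟩
  have h0 : ∀ a, a ≠ 0 → φ a ≠ 0 := fun a ha h => ha ((injective_iff_map_eq_zero _).1 hφ a h)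
  have hτ : ∀ d ∈ S, act.τ d ∈ S := by
    intro d hd
    obtain ⟨a, b, -, rfl⟩ := (hS d).1 hd
    rw [map_mul, map_inv₀, act.τ_apply, act.τ_apply]
    exact mul_mem (hmem _) (inv_mem (hmem _))
  have hτ' : ∀ d ∈ S, act.τ.symm d ∈ S := by
    intro d hd
    obtain ⟨a, b, -, rfl⟩ := (hS d).1 hd
    rw [map_mul, map_inv₀, act.τ_symm_apply, act.τ_symm_apply]
    exact mul_mem (hmem _) (inv_mem (hmem _))
  have key : ∀ (T : D →ₗ[ℂ] D) (α β : D ≃ₐ[ℂ] D), (∀ a b, T (a * b) = T a * β b + α a * T b) →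
      (∀ d ∈ S, α d ∈ S) → (∀ d ∈ S, β d ∈ S) → (∀ a, T (φ a) ∈ S) → ∀ d ∈ S, T d ∈ S := by
    intro T α β hT hα hβ hTφ d hd
    obtain ⟨a, b, hb, rfl⟩ := (hS d).1 hd
    rw [skewDerivation_mul_inv hT _ (h0 b hb)]
    exact mul_mem (sub_mem (hTφ a) (mul_mem (hα _ hd) (hTφ b))) (inv_mem (hβ _ (hmem b)))
  refine ⟨hτ, hτ', key act.E act.τ act.τ.symm act.E_mul hτ hτ' fun a => ?_,
    key act.F _ _ act.F_mul_refl (fun _ => id) (fun _ => id) fun a => ?_,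
    key act.H act.τ act.τ.symm act.H_mul hτ hτ' fun a => ?_⟩
  · rw [act.E_apply]; exact hmem _
  · rw [act.F_apply]; exact hmem _
  · rw [act.H_apply]; exact hmem _

/-- By the product rules only the generators matter. Those in `t` are killed by the operators and
fixed by `e^{±hF}`. -/
theorem ExtendedAction.isStable_closure (act : ExtendedAction φ) (S : Subfield D)
    (hS : act.IsStable S S) {t : Set D} (ht : ∀ a ∈ t, act.IsInvariant a) :
    act.IsStable (Subring.closure ((S : Set D) ∪ t)) (Subring.closure ((S : Set D) ∪ t)) := by
  have hsub : ∀ a ∈ S, a ∈ Subring.closure ((S : Set D) ∪ t) := fun a ha =>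
    Subring.subset_closure (Or.inl ha)
  have hτ : ∀ a ∈ (S : Set D) ∪ t, act.τ a ∈ Subring.closure ((S : Set D) ∪ t) := by
    rintro a (ha | ha)
    · exact hsub _ (hS.τ_mem a ha)
    · rw [(ht a ha).2.2.2]; exact Subring.subset_closure (Or.inr ha)
  have hτ' : ∀ a ∈ (S : Set D) ∪ t, act.τ.symm a ∈ Subring.closure ((S : Set D) ∪ t) := by
    rintro a (ha | ha)
    · exact hsub _ (hS.τ_symm_mem a ha)
    · rw [(AlgEquiv.symm_apply_eq _).2 (ht a ha).2.2.2.symm]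
      exact Subring.subset_closure (Or.inr ha)
  have hγ : ∀ γ : D ≃ₐ[ℂ] D, (∀ a ∈ (S : Set D) ∪ t, γ a ∈ Subring.closure ((S : Set D) ∪ t)) →
      ∀ a ∈ Subring.closure ((S : Set D) ∪ t), γ a ∈ Subring.closure ((S : Set D) ∪ t) := by
    intro γ hγ a ha
    have : Subring.closure ((S : Set D) ∪ t) ≤
      (Subring.closure ((S : Set D) ∪ t)).comap (γ : D →+* D) := Subring.closure_le.2 hγ
    exact this ha
  have key : ∀ T : D →ₗ[ℂ] D, (∀ a ∈ S, T a ∈ S) → (∀ a ∈ t, T a = 0) →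
      ∀ a ∈ (S : Set D) ∪ t, T a ∈ Subring.closure ((S : Set D) ∪ t) := by
    rintro T hTS hTt a (ha | ha)
    · exact hsub _ (hTS a ha)
    · rw [hTt a ha]; exact zero_mem _
  refine ⟨hγ _ hτ, hγ _ hτ', fun a ha => ?_, fun a ha => ?_, fun a ha => ?_⟩
  · exact skewDerivation_mem_closure act.E_mul hτ hτ' (key _ hS.E_mem fun a ha => (ht a ha).1) ha
  · exact skewDerivation_mem_closure act.F_mul_refl (fun a ha => Subring.subset_closure ha)
      (fun a ha => Subring.subset_closure ha) (key _ hS.F_mem fun a ha => (ht a ha).2.1) ha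
  · exact skewDerivation_mem_closure act.H_mul hτ hτ' (key _ hS.H_mem fun a ha => (ht a ha).2.2.1) ha

/-- The restriction of an action to a stable skew subfield. -/
theorem ExtendedAction.exists_restrict {K : Type*} [DivisionRing K] [Algebra ℂ K]
    {D : Type u} [DivisionRing D] [Algebra ℂ D] {φ : HAlg h I →ₐ[ℂ] D}
    (act : ExtendedAction φ) (e : K →ₐ[ℂ] D) (ι : HAlg h I →ₐ[ℂ] K) (hι : ∀ a, e (ι a) = φ a)
    (hst : act.IsStable e.range e.range) :
    ∃ act' : ExtendedAction ι, ∀ a, act.IsInvariant (e a) → act'.IsInvariant a := by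
  have he : Function.Injective e := RingHom.injective e.toRingHom
  obtain ⟨E', hE⟩ := exists_linearMap_comp_eq e act.E hst.E_mem
  obtain ⟨F', hF⟩ := exists_linearMap_comp_eq e act.F hst.F_mem
  obtain ⟨H', hH⟩ := exists_linearMap_comp_eq e act.H hst.H_mem
  obtain ⟨t, ht⟩ := exists_algHom_comp_eq e ((act.τ : D →ₐ[ℂ] D).comp e)
    fun a => hst.τ_mem _ ⟨a, rfl⟩
  obtain ⟨t', ht'⟩ := exists_algHom_comp_eq e ((act.τ.symm : D →ₐ[ℂ] D).comp e)
    fun a => hst.τ_symm_mem _ ⟨a, rfl⟩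
  have ht1 : ∀ a, e (t a) = act.τ (e a) := ht
  have ht2 : ∀ a, e (t' a) = act.τ.symm (e a) := ht'
  let τ' : K ≃ₐ[ℂ] K := AlgEquiv.ofAlgHom t t'
    (AlgHom.ext fun a => he (by
      rw [AlgHom.comp_apply, ht1, ht2, AlgEquiv.apply_symm_apply, AlgHom.id_apply]))
    (AlgHom.ext fun a => he (by
      rw [AlgHom.comp_apply, ht2, ht1, AlgEquiv.symm_apply_apply, AlgHom.id_apply]))
  have hτ : ∀ a, e (τ' a) = act.τ (e a) := ht1
  have hτ' : ∀ a, e (τ'.symm a) = act.τ.symm (e a) := ht2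
  refine ⟨⟨τ', E', F', H', fun a => he ?_, fun a => he ?_, fun a => he ?_, fun a => he ?_,
    fun a b => he ?_, fun a b => he ?_, fun a b => he ?_⟩, fun a ha => ⟨he ?_, he ?_, he ?_, he ?_⟩⟩
  · rw [hτ, hι, act.τ_apply, hι]
  · rw [hE, hι, act.E_apply, hι]
  · rw [hF, hι, act.F_apply, hι]
  · rw [hH, hι, act.H_apply, hι]
  · rw [hE, map_mul, act.E_mul, map_add, map_mul, map_mul, hE, hE, hτ, hτ']
  · rw [hF, map_mul, act.F_mul, map_add, map_mul, map_mul, hF, hF]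
  · rw [hH, map_mul, act.H_mul, map_add, map_mul, map_mul, hH, hH, hτ, hτ']
  · rw [hE, ha.1, map_zero]
  · rw [hF, ha.2.1, map_zero]
  · rw [hH, ha.2.2.1, map_zero]
  · rw [hτ, ha.2.2.2]

end Stability

namespace ShiftAlg

/-- A skew field with an action that contains `H_I` and its algebraically closed field of
scalars. -/
theorem exists_skewField_model {L : Type u} [Field L] [Algebra ℂ L] {h : ℂ} (hh : h ≠ 0)
    {I : Type u} [LinearOrder I] (p s : I → L) (hps : AlgebraicIndependent ℂ (Sum.elim p s)) :
    ∃ (D : Type u) (_ : DivisionRing D) (_ : Algebra ℂ D) (ι : ShiftAlg L[X] →ₐ[ℂ] D)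
      (act : ExtendedAction (ι.comp (model h p s))),
      Function.Injective (ι.comp (model h p s)) ∧
      ∀ l : L, (∀ z, ι (algebraMap L _ l) * z = z * ι (algebraMap L _ l)) ∧
        act.IsInvariant (ι (algebraMap L _ l)) := by
  obtain ⟨D, _, _, ι, hι, hcent, hder⟩ := exists_skewField L[X]
  obtain ⟨F, hF, hF'⟩ := hder (derX h) (derX_mul h)
  obtain ⟨δ, hδ, hδ'⟩ := hder (derCoeff (derParam L)) (derCoeff_mul _)
  let v : Dˣ := Units.map (ι : ShiftAlg L[X] →* D) (yUnit L[X])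
  have hcent' : ∀ l z, ι (algebraMap L _ l) * z = z * ι (algebraMap L _ l) := fun l z =>
    hcent _ (fun b => Algebra.commutes l b) z
  let act : ExtendedAction (ι.comp (model h p s)) :=
    { τ := conjAlgEquiv v
      E := twistedDer v (ι (wE L[X] h)) δ
      F := F
      H := twistedDer v (ι (wH L[X])) 0
      τ_apply := fun a => by
        have := congrArg ι (realize_shift h (fun i => C (p i) + C (s i) * X) (fun i => C (s i)) a)
        rw [map_mul, map_mul] at this
        exact this.symm
      E_apply := fun a => by
        rw [AlgHom.comp_apply, map_twistedDer ι _ _ _ _ hδ', model_opE]; rfl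
      F_apply := fun a => by rw [AlgHom.comp_apply, hF', model_opF hh]; rfl
      H_apply := fun a => by
        rw [AlgHom.comp_apply, map_twistedDer ι _ _ 0 0 (fun _ => (map_zero ι).symm), model_opH]
        rfl
      E_mul := fun a b => twistedDer_mul _ _ _ hδ a b
      F_mul := hF
      H_mul := fun a b => twistedDer_mul _ _ 0 (fun _ _ => by simp) a b }
  refine ⟨D, _, _, ι, act, hι.comp (model_injective h p s hps), fun l => ⟨hcent' l, ?_, ?_, ?_, ?_⟩⟩
  · refine twistedDer_central _ _ _ (hcent' l _) ?_
    rw [hδ', algebraMap_param, derCoeff_mono, polyDer_C, derParam_apply, derivative_C, C_0,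
      map_zero, map_zero]
  · change F _ = 0
    rw [hF', algebraMap_param, derX, mapCoeff_mono]
    simp
  · exact twistedDer_central _ _ _ (hcent' l _) rfl
  · change ↑v⁻¹ * ι (algebraMap L _ l) * ↑v = ι (algebraMap L _ l)
    rw [← hcent', mul_assoc, Units.inv_mul, mul_one]

end ShiftAlg

/-- The variables of a rational function field stay independent in its algebraic closure. -/
theorem exists_algebraicIndependent (J : Type u) :
    ∃ (L : Type u) (_ : Field L) (_ : Algebra ℂ L) (_ : IsAlgClosed L) (v : J → L),
      AlgebraicIndependent ℂ v := by
  let F := FractionRing (MvPolynomial J ℂ)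
  let f : MvPolynomial J ℂ →ₐ[ℂ] AlgebraicClosure F :=
    (IsScalarTower.toAlgHom ℂ F (AlgebraicClosure F)).comp
      (IsScalarTower.toAlgHom ℂ (MvPolynomial J ℂ) F)
  have hf : Function.Injective f :=
    (algebraMap F (AlgebraicClosure F)).injective.comp (IsFractionRing.injective _ F)
  exact ⟨AlgebraicClosure F, inferInstance, inferInstance, inferInstance, _,
    (MvPolynomial.algebraicIndependent_X J ℂ).map' hf⟩

/-- The linear form is additive in its coordinates. The pair `(-d - h b, b)` gives `x b + y d`, the
pair `(x_l, y_l)` gives the bracket, and the central `σ` can be pulled out. -/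
theorem linForm_sub_mul {h : ℂ} {I : Type u} [LinearOrder I] {K : Type*} [DivisionRing K]
    [Algebra ℂ K] (ι : HAlg h I →ₐ[ℂ] K) {k l : I} {σ : K} (hσ : ∀ z, σ * z = z * σ)
    (b d : HAlg h I) :
    linForm ι k (ι (-d - h • b) - σ * ι (x h l)) (ι b - σ * ι (y h l)) =
      ι (x h k * b + y h k * d) - σ * ι (bracket h k l) := by
  have e : ∀ a c : HAlg h I, ι a * (σ * ι c) = σ * ι (a * c) := fun a c => by
    rw [← mul_assoc, ← hσ, mul_assoc, map_mul]
  rw [linForm, bracket]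
  simp only [mul_sub, e, map_sub, map_add, map_neg, map_smul, map_mul, mul_neg, mul_smul_comm,
    smul_sub]
  abel

end NCForm

/-! ### The factorization theorem: descent from the big skew field. -/

theorem theorem14 {I : Type u} [LinearOrder I] (h : ℂ) (hh : h ≠ 0) (i₀ i₁ : I) (h01 : i₀ ≠ i₁) :
    -- the quotient division ring `Q = Q_I` of `H_I`
    ∃ (Q : Type u) (_ : DivisionRing Q) (_ : Algebra ℂ Q) (κ : NCForm.HAlg h I →ₐ[ℂ] Q),
      NCForm.IsRightQuotientDivisionRing κ ∧
      ∀ (n : ℕ) (f : NCForm.HAlg h I), NCForm.IsForm h i₀ {i₀, i₁}ᶜ n f →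
        -- the skew field `K = Q_I[σ_1, …, σ_n]`, with the embedding `ι` of `H_I`
        ∃ (K : Type u) (_ : DivisionRing K) (_ : Algebra ℂ K) (j : Q →ₐ[ℂ] K)
          (ι : NCForm.HAlg h I →ₐ[ℂ] K) (act : NCForm.ExtendedAction ι)
          (σ X Y : Fin n → K) (C : K),
          ι = j.comp κ ∧
          -- `K` is generated over `Q_I` by the central invariant elements `σ i`
          Subring.closure (Set.range j ∪ Set.range σ) = ⊤ ∧
          (∀ i, ∀ z : K, σ i * z = z * σ i) ∧
          (∀ i, act.IsInvariant (σ i)) ∧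
          -- the `σ i` are the roots of a polynomial over the invariants of `Q_{I∖{0}}`
          (∀ k, ((List.ofFn fun i => (Polynomial.X - Polynomial.C (σ i) : Polynomial K)).prod).coeff k
            ∈ NCForm.invQ act {i₀}ᶜ) ∧
          (∀ i, X i ∈ NCForm.adjoinRoots ι {i₀}ᶜ σ ∧ Y i ∈ NCForm.adjoinRoots ι {i₀}ᶜ σ) ∧
          -- the factors are `ξ - σ_i η` with `ξ = P_{01}^{n-1} f`, `η = (01)`
          (∀ i, NCForm.linForm ι i₀ (X i) (Y i) =
            ι (NCForm.polar h i₀ i₁ n (n - 1) f) - σ i * ι (NCForm.bracket h i₀ i₁)) ∧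
          (∀ i k, NCForm.linForm ι i₀ (X i) (Y i) * NCForm.linForm ι i₀ (X k) (Y k) =
            NCForm.linForm ι i₀ (X k) (Y k) * NCForm.linForm ι i₀ (X i) (Y i)) ∧
          (∀ i, act.IsInvariant (NCForm.linForm ι i₀ (X i) (Y i))) ∧
          C = ι (NCForm.polar h i₀ i₁ n n f) ^ (1 - (n : ℤ)) ∧
          C ∈ NCForm.invQ act {i₀}ᶜ ∧
          ι f = C * (List.ofFn fun i => NCForm.linForm ι i₀ (X i) (Y i)).prod := by
  obtain ⟨L, _, _, _, v, hv⟩ := NCForm.exists_algebraicIndependent (I ⊕ I)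
  let p : I → L := fun i => v (Sum.inl i)
  let s : I → L := fun i => v (Sum.inr i)
  have hps : AlgebraicIndependent ℂ (Sum.elim p s) := by
    convert hv using 1
    ext (i | i) <;> rfl
  obtain ⟨D, _, _, ε, act, hφ, hL⟩ := NCForm.ShiftAlg.exists_skewField_model hh p s hps
  let φ := ε.comp (NCForm.ShiftAlg.model h p s)
  let Λ : L →+* D := (ε : NCForm.ShiftAlg L[X] →+* D).comp (algebraMap L (NCForm.ShiftAlg L[X]))
  have hΛ : ∀ l z, Λ l * z = z * Λ l := fun l => (hL l).1
  have hΛact : ∀ l, act.IsInvariant (Λ l) := fun l => (hL l).2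
  -- `Q` is realized inside `D` as the right fractions of `H_I`, which has common right multiples by
  -- polynomial growth.
  obtain ⟨S, hS⟩ := NCForm.exists_subfield_fractions φ hφ fun a b ha hb =>
    NCForm.ShiftAlg.exists_right_common_multiple _ (NCForm.ShiftAlg.model_injective h p s hps) ha hb
  have hone : (1 : NCForm.HAlg h I) ≠ 0 := by
    intro h0
    have := congrArg φ h0
    rw [map_one, map_zero] at this
    exact one_ne_zero this
  have hφS : ∀ a, φ a ∈ S := fun a => (hS _).2 ⟨a, 1, hone, by simp⟩
  have hCS : ∀ c : ℂ, algebraMap ℂ D c ∈ S := fun c => by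
    rw [← AlgHom.commutes φ c]; exact hφS _
  obtain ⟨Q, _, _, eQ, heQ⟩ := NCForm.exists_divisionRing_of_subfield S hCS
  have heQinj : Function.Injective eQ := RingHom.injective eQ.toRingHom
  obtain ⟨κ, hκ⟩ := NCForm.exists_algHom_comp_eq eQ φ fun a => (heQ _).2 (hφS a)
  refine ⟨Q, _, _, κ, ⟨fun a b hab => hφ ?_, fun q => ?_⟩, fun n f hf => ?_⟩
  · change φ a = φ b
    rw [← hκ, hab, hκ]
  · obtain ⟨a, b, hb, hab⟩ := (hS _).1 ((heQ _).1 ⟨q, rfl⟩)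
    refine ⟨a, b, hb, heQinj ?_⟩
    rw [map_mul, map_inv₀, hκ, hκ]
    exact hab
  obtain ⟨r, c, ξ, η, σ, hr, hc, hc0, hξ, hη, hrσ, hcoeff⟩ :=
    NCForm.ShiftAlg.exists_factorization hh h01 hps hf
  have hφr : φ f = Λ r := congrArg ε hr
  have hφc : φ (NCForm.polar h i₀ i₁ n n f) = Λ c := congrArg ε hc
  have hφξ : φ (NCForm.polar h i₀ i₁ n (n - 1) f) = Λ ξ := congrArg ε hξ
  have hφη : φ (NCForm.bracket h i₀ i₁) = Λ η := congrArg ε hη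
  have hΛc : Λ c ≠ 0 := (map_ne_zero_iff Λ Λ.injective).2 hc0
  -- Dividing by the nonzero scalar of the last polar places the coefficients in the skew field of
  -- `H_{I∖{0}}`.
  have hcoeff' : ∀ m, ∃ a ∈ NCForm.subH h {i₀}ᶜ, Λ ((∏ i, (X - C (σ i))).coeff m) =
      φ a * (φ (NCForm.polar h i₀ i₁ n n f))⁻¹ := by
    intro m
    obtain ⟨a, ha, hac⟩ := hcoeff m
    refine ⟨a, ha, ?_⟩
    have : φ a = Λ ((∏ i, (X - C (σ i))).coeff m * c) := congrArg ε hac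
    rw [this, hφc, map_mul, mul_assoc, mul_inv_cancel₀ hΛc, mul_one]
  obtain ⟨T, hT⟩ := NCForm.exists_subfield_adjoin S Λ hΛ σ fun m => by
    obtain ⟨a, -, ha⟩ := hcoeff' m
    rw [ha]
    exact mul_mem (hφS _) (inv_mem (hφS _))
  have hT' : ∀ d, d ∈ T ↔ d ∈ Subring.closure ((S : Set D) ∪ Set.range fun i => Λ (σ i)) :=
    fun d => by rw [← hT]; rfl
  have hST : ∀ d ∈ S, d ∈ T := fun d hd => (hT' d).2 (Subring.subset_closure (Or.inl hd))
  obtain ⟨K, _, _, e, he⟩ := NCForm.exists_divisionRing_of_subfield T fun c => hST _ (hCS c)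
  have heinj : Function.Injective e := RingHom.injective e.toRingHom
  obtain ⟨j, hj⟩ := NCForm.exists_algHom_comp_eq e eQ fun a => (he _).2 (hST _ ((heQ _).1 ⟨a, rfl⟩))
  let ι := j.comp κ
  have hι : ∀ a, e (ι a) = φ a := fun a => by rw [AlgHom.comp_apply, hj, hκ]
  have hrange : (e.range : Set D) =
      Subring.closure ((S : Set D) ∪ Set.range fun i => Λ (σ i)) := by
    ext d
    exact (he d).trans (hT' d)
  obtain ⟨act', hact'⟩ := act.exists_restrict e ι hι (by
    have := act.isStable_closure S (act.isStable_fractions S hφ hS)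
      (t := Set.range fun i => Λ (σ i)) (by rintro _ ⟨i, rfl⟩; exact hΛact _)
    rw [← hrange] at this
    exact this)
  -- The field `L` need not lie in `K`. Invariance in `K` is read off whenever an element becomes a
  -- scalar of `L` in `D`.
  have hinv : ∀ (z : K) (l : L), e z = Λ l → act'.IsInvariant z := fun z l hz =>
    hact' z (hz ▸ hΛact l)
  have hσK : ∀ i, ∃ z : K, e z = Λ (σ i) := fun i =>
    (he _).2 ((hT' _).2 (Subring.subset_closure (Or.inr ⟨i, rfl⟩)))
  choose ς hς using hσK
  have hςc : ∀ i z, ς i * z = z * ς i := fun i z => heinj (by rw [map_mul, map_mul, hς, hΛ])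
  have hsubQ : ∀ a ∈ NCForm.subH h {i₀}ᶜ, ι a ∈ NCForm.subQ ι {i₀}ᶜ := fun a ha =>
    Subfield.subset_closure ⟨a, ha, rfl⟩
  have hsubR : ∀ a ∈ NCForm.subH h {i₀}ᶜ, ι a ∈ NCForm.adjoinRoots ι {i₀}ᶜ ς := fun a ha =>
    Subring.subset_closure (Or.inl (hsubQ a ha))
  have hςR : ∀ i, ς i ∈ NCForm.adjoinRoots ι {i₀}ᶜ ς := fun i =>
    Subring.subset_closure (Or.inr ⟨i, rfl⟩)
  have hi₁ : i₁ ∈ ({i₀}ᶜ : Set I) := h01.symm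
  -- For `n = 0` there are no factors, and `b = d = 0` are mere placeholders.
  obtain ⟨b, hb, d, hd, hbd⟩ : ∃ b ∈ NCForm.subH h {i₀}ᶜ, ∃ d ∈ NCForm.subH h {i₀}ᶜ,
      n ≠ 0 → NCForm.polar h i₀ i₁ n (n - 1) f = NCForm.x h i₀ * b + NCForm.y h i₀ * d := by
    by_cases hn : n = 0
    · exact ⟨0, zero_mem _, 0, zero_mem _, fun hn' => absurd hn hn'⟩
    · obtain ⟨b, hb, d, hd, hbd, -⟩ := hf.exists_polar_pred h01 hn
      exact ⟨b, hb, d, hd, fun _ => hbd⟩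
  have hbh : -d - h • b ∈ NCForm.subH h {i₀}ᶜ := sub_mem (neg_mem hd) (Subalgebra.smul_mem _ hb h)
  let Xf : Fin n → K := fun i => ι (-d - h • b) - ς i * ι (NCForm.x h i₁)
  let Yf : Fin n → K := fun i => ι b - ς i * ι (NCForm.y h i₁)
  have hlin : ∀ i, NCForm.linForm ι i₀ (Xf i) (Yf i) =
      ι (NCForm.polar h i₀ i₁ n (n - 1) f) - ς i * ι (NCForm.bracket h i₀ i₁) := fun i => by
    rw [hbd (Fin.pos i).ne']
    exact NCForm.linForm_sub_mul ι (hςc i) b d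
  have helin : ∀ i, e (NCForm.linForm ι i₀ (Xf i) (Yf i)) = Λ (ξ - σ i * η) := fun i => by
    rw [hlin, map_sub, map_mul, hι, hι, hς, hφξ, hφη, map_sub, map_mul]
  have heC : e (ι (NCForm.polar h i₀ i₁ n n f) ^ (1 - (n : ℤ))) = Λ (c ^ (1 - (n : ℤ))) := by
    rw [map_zpow₀, hι, hφc, map_zpow₀]
  -- Over the noncommutative `K` the product is taken along a list. Its image in `D` is that of the
  -- ordinary product over the field `L`.
  have hecoeff : ∀ m, e (((List.ofFn fun i => (X - C (ς i) : K[X])).prod).coeff m) =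
      Λ ((∏ i, (X - C (σ i))).coeff m) := by
    intro m
    have h1 : ((List.ofFn fun i => (X - C (ς i) : K[X])).prod).map (e : K →+* D) =
        (∏ i, (X - C (σ i))).map Λ := by
      rw [← List.prod_ofFn, ← coe_mapRingHom, ← coe_mapRingHom, map_list_prod, map_list_prod,
        List.map_ofFn, List.map_ofFn]
      congr 2
      funext i
      simp [hς]
    have h2 := congrArg (fun P => P.coeff m) h1
    rw [coeff_map, coeff_map] at h2
    exact h2
  refine ⟨K, _, _, j, ι, act', ς, Xf, Yf, _, rfl, ?_, hςc, fun i => hinv _ _ (hς i), fun m => ?_,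
    fun i => ⟨sub_mem (hsubR _ hbh) (mul_mem (hςR i) (hsubR _ (NCForm.x_mem_subH h hi₁))),
      sub_mem (hsubR _ hb) (mul_mem (hςR i) (hsubR _ (NCForm.y_mem_subH h hi₁)))⟩,
    hlin, fun i m => heinj ?_, fun i => hinv _ _ (helin i), rfl,
    ⟨zpow_mem (hsubQ _ (hf.polar_mem h01)) _, hinv _ _ heC⟩, heinj ?_⟩
  · refine eq_top_iff.2 fun z _ => ?_
    have hz : e z ∈ Subring.closure ((S : Set D) ∪ Set.range fun i => Λ (σ i)) :=
      (hT' _).1 ((he _).1 ⟨z, rfl⟩)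
    -- Generation is transferred from `D`: the generators of the image of `K` come from `Q` and the
    -- `ς i`, and `e` is injective.
    have hsub : Subring.closure ((S : Set D) ∪ Set.range fun i => Λ (σ i)) ≤
        (Subring.closure (Set.range j ∪ Set.range ς)).map (e : K →+* D) := by
      refine Subring.closure_le.2 ?_
      rintro _ (ha | ⟨i, rfl⟩)
      · obtain ⟨q, rfl⟩ := (heQ _).2 ha
        exact ⟨j q, Subring.subset_closure (Or.inl ⟨q, rfl⟩), hj q⟩
      · exact ⟨ς i, Subring.subset_closure (Or.inr ⟨i, rfl⟩), hς i⟩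
    obtain ⟨z', hz', hzz⟩ := hsub hz
    rwa [← heinj hzz]
  · refine ⟨?_, hinv _ _ (hecoeff m)⟩
    obtain ⟨a, ha, hac⟩ := hcoeff' m
    have : ((List.ofFn fun i => (X - C (ς i) : K[X])).prod).coeff m =
        ι a * (ι (NCForm.polar h i₀ i₁ n n f))⁻¹ := heinj (by
      rw [hecoeff, hac, map_mul, map_inv₀, hι, hι])
    rw [this]
    exact mul_mem (hsubQ a ha) (inv_mem (hsubQ _ (hf.polar_mem h01)))
  · rw [map_mul, map_mul, helin, helin, hΛ]
  · rw [hι, hφr, hrσ, map_mul, map_mul, heC, map_list_prod, List.map_ofFn, ← List.prod_ofFn,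
      map_list_prod, List.map_ofFn]
    congr 3
    funext i
    exact (helin i).symm
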